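/- Let $\mathcal X$ be a standard Borel space and let $\mathcal F$ be a set of measurable functions $f:\mathcal X\to\{0,1\}$ of VC dimension $1$. Assume that for every $T$ the map $(x_t,y_t)_{t\le T}\mapsto \inf_{f\in\mathcal F}\sum_{t\le T}\mathbb 1[f(x_t)\ne y_t]$ is measurable on $(\mathcal X\times\{0,1\})^T$, so that the adaptive regret below is well defined. **Protocol.** A distribution class $\mathcal U$ is a set of probability measures on $\mathcal X$. In round $t=1,\dots,T$ an adversary selects $\mu_t\in\mathcal U$ and a measurable $f_t:\mathcal X\to\{0,1\}$; $x_t\sim\mu_t$ is drawn; the (possibly randomized) learner predicts $\hat y_t\in\{0,1\}$ from $x_t$ and $(x_s,y_s,\hat y_s)_{s<t}$; then $y_t=f_t(x_t)$ is revealed. An oblivious adversary fixes all $\mu_t,f_t$ in advance; an adaptive adversary chooses them as measurable functions of $(x_s,\hat y_s)_{s<t}$. For a learner $\mathcal L$ and an adversary $\mathcal A$, the regrets are $$\mathrm{Reg}^{\mathrm{ob}}_T=\mathbb E\Big[\sum_{t\le T}\mathbb 1[\hat y_t\ne y_t]\Big]-\inf_{f\in\mathcal F}\mathbb E\Big[\sum_{t\le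 T}\mathbb 1[f(x_t)\ne y_t]\Big],\qquad \mathrm{Reg}^{\mathrm{ad}}_T=\mathbb E\Big[\sum_{t\le T}\mathbb 1[\hat y_t\ne y_t]-\inf_{f\in\mathcal F}\sum_{t\le T}\mathbb 1[f(x_t)\ne y_t]\Big].$$ There are four settings: adversaries are oblivious (with regret $\mathrm{Reg}^{\mathrm{ob}}$) or adaptive (with regret $\mathrm{Reg}^{\mathrm{ad}}$), and either arbitrary (agnostic) or realizable, meaning that almost surely some $f\in\mathcal F$ (fixed in advance in the oblivious case) satisfies $f(x_t)=y_t$ for all $t\le T$. In a given setting, $(\mathcal F,\mathcal U)$ is *learnable* if $\frac1T\inf_{\mathcal L}\sup_{\mathcal A}\mathrm{Reg}_T(\mathcal L,\mathcal A)\to0$ as $T\to\infty$, and a family of learners $(\mathcal L_T)_T$, one for each horizon, is an *optimistic learner* for $\mathcal F$ if $\frac1T\sup_{\mathcal A}\mathrm{Reg}_T(\mathcal L_T,\mathcal A)\to0$ for every $\mathcal U$ such that $(\mathcal F,\mathcal U)$ is learnable in that setting. **Algorithm.** For $r\in\mathcal F$ write $x\preceq_r y$ if every $f\in\mathcal F$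 with $f(y)\ne r(y)$ satisfies $f(x)\ne r(x)$. This is the tree (pre)order of $\mathcal F$ after relabelling by $r$: all the sets $\{f\neq r\}$ are initial segments. For a set of times $S\subseteq\{1,\dots,T\}$, the expert $E(S)$ predicts, at time $t$, the label $r(x_t)$ if $S$ contains no time $s\le t$, and otherwise predicts $r(x_t)\oplus\mathbb 1[x_t\preceq_r x_s]$ with $s=\max\{s'\in S:s'\le t\}$. Let $\mathcal L_T$ be Hedge over the $N$ experts $E(S)$ with $|S|\le\sqrt T$: at time $t$ it follows an expert drawn, independently of the past, with probability proportional to $e^{-\eta L_{t,S}}$, where $L_{t,S}$ is the number of mistakes of $E(S)$ before time $t$ and $\eta=\sqrt{8\log N/T}$. **Proposition.** There is $r\in\mathcal F$ such that the family $(\mathcal L_T)_T$, which does not depend on $\mathcal U$, is an optimistic learner for $\mathcal F$ simultaneously in all four settings. In particular $\mathcal F$ is optimistically learnable for both oblivious and adaptive adversaries, with the same algorithm. -/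

import Mathlib

open MeasureTheory ProbabilityTheory Filter Topology

namespace DistOnline

/-! ### Function classes and VC dimension -/

/-- `F` shatters the finite set `s`: every labelling of `s` is realized by some member of `F`. -/
def Shatters {X : Type*} (F : Set (X → Bool)) (s : Finset X) : Prop :=
  ∀ b : X → Bool, ∃ f ∈ F, ∀ x ∈ s, f x = b x

/-- The VC dimension: the supremum of the cardinalities of the shattered finite sets. -/
noncomputable def vcDim {X : Type*} (F : Set (X → Bool)) : ℕ∞ :=
  ⨆ (s : Finset X) (_ : Shatters F s), (s.card : ℕ∞)

/-- The number of errors of `f` on a labelled sample. -/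
noncomputable def errors {X : Type*} (f : X → Bool) {t : ℕ} (D : Fin t → X × Bool) : ℝ :=
  ∑ s, if f (D s).1 ≠ (D s).2 then 1 else 0

/-- The loss `inf_{f ∈ F} ∑ₛ 𝟙[f(xₛ) ≠ yₛ]` of the best function in hindsight. -/
noncomputable def bestLoss {X : Type*} (F : Set (X → Bool)) {t : ℕ} (D : Fin t → X × Bool) : ℝ :=
  ⨅ f : F, errors f.1 D

/-! ### The online protocol -/

/-- The record `(x, y, ŷ)` of a round: instance, true label, prediction of the learner. -/
abbrev Round (X : Type*) := X × Bool × Bool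

/-- A history of `t` rounds. -/
abbrev Hist (X : Type*) (t : ℕ) := Fin t → Round X

/-- The labelled sample `(x_s, y_s)` of a history. -/
def sample {X : Type*} {t : ℕ} (h : Hist X t) : Fin t → X × Bool := fun s => ((h s).1, (h s).2.1)

/-- The part `(x_s, ŷ_s)` of a history; it determines the labels, given the adversary. -/
def played {X : Type*} {t : ℕ} (h : Hist X t) : Fin t → X × Bool := fun s => ((h s).1, (h s).2.2)

/-- A (randomized) learner: in each round, a Markov kernel that draws the prediction from the
history and the current instance. For the horizon `T` only the rounds `0, …, T - 1` matter. -/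
structure Learner (X : Type*) [MeasurableSpace X] where
  predict : ∀ t : ℕ, Kernel (Hist X t × X) Bool
  markov : ∀ t, IsMarkovKernel (predict t)

/-- An adaptive adversary for the distribution class `U`: in each round it selects a distribution
in `U` and a value function, both measurably in the past instances and predictions.
(The measurable structure on distributions is generated by the evaluations `μ ↦ μ B`; on a
standard Borel space it is the Borel structure of the weak topology.) -/
structure AdaptiveAdversary {X : Type*} [MeasurableSpace X] (U : Set (ProbabilityMeasure X)) where
  dist : ∀ t : ℕ, (Fin t → X × Bool) → ProbabilityMeasure X
  dist_mem : ∀ t h, dist t h ∈ U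
  measurable_dist : ∀ t, Measurable fun h => (dist t h : Measure X)
  label : ∀ t : ℕ, (Fin t → X × Bool) → X → Bool
  measurable_label : ∀ t, Measurable fun p : (Fin t → X × Bool) × X => label t p.1 p.2

/-- An oblivious adversary for `U`: distributions in `U` and value functions fixed in advance. -/
structure ObliviousAdversary {X : Type*} [MeasurableSpace X] (U : Set (ProbabilityMeasure X)) where
  dist : ℕ → ProbabilityMeasure X
  dist_mem : ∀ t, dist t ∈ U
  label : ℕ → X → Bool
  measurable_label : ∀ t, Measurable (label t)

/-- An oblivious adversary as an adaptive one that ignores the history. -/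
def ObliviousAdversary.toAdaptive {X : Type*} [MeasurableSpace X] {U : Set (ProbabilityMeasure X)}
    (A : ObliviousAdversary U) : AdaptiveAdversary U where
  dist t _ := A.dist t
  dist_mem t _ := A.dist_mem t
  measurable_dist _ := measurable_const
  label t _ := A.label t
  measurable_label t := (A.measurable_label t).comp measurable_snd

theorem measurable_played {X : Type*} [MeasurableSpace X] {t : ℕ} :
    Measurable (played : Hist X t → Fin t → X × Bool) := by
  unfold played
  fun_prop

/-- The kernel that draws the instance of round `t` given the history. -/
noncomputable def AdaptiveAdversary.instanceKernel {X : Type*} [MeasurableSpace X]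
    {U : Set (ProbabilityMeasure X)} (A : AdaptiveAdversary U) (t : ℕ) : Kernel (Hist X t) X where
  toFun h := A.dist t (played h)
  measurable' := (A.measurable_dist t).comp measurable_played

/-- Extend a history by the instance and the prediction of round `t`; the label is the value of
the function chosen by the adversary. -/
def AdaptiveAdversary.extend {X : Type*} [MeasurableSpace X]
    {U : Set (ProbabilityMeasure X)} (A : AdaptiveAdversary U) (t : ℕ)
    (p : Hist X t × (X × Bool)) : Hist X (t + 1) :=
  Fin.snoc (α := fun _ => Round X) p.1 (p.2.1, A.label t (played p.1) p.2.1, p.2.2)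

/-- The law of the history of the first `t` rounds of the game between `L` and `A`: in each round
`x ∼ μ_t` is drawn, and then the learner draws its prediction. -/
noncomputable def play {X : Type*} [MeasurableSpace X] {U : Set (ProbabilityMeasure X)}
    (L : Learner X) (A : AdaptiveAdversary U) : ∀ t : ℕ, Measure (Hist X t)
  | 0 => Measure.dirac Fin.elim0
  | t + 1 => ((play L A t).compProd ((A.instanceKernel t).compProd (L.predict t))).map (A.extend t)

/-- The number of mistakes of the learner. -/
noncomputable def mistakes {X : Type*} {t : ℕ} (h : Hist X t) : ℝ :=
  ∑ s, if (h s).2.2 ≠ (h s).2.1 then 1 else 0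

/-- The adaptive regret, against the best function a posteriori. -/
noncomputable def adaptiveRegret {X : Type*} [MeasurableSpace X] {U : Set (ProbabilityMeasure X)}
    (F : Set (X → Bool)) (T : ℕ) (L : Learner X) (A : AdaptiveAdversary U) : ℝ :=
  ∫ h, (mistakes h - bestLoss F (sample h)) ∂(play L A T)

/-- The oblivious regret, against the best function a priori. -/
noncomputable def obliviousRegret {X : Type*} [MeasurableSpace X] {U : Set (ProbabilityMeasure X)}
    (F : Set (X → Bool)) (T : ℕ) (L : Learner X) (A : ObliviousAdversary U) : ℝ :=
  ∫ h, mistakes h ∂(play L A.toAdaptive T) -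
    ⨅ f : F, ∫ h, errors f.1 (sample h) ∂(play L A.toAdaptive T)

/-! ### Learnability and optimistic learners -/

/-- The four settings: oblivious or adaptive adversaries, agnostic or realizable. -/
inductive Setting
  | obliviousAgnostic
  | obliviousRealizable
  | adaptiveAgnostic
  | adaptiveRealizable

/-- The regrets over the horizon `T` that the adversaries of a setting inflict on `L`.
Realizable means: almost surely, some function in the class (fixed in advance in the oblivious
case) makes no error. -/
def regrets {X : Type*} [MeasurableSpace X] (F : Set (X → Bool)) (U : Set (ProbabilityMeasure X))
    (T : ℕ) (L : Learner X) : Setting → Set ℝ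
  | .obliviousAgnostic => {ρ | ∃ A : ObliviousAdversary U, ρ = obliviousRegret F T L A}
  | .obliviousRealizable => {ρ | ∃ A : ObliviousAdversary U,
      (∃ f ∈ F, ∀ᵐ h ∂(play L A.toAdaptive T), ∀ s : Fin T, f (h s).1 = (h s).2.1) ∧
      ρ = obliviousRegret F T L A}
  | .adaptiveAgnostic => {ρ | ∃ A : AdaptiveAdversary U, ρ = adaptiveRegret F T L A}
  | .adaptiveRealizable => {ρ | ∃ A : AdaptiveAdversary U,
      (∀ᵐ h ∂(play L A T), bestLoss F (sample h) = 0) ∧ ρ = adaptiveRegret F T L A}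

/-- The worst-case regret of `L`. All regrets lie in `[-T, T]`. -/
noncomputable def worstRegret {X : Type*} [MeasurableSpace X] (F : Set (X → Bool))
    (U : Set (ProbabilityMeasure X)) (T : ℕ) (L : Learner X) (σ : Setting) : ℝ :=
  sSup (regrets F U T L σ)

/-- `(F, U)` is learnable in the setting `σ`: the minimax regret is sublinear. The learner may
depend on `F`, `U` and the horizon. -/
def Learnable {X : Type*} [MeasurableSpace X] (σ : Setting) (F : Set (X → Bool))
    (U : Set (ProbabilityMeasure X)) : Prop :=
  Tendsto (fun T : ℕ => (1 / (T : ℝ)) * ⨅ L : Learner X, worstRegret F U T L σ) atTop (𝓝 0)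

/-- The learner `L` (with strategy `L T` for the horizon `T`) is an optimistic learner for `F` in
the setting `σ`: it has sublinear worst-case regret for every `U` such that `(F, U)` is
learnable. -/
def IsOptimistic {X : Type*} [MeasurableSpace X] (σ : Setting) (F : Set (X → Bool))
    (L : ℕ → Learner X) : Prop :=
  ∀ U : Set (ProbabilityMeasure X), Learnable σ F U →
    Tendsto (fun T : ℕ => (1 / (T : ℝ)) * worstRegret F U T (L T) σ) atTop (𝓝 0)

/-! ### Hedge over initial-segment experts -/

/-- The tree (pre)order of `F` relabelled by `r`: the largest preorder for which all the sets
`{f ≠ r}`, `f ∈ F`, are initial segments. -/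
def TreeLE {X : Type*} (F : Set (X → Bool)) (r : X → Bool) (x y : X) : Prop :=
  ∀ f ∈ F, f y ≠ r y → f x ≠ r x

open Classical in
/-- The prediction of the expert `E(S)` at time `t` on the instances `z 0, …, z t`. If `s` is the
last time in `S` up to `t`, the relabelled prediction is `𝟙[z t ≼ z s]`; if there is no such time,
it is `0`. -/
noncomputable def expertPredict {X : Type*} (F : Set (X → Bool)) (r : X → Bool) (S : Finset ℕ)
    {t : ℕ} (z : Fin (t + 1) → X) : Bool :=
  xor (r (z (Fin.last t)))
    (decide (∃ s : Fin (t + 1), (s : ℕ) ∈ S ∧ (∀ s' ∈ S, s' ≤ t → s' ≤ s) ∧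
      TreeLE F r (z (Fin.last t)) (z s)))

/-- The number of mistakes of the expert `E(S)` on a labelled sample. -/
noncomputable def expertLoss {X : Type*} (F : Set (X → Bool)) (r : X → Bool) (S : Finset ℕ)
    {t : ℕ} (D : Fin t → X × Bool) : ℝ :=
  ∑ s : Fin t, if expertPredict F r S (t := (s : ℕ))
    (fun i => (D (Fin.castLE s.isLt i)).1) ≠ (D s).2 then 1 else 0

/-- The experts for the horizon `T`: the sets of at most `√T` times. -/
def experts (T : ℕ) : Finset (Finset ℕ) :=
  (Finset.range T).powerset.filter fun S => S.card ≤ Nat.sqrt T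

/-- The learning rate of Hedge. -/
noncomputable def rate (T : ℕ) : ℝ := Real.sqrt (8 * Real.log (experts T).card / T)

/-- The probability that Hedge predicts `1` on the instance `x` after the labelled sample `D`. -/
noncomputable def hedgeProb {X : Type*} (F : Set (X → Bool)) (r : X → Bool) (T : ℕ) {t : ℕ}
    (D : Fin t → X × Bool) (x : X) : ℝ :=
  (∑ S ∈ experts T, if expertPredict F r S
      (Fin.snoc (α := fun _ => X) (fun s => (D s).1) x) = true
      then Real.exp (-rate T * expertLoss F r S D) else 0) /
    ∑ S ∈ experts T, Real.exp (-rate T * expertLoss F r S D)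

/-- For every horizon `T`, the strategy `L T` is Hedge over the experts `E(S)`, `|S| ≤ √T`. -/
def IsTreeHedge {X : Type*} [MeasurableSpace X] (F : Set (X → Bool)) (r : X → Bool)
    (L : ℕ → Learner X) : Prop :=
  ∀ T t : ℕ, t < T → ∀ (h : Hist X t) (x : X),
    (L T).predict t (h, x) {true} = ENNReal.ofReal (hedgeProb F r T (sample h) x)

end DistOnline

namespace DistOnline

/-! ### The tree order of a class of VC dimension one -/

section Order

variable {X : Type*} {F : Set (X → Bool)} {r : X → Bool}

/-! Any `r ∈ F` works. VC dimension one makes each set `{f ≠ r}` a chain as well as an initial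
segment of the tree order (`treeLE_total`). Learnability is decided by how far an adversary confined
to `U` can make the instances climb such chains unpredictably, and ladders measure this: from each
point of `B (j + 1)` one can step up to a point of `B j`, with a distribution in `U` that gives mass
at least `ε` to instances for which both labels leave a way to go on (`goodSet`). Ladders start at
the whole space in the adaptive settings and at some `{f ≠ r}` in the oblivious ones (`bases`). The
learner enters only on the two sides of the argument, never in the notion itself.

Tall ladders force regret, already in the realizable case. An adaptive adversary runs a binary
search along a path of the ladder, gives each free instance the label that the learner finds less
likely, and keeps a nonempty set of consistent functions (`exists_adaptiveAdversary`). An oblivious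
adversary cannot react to the instances. Below a fixed `f` the path is a chain, so it can choose
halves by expected error; it shrinks every half to a subsegment of mass at most `1 / M`, on which
the remaining functions can disagree. One final function then replaces all the labels at small cost
(`exists_obliviousAdversary`). Hence learnability excludes ladders of some height `K` for each `ε`
(`exists_not_hasLadder_of_learnable`).

Without ladders Hedge succeeds. For a fixed adversary, take extensions that are maximal up to null
sets; then `B K` is empty. By maximality, an instance rises from outside `B (j + 1)` into `B j` with
conditional probability below `2 * ε` (`measureReal_rise_lt`): otherwise a measurable section, with
a second independent sample as the next point, would enlarge the extension. An expert that tracks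
`f` updates only at instances outside the current level, hence at most `K` times, and loses to `f`
only at rises (`exists_follows`). An exponential moment bound, summed over all experts, controls the
rises simultaneously (`integral_mistakes_le_of_not_hasLadder`). Since `K ≤ √T` eventually and the
logarithm of the number of experts is `o(T)`, the average regret is at most `4 * ε + o(1)`. -/

theorem TreeLE.refl (F : Set (X → Bool)) (r : X → Bool) (x : X) : TreeLE F r x x :=
  fun _ _ h => h

theorem TreeLE.trans {x y z : X} (h : TreeLE F r x y) (h' : TreeLE F r y z) : TreeLE F r x z :=
  fun f hf hz => h f hf (h' f hf hz)

theorem exists_of_not_treeLE {x y : X} (h : ¬ TreeLE F r x y) :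
    ∃ f ∈ F, f y ≠ r y ∧ f x = r x := by
  simpa [TreeLE] using h

/-- The strict tree order. -/
def TreeLT (F : Set (X → Bool)) (r : X → Bool) (x y : X) : Prop :=
  TreeLE F r x y ∧ ¬ TreeLE F r y x

theorem Bool.eq_of_ne_of_ne {a b c : Bool} (h : a ≠ c) (h' : b ≠ c) : a = b := by
  revert a b c; decide

theorem card_le_of_shatters {n : ℕ} (hVC : vcDim F = n) {s : Finset X} (hs : Shatters F s) :
    s.card ≤ n := by
  have h : (s.card : ℕ∞) ≤ vcDim F := le_iSup₂ (f := fun (s : Finset X) (_ : Shatters F s) =>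
    (s.card : ℕ∞)) s hs
  rw [hVC] at h
  exact_mod_cast h

theorem nonempty_of_vcDim (hVC : vcDim F = 1) : F.Nonempty := by
  by_contra h
  rw [Set.not_nonempty_iff_eq_empty] at h
  subst h
  have : vcDim (∅ : Set (X → Bool)) = 0 := by
    simp [vcDim, Shatters]
  rw [this] at hVC
  exact zero_ne_one hVC

/-- Two points on which a member of the class differs from `r` are comparable. -/
theorem treeLE_total (hVC : vcDim F = 1) (hr : r ∈ F) {f : X → Bool} (hf : f ∈ F) {x y : X}
    (hx : f x ≠ r x) (hy : f y ≠ r y) : TreeLE F r x y ∨ TreeLE F r y x := by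
  by_contra! h
  obtain ⟨⟨g, hg, hgy, hgx⟩, g', hg', hgx', hgy'⟩ :=
    And.intro (exists_of_not_treeLE h.1) (exists_of_not_treeLE h.2)
  have hxy : x ≠ y := by
    rintro rfl
    exact h.1 (TreeLE.refl F r x)
  classical
  -- The four labellings come from `r`, the two witnesses of incomparability, and `f`.
  have hs : Shatters F {x, y} := by
    intro b
    by_cases h1 : b x = r x <;> by_cases h2 : b y = r y
    · exact ⟨r, hr, by simp [h1, h2]⟩
    · exact ⟨g, hg, by simp [h1, hgx, Bool.eq_of_ne_of_ne hgy h2]⟩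
    · exact ⟨g', hg', by simp [h2, hgy', Bool.eq_of_ne_of_ne hgx' h1]⟩
    · exact ⟨f, hf, by simp [Bool.eq_of_ne_of_ne hx h1, Bool.eq_of_ne_of_ne hy h2]⟩
  have := card_le_of_shatters (n := 1) (by simpa using hVC) hs
  rw [Finset.card_pair hxy] at this
  omega

theorem treeLT_of_not_treeLE (hVC : vcDim F = 1) (hr : r ∈ F) {f : X → Bool} (hf : f ∈ F) {x y : X}
    (hx : f x ≠ r x) (hy : f y ≠ r y) (h : ¬ TreeLE F r y x) : TreeLT F r x y :=
  ⟨(treeLE_total hVC hr hf hx hy).resolve_right h, h⟩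

/-! ### Losses in hindsight -/

theorem errors_nonneg (f : X → Bool) {t : ℕ} (D : Fin t → X × Bool) : 0 ≤ errors f D :=
  Finset.sum_nonneg fun _ _ => by split_ifs <;> norm_num

theorem errors_le (f : X → Bool) {t : ℕ} (D : Fin t → X × Bool) : errors f D ≤ t := by
  unfold errors
  calc _ ≤ ∑ _s : Fin t, (1 : ℝ) := Finset.sum_le_sum fun _ _ => by split_ifs <;> norm_num
    _ = t := by simp

theorem errors_eq_zero_iff {f : X → Bool} {t : ℕ} {D : Fin t → X × Bool} :
    errors f D = 0 ↔ ∀ s, f (D s).1 = (D s).2 := by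
  unfold errors
  rw [Finset.sum_eq_zero_iff_of_nonneg (fun _ _ => by split_ifs <;> norm_num)]
  simp

theorem bddBelow_errors {t : ℕ} (D : Fin t → X × Bool) :
    BddBelow (Set.range fun f : F => errors f.1 D) :=
  ⟨0, by rintro _ ⟨f, rfl⟩; exact errors_nonneg _ _⟩

theorem bestLoss_le {f : X → Bool} (hf : f ∈ F) {t : ℕ} (D : Fin t → X × Bool) :
    bestLoss F D ≤ errors f D :=
  ciInf_le (bddBelow_errors D) (⟨f, hf⟩ : F)

theorem bestLoss_nonneg {t : ℕ} (D : Fin t → X × Bool) : 0 ≤ bestLoss F D :=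
  Real.iInf_nonneg fun _ => errors_nonneg _ _

/-- The loss takes only the values `0, …, t`, so the infimum is a minimum. The adaptive comparator
can thus be an actual function, chosen separately for each history. -/
theorem exists_errors_eq_bestLoss (hF : F.Nonempty) {t : ℕ} (D : Fin t → X × Bool) :
    ∃ f ∈ F, errors f D = bestLoss F D := by
  have hfin : (Set.range fun f : F => errors f.1 D).Finite := by
    refine (Set.finite_range fun k : Fin (t + 1) => ((k : ℕ) : ℝ)).subset ?_
    rintro _ ⟨f, rfl⟩
    have h : errors f.1 D = ((Finset.univ.filter fun s => f.1 (D s).1 ≠ (D s).2).card : ℝ) := by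
      simp [errors, Finset.sum_ite]
    refine ⟨⟨(Finset.univ.filter fun s => f.1 (D s).1 ≠ (D s).2).card, ?_⟩, h.symm⟩
    exact Nat.lt_succ_of_le ((Finset.card_filter_le _ _).trans (by simp))
  have : Nonempty F := hF.to_subtype
  obtain ⟨f, hf⟩ := (Set.range_nonempty fun f : F => errors f.1 D).csInf_mem hfin
  exact ⟨f.1, f.2, hf⟩

theorem bestLoss_le_card (hF : F.Nonempty) {t : ℕ} (D : Fin t → X × Bool) : bestLoss F D ≤ t := by
  obtain ⟨f, -, h⟩ := exists_errors_eq_bestLoss hF D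
  exact h ▸ errors_le f D

theorem bestLoss_eq_zero_iff (hF : F.Nonempty) {t : ℕ} {D : Fin t → X × Bool} :
    bestLoss F D = 0 ↔ ∃ f ∈ F, ∀ s, f (D s).1 = (D s).2 := by
  constructor
  · intro h
    obtain ⟨f, hf, h'⟩ := exists_errors_eq_bestLoss hF D
    exact ⟨f, hf, errors_eq_zero_iff.1 (h'.trans h)⟩
  · rintro ⟨f, hf, h⟩
    exact le_antisymm ((bestLoss_le hf D).trans_eq (errors_eq_zero_iff.2 h)) (bestLoss_nonneg D)

/-! ### Measurability of the tree order -/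

variable [MeasurableSpace X]

/-- Failure of `x ≼ y` means that some member of the class fits the two-point sample `(y, !r y), (x,
r x)`, that is, that the best loss of this sample vanishes. So the assumed measurability for `T = 2`
suffices. -/
theorem measurableSet_treeLE (hF : ∀ f ∈ F, Measurable f) (hr : r ∈ F)
    (hbest : ∀ T : ℕ, Measurable fun D : Fin T → X × Bool => bestLoss F D) :
    MeasurableSet {p : X × X | TreeLE F r p.1 p.2} := by
  have hrm := hF r hr
  have h1 : Measurable fun p : X × X =>
      (![(p.2, !(r p.2)), (p.1, r p.1)] : Fin 2 → X × Bool) := by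
    refine measurable_pi_iff.2 fun i => ?_
    fin_cases i
    · exact measurable_snd.prodMk ((measurable_of_countable not).comp (hrm.comp measurable_snd))
    · exact measurable_fst.prodMk (hrm.comp measurable_fst)
  have h2 := ((hbest 2).comp h1) (measurableSet_singleton (0 : ℝ)).compl
  convert h2 using 1
  ext p
  simp only [Set.mem_ofPred_eq, Set.mem_preimage, Set.mem_compl_iff, Set.mem_singleton_iff,
    Function.comp, bestLoss_eq_zero_iff ⟨r, hr⟩]
  rw [iff_not_comm, iff_comm]
  constructor
  · intro h
    obtain ⟨f, hf, h1, h2⟩ := exists_of_not_treeLE h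
    refine ⟨f, hf, fun s => ?_⟩
    fin_cases s
    · simpa [Bool.eq_not] using h1
    · simpa using h2
  · rintro ⟨f, hf, h⟩ hle
    have h0 := h 0
    have h1 := h 1
    simp only [Matrix.cons_val_zero, Matrix.cons_val_one] at h0 h1
    exact hle f hf (by rw [h0]; simp) h1

theorem measurableSet_treeLT (hF : ∀ f ∈ F, Measurable f) (hr : r ∈ F)
    (hbest : ∀ T : ℕ, Measurable fun D : Fin T → X × Bool => bestLoss F D) :
    MeasurableSet {p : X × X | TreeLT F r p.1 p.2} :=
  (measurableSet_treeLE hF hr hbest).inter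
    (measurable_swap (measurableSet_treeLE hF hr hbest)).compl

end Order

/-! ### Measure-theoretic preliminaries -/

/-- A measurable map to a standard Borel space has a measurable section, with values in a given set
of positive measure, over some set that is not negligible. -/
theorem exists_measurable_section {X Z : Type*} [MeasurableSpace X] [StandardBorelSpace X]
    [MeasurableSpace Z] [StandardBorelSpace Z] (P : Measure Z) [IsFiniteMeasure P] {φ : Z → X}
    (hφ : Measurable φ) {W : Set Z} (hW : MeasurableSet W) (hP : P W ≠ 0) :
    ∃ (B : Set X) (g : X → Z), MeasurableSet B ∧ Measurable g ∧ (P.map φ) B ≠ 0 ∧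
      ∀ v ∈ B, g v ∈ W ∧ φ (g v) = v := by
  have hne : Nonempty Z := by
    by_contra h
    rw [not_nonempty_iff] at h
    exact hP (by rw [Set.eq_empty_of_isEmpty W]; simp)
  set ρ : Measure (X × Z) := (P.restrict W).map fun z => (φ z, z) with hρ
  have hm : Measurable fun z => (φ z, z) := hφ.prodMk measurable_id
  -- Disintegrate over the value of `φ` and simulate the conditional law of `z` by a uniform seed;
  -- each good seed then gives a measurable section.
  obtain ⟨f, hf, hfκ⟩ := Kernel.exists_measurable_map_eq_unitInterval ρ.condKernel
  have hG : MeasurableSet {p : X × Z | p.2 ∈ W ∧ φ p.2 = p.1} :=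
    (measurable_snd hW).inter (measurableSet_eq_fun (hφ.comp measurable_snd) measurable_fst)
  have h1 : ∀ᵐ p ∂ρ, p.2 ∈ W ∧ φ p.2 = p.1 := by
    rw [hρ, ae_map_iff hm.aemeasurable hG]
    filter_upwards [ae_restrict_mem hW] with z hz using ⟨hz, rfl⟩
  rw [← ρ.disintegrate ρ.condKernel, Measure.ae_compProd_iff hG] at h1
  have h2 : ∀ᵐ v ∂ρ.fst, ∀ᵐ u ∂(ℙ : Measure unitInterval), f v u ∈ W ∧ φ (f v u) = v := by
    filter_upwards [h1] with v hv
    rw [← hfκ v] at hv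
    exact ae_of_ae_map (hf.comp measurable_prodMk_left).aemeasurable hv
  have hG' : MeasurableSet {p : X × unitInterval | f p.1 p.2 ∈ W ∧ φ (f p.1 p.2) = p.1} :=
    (hf hW).inter (measurableSet_eq_fun (hφ.comp hf) measurable_fst)
  -- Exchanging the quantifiers yields a single seed `u` that works for almost every `v`.
  have h3 := (Measure.ae_ae_comm (μ := ρ.fst) (ν := (ℙ : Measure unitInterval))
    (p := fun v u => f v u ∈ W ∧ φ (f v u) = v) hG').1 h2
  obtain ⟨u, hu⟩ := h3.exists
  have hfst : ρ.fst = (P.restrict W).map φ := by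
    rw [hρ]
    exact Measure.fst_map_prodMk (X := φ) (Y := fun z => z) measurable_id
  have hgm : Measurable fun v => f v u := hf.comp measurable_prodMk_right
  have hBm : MeasurableSet {v | f v u ∈ W ∧ φ (f v u) = v} :=
    (hgm hW).inter (measurableSet_eq_fun (hφ.comp hgm) measurable_id)
  refine ⟨{v | f v u ∈ W ∧ φ (f v u) = v}, fun v => f v u, hBm, hgm, ?_, fun v hv => hv⟩
  intro h0
  have h4 : (P.restrict W).map φ {v | f v u ∈ W ∧ φ (f v u) = v} = 0 := by
    rw [Measure.map_apply hφ hBm] at h0 ⊢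
    exact le_antisymm ((Measure.restrict_apply_le _ _).trans h0.le) bot_le
  rw [hfst] at hu
  have h5 : (P.restrict W).map φ Set.univ = 0 := by
    refine le_antisymm ?_ bot_le
    rw [← Set.union_compl_self {v | f v u ∈ W ∧ φ (f v u) = v}]
    refine (measure_union_le _ _).trans ?_
    rw [h4, show (P.restrict W).map φ {v | f v u ∈ W ∧ φ (f v u) = v}ᶜ = 0 from hu]
    simp
  rw [Measure.map_apply hφ MeasurableSet.univ] at h5
  simp at h5
  exact hP h5

/-- If `z, w` are independent samples then `w` is strictly below `z` with probability at most one
half; so for many `w`, the points that are not strictly above `w` have at least half the mass. -/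
theorem measure_pos_of_half {X : Type*} [MeasurableSpace X] {ν : Measure X} [IsProbabilityMeasure ν]
    {R : X → X → Prop} (hR : MeasurableSet {p : X × X | R p.1 p.2})
    (hasymm : ∀ x y, R x y → ¬ R y x) {C : Set X} (hC : MeasurableSet C) {ε : ℝ} (hε : 0 < ε)
    (h : 2 * ε ≤ ν.real C) : ν {w | w ∈ C ∧ ε ≤ ν.real {z | z ∈ C ∧ ¬ R w z}} ≠ 0 := by
  intro h0
  have hcε : 2 * ENNReal.ofReal ε ≤ ν C := by
    rw [← ofReal_measureReal (measure_ne_top ν C)]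
    calc 2 * ENNReal.ofReal ε = ENNReal.ofReal (2 * ε) := by
          rw [ENNReal.ofReal_mul (by norm_num)]; simp
      _ ≤ _ := ENNReal.ofReal_le_ofReal h
  have hC0 : ν C ≠ 0 := by
    intro h1
    rw [h1] at hcε
    have : ENNReal.ofReal ε = 0 := by simpa using hcε
    exact absurd (ENNReal.ofReal_eq_zero.1 this) (not_le.2 hε)
  set E : Set (X × X) := (C ×ˢ C) \ {p | R p.1 p.2} with hE
  set D : Set (X × X) := (C ×ˢ C) ∩ {p | R p.1 p.2} with hD
  have hEm : MeasurableSet E := (hC.prod hC).diff hR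
  have hDm : MeasurableSet D := (hC.prod hC).inter hR
  -- The product measure is symmetric and `R` is asymmetric, so the pairs with `R` weigh no more
  -- than the pairs without.
  have hswap : (ν.prod ν) (Prod.swap ⁻¹' D) = (ν.prod ν) D := by
    conv_rhs => rw [← Measure.prod_swap (μ := ν) (ν := ν)]
    rw [Measure.map_apply measurable_swap hDm]
  have hDE : (ν.prod ν) D ≤ (ν.prod ν) E := by
    rw [← hswap]
    refine measure_mono ?_
    rintro ⟨x, y⟩ ⟨⟨hy, hx⟩, hyx⟩
    exact ⟨⟨hx, hy⟩, fun hxy => hasymm _ _ hyx hxy⟩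
  have hsum : ν C * ν C ≤ 2 * (ν.prod ν) E := by
    rw [← Measure.prod_prod, ← measure_inter_add_sdiff (C ×ˢ C) hR, two_mul]
    gcongr
  -- If almost every slice over `C` had mass below `ε`, Fubini would put `E` below half of `ν C * ν
  -- C`.
  have hlt : (ν.prod ν) E < ENNReal.ofReal ε * ν C := by
    rw [Measure.prod_apply hEm]
    have h2 : ∫⁻ x, ν (Prod.mk x ⁻¹' E) ∂ν = ∫⁻ x in C, ν (Prod.mk x ⁻¹' E) ∂ν := by
      rw [← lintegral_indicator hC]
      congr 1
      ext x
      by_cases hx : x ∈ C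
      · simp [hx]
      · have : Prod.mk x ⁻¹' E = ∅ := by
          ext y
          simp [hE, hx]
        simp [hx, this]
    rw [h2, ← setLIntegral_const]
    refine setLIntegral_strict_mono hC hC0 measurable_const ?_ ?_
    · rw [← h2, ← Measure.prod_apply hEm]
      exact measure_ne_top _ _
    · have h3 : ∀ᵐ w ∂ν, ¬ (w ∈ C ∧ ε ≤ ν.real {z | z ∈ C ∧ ¬ R w z}) := by
        rw [ae_iff]
        simpa using h0
      filter_upwards [h3] with w hw hwC
      have h4 : Prod.mk w ⁻¹' E = {z | z ∈ C ∧ ¬ R w z} := by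
        ext z
        simp [hE, hwC]
      rw [h4, ← ofReal_measureReal (measure_ne_top ν _)]
      exact (ENNReal.ofReal_lt_ofReal_iff hε).2 (not_le.1 fun h => hw ⟨hwC, h⟩)
  have h5 : 2 * (ν.prod ν) E < ν C * ν C := by
    calc 2 * (ν.prod ν) E < 2 * (ENNReal.ofReal ε * ν C) := by
          exact (ENNReal.mul_lt_mul_iff_right (by simp) (by simp)).2 hlt
      _ = 2 * ENNReal.ofReal ε * ν C := (mul_assoc _ _ _).symm
      _ ≤ ν C * ν C := by gcongr
  exact absurd hsum (not_le.2 h5)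

/-! ### Counting mistakes -/

section Mistakes

variable {X : Type*}

theorem mistakes_nonneg {t : ℕ} (h : Hist X t) : 0 ≤ mistakes h :=
  Finset.sum_nonneg fun _ _ => by split_ifs <;> norm_num

theorem mistakes_le {t : ℕ} (h : Hist X t) : mistakes h ≤ t := by
  unfold mistakes
  calc _ ≤ ∑ _s : Fin t, (1 : ℝ) := Finset.sum_le_sum fun _ _ => by split_ifs <;> norm_num
    _ = t := by simp

theorem abs_mistakes_le {t : ℕ} (h : Hist X t) : |mistakes h| ≤ t := by
  rw [abs_of_nonneg (mistakes_nonneg h)]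
  exact mistakes_le h

theorem errors_snoc (f : X → Bool) {t : ℕ} (D : Fin t → X × Bool) (x : X) (y : Bool) :
    errors f (Fin.snoc (α := fun _ => X × Bool) D (x, y)) =
      errors f D + if f x ≠ y then 1 else 0 := by
  simp [errors, Fin.sum_univ_castSucc]

end Mistakes

/-! ### The law of a game -/

section Play

variable {X : Type*} [MeasurableSpace X] {U : Set (ProbabilityMeasure X)}

instance (L : Learner X) (t : ℕ) : IsMarkovKernel (L.predict t) := L.markov t

instance (A : AdaptiveAdversary U) (t : ℕ) : IsMarkovKernel (A.instanceKernel t) :=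
  ⟨fun h => (A.dist t (played h)).2⟩

theorem AdaptiveAdversary.instanceKernel_apply (A : AdaptiveAdversary U) (t : ℕ) (h : Hist X t) :
    A.instanceKernel t h = (A.dist t (played h) : Measure X) := rfl

theorem measurable_snoc {α : Type*} [MeasurableSpace α] {t : ℕ} :
    Measurable fun p : (Fin t → α) × α => (Fin.snoc (α := fun _ => α) p.1 p.2 : Fin (t + 1) → α) := by
  refine measurable_pi_iff.2 fun i => ?_
  refine Fin.lastCases ?_ (fun j => ?_) i
  · simpa using measurable_snd
  · simp only [Fin.snoc_castSucc]
    exact (measurable_pi_apply j).comp measurable_fst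

theorem AdaptiveAdversary.measurable_extend (A : AdaptiveAdversary U) (t : ℕ) :
    Measurable (A.extend t) := by
  unfold AdaptiveAdversary.extend
  refine measurable_snoc.comp (measurable_fst.prodMk ?_)
  refine (measurable_fst.comp measurable_snd).prodMk (Measurable.prodMk ?_
    (measurable_snd.comp measurable_snd))
  exact (A.measurable_label t).comp ((measurable_played.comp measurable_fst).prodMk
    (measurable_fst.comp measurable_snd))

instance isProbabilityMeasure_play (L : Learner X) (A : AdaptiveAdversary U) (t : ℕ) :
    IsProbabilityMeasure (play L A t) := by
  induction t with
  | zero => unfold play; infer_instance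
  | succ t ih =>
    unfold play
    exact Measure.isProbabilityMeasure_map (A.measurable_extend t).aemeasurable

theorem integral_play_succ (L : Learner X) (A : AdaptiveAdversary U) (t : ℕ)
    {g : Hist X (t + 1) → ℝ} (hg : Measurable g) {C : ℝ} (hC : ∀ h, |g h| ≤ C) :
    ∫ h, g h ∂(play L A (t + 1)) =
      ∫ h, ∫ x, ∫ b, g (A.extend t (h, (x, b))) ∂(L.predict t (h, x))
        ∂(A.dist t (played h) : Measure X) ∂(play L A t) := by
  have hm : Measurable fun p => g (A.extend t p) := hg.comp (A.measurable_extend t)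
  rw [play, integral_map (A.measurable_extend t).aemeasurable hg.aestronglyMeasurable,
    Measure.integral_compProd]
  · refine integral_congr_ae (Eventually.of_forall fun h => ?_)
    simp only
    rw [ProbabilityTheory.integral_compProd]
    · rfl
    · exact Integrable.of_bound (hm.comp measurable_prodMk_left).aestronglyMeasurable C
        (Eventually.of_forall fun _ => hC _)
  · exact Integrable.of_bound hm.aestronglyMeasurable C (Eventually.of_forall fun _ => hC _)

/-- Asking for both values of the prediction removes the learner's kernel from the hypothesis. -/
theorem ae_play_succ (L : Learner X) (A : AdaptiveAdversary U) (t : ℕ)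
    {p : Hist X (t + 1) → Prop} (hp : MeasurableSet {h | p h})
    (h : ∀ᵐ h ∂(play L A t), ∀ᵐ x ∂(A.dist t (played h) : Measure X), ∀ b,
      p (A.extend t (h, (x, b)))) : ∀ᵐ h ∂(play L A (t + 1)), p h := by
  have hp' : MeasurableSet {q | p (A.extend t q)} := A.measurable_extend t hp
  rw [play, ae_map_iff (A.measurable_extend t).aemeasurable hp, Measure.ae_compProd_iff hp']
  filter_upwards [h] with h hh
  have hp'' : MeasurableSet {q | p (A.extend t (h, q))} := measurable_prodMk_left hp'
  rw [Kernel.ae_compProd_iff hp'']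
  filter_upwards [hh] with x hx
  exact Eventually.of_forall hx

/-- The play up to round `t` depends on the adversary only through the rounds before `t`. -/
theorem play_congr (L : Learner X) {A A' : AdaptiveAdversary U} (t : ℕ)
    (hd : ∀ s < t, A.dist s = A'.dist s) (hl : ∀ s < t, A.label s = A'.label s) :
    play L A t = play L A' t := by
  induction t with
  | zero => rfl
  | succ t ih =>
    have h1 : A.instanceKernel t = A'.instanceKernel t := by
      ext h : 1
      simp only [AdaptiveAdversary.instanceKernel_apply, hd t (Nat.lt_succ_self t)]
    have h2 : A.extend t = A'.extend t := by
      funext p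
      simp only [AdaptiveAdversary.extend, hl t (Nat.lt_succ_self t)]
    rw [play, play, h1, h2, ih (fun s hs => hd s (hs.trans (Nat.lt_succ_self t)))
      (fun s hs => hl s (hs.trans (Nat.lt_succ_self t)))]

theorem measurable_sample {t : ℕ} : Measurable (sample : Hist X t → Fin t → X × Bool) := by
  unfold sample
  fun_prop

theorem measurable_mistakes {t : ℕ} : Measurable (mistakes : Hist X t → ℝ) := by
  unfold mistakes
  refine Finset.measurable_sum _ fun s _ => Measurable.ite ?_ measurable_const measurable_const
  have h : Measurable fun h : Hist X t => (h s).2 := by fun_prop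
  exact h (MeasurableSet.of_discrete (s := {p : Bool × Bool | p.2 ≠ p.1}))

theorem measurable_errors {f : X → Bool} (hf : Measurable f) {t : ℕ} :
    Measurable fun D : Fin t → X × Bool => errors f D := by
  unfold errors
  refine Finset.measurable_sum _ fun s _ => Measurable.ite ?_ measurable_const measurable_const
  have h : Measurable fun D : Fin t → X × Bool => (f (D s).1, (D s).2) := by fun_prop
  exact h (MeasurableSet.of_discrete (s := {p : Bool × Bool | p.1 ≠ p.2}))

theorem integrable_of_bound {α : Type*} [MeasurableSpace α] {μ : Measure α} [IsFiniteMeasure μ]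
    {g : α → ℝ} (hg : Measurable g) {C : ℝ} (hC : ∀ h, |g h| ≤ C) : Integrable g μ :=
  Integrable.of_bound hg.aestronglyMeasurable C (Eventually.of_forall hC)

theorem mistakes_extend (A : AdaptiveAdversary U) (t : ℕ) (h : Hist X t) (x : X) (b : Bool) :
    mistakes (A.extend t (h, (x, b))) =
      mistakes h + if b ≠ A.label t (played h) x then 1 else 0 := by
  simp [mistakes, AdaptiveAdversary.extend, Fin.sum_univ_castSucc]

theorem sample_extend (A : AdaptiveAdversary U) (t : ℕ) (h : Hist X t) (x : X) (b : Bool) :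
    sample (A.extend t (h, (x, b))) =
      Fin.snoc (α := fun _ => X × Bool) (sample h) (x, A.label t (played h) x) := by
  funext s
  refine Fin.lastCases ?_ (fun j => ?_) s <;> simp [sample, AdaptiveAdversary.extend]

theorem played_extend (A : AdaptiveAdversary U) (t : ℕ) (h : Hist X t) (x : X) (b : Bool) :
    played (A.extend t (h, (x, b))) = Fin.snoc (α := fun _ => X × Bool) (played h) (x, b) := by
  funext s
  refine Fin.lastCases ?_ (fun j => ?_) s <;> simp [played, AdaptiveAdversary.extend]

theorem real_false_eq (μ : Measure Bool) [IsProbabilityMeasure μ] :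
    μ.real {false} = 1 - μ.real {true} := by
  rw [← probReal_compl_eq_one_sub (MeasurableSet.singleton true)]
  congr 1
  ext b
  simp

theorem integral_bool {μ : Measure Bool} [IsProbabilityMeasure μ] (g : Bool → ℝ) :
    ∫ b, g b ∂μ = μ.real {true} * g true + (1 - μ.real {true}) * g false := by
  rw [integral_fintype .of_finite]
  simp [real_false_eq μ]

theorem measurable_mistakeProb (L : Learner X) (A : AdaptiveAdversary U) (t : ℕ) :
    Measurable fun p : Hist X t × X =>
      (L.predict t p).real {!(A.label t (played p.1) p.2)} := by
  have hl : Measurable fun p : Hist X t × X => A.label t (played p.1) p.2 :=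
    (A.measurable_label t).comp ((measurable_played.comp measurable_fst).prodMk measurable_snd)
  have h : ∀ b : Bool, Measurable fun p : Hist X t × X => (L.predict t p).real {b} := fun b =>
    ((L.predict t).measurable_coe (MeasurableSet.singleton b)).ennreal_toReal
  have : (fun p : Hist X t × X => (L.predict t p).real {!(A.label t (played p.1) p.2)}) =
      fun p => if A.label t (played p.1) p.2 = true then (L.predict t p).real {false} else
        (L.predict t p).real {true} := by
    funext p
    cases A.label t (played p.1) p.2 <;> simp
  rw [this]
  exact Measurable.ite (hl (measurableSet_singleton true)) (h _) (h _)

theorem measurable_integral_dist (A : AdaptiveAdversary U) (t : ℕ) {q : Hist X t × X → ℝ}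
    (hq : Measurable q) :
    Measurable fun h : Hist X t => ∫ x, q (h, x) ∂(A.dist t (played h) : Measure X) :=
  (StronglyMeasurable.integral_kernel_prod_right (κ := A.instanceKernel t)
    (f := fun h x => q (h, x)) hq.stronglyMeasurable).measurable

/-- The expected number of mistakes grows by the expected probability of a mistake. -/
theorem integral_mistakes_succ (L : Learner X) (A : AdaptiveAdversary U) (t : ℕ) :
    ∫ h, mistakes h ∂(play L A (t + 1)) = ∫ h, mistakes h ∂(play L A t) +
      ∫ h, ∫ x, (L.predict t (h, x)).real {!(A.label t (played h) x)}
        ∂(A.dist t (played h) : Measure X) ∂(play L A t) := by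
  rw [integral_play_succ L A t measurable_mistakes abs_mistakes_le]
  have hb : ∀ h x, ∫ b, mistakes (A.extend t (h, (x, b))) ∂(L.predict t (h, x)) =
      mistakes h + (L.predict t (h, x)).real {!(A.label t (played h) x)} := by
    intro h x
    have hf := real_false_eq (L.predict t (h, x))
    simp only [mistakes_extend, integral_bool]
    cases A.label t (played h) x <;> simp [hf] <;> ring
  simp only [hb]
  have hq := measurable_mistakeProb L A t
  have hx : ∀ h, ∫ x, (mistakes h + (L.predict t (h, x)).real {!(A.label t (played h) x)})
      ∂(A.dist t (played h) : Measure X) = mistakes h +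
      ∫ x, (L.predict t (h, x)).real {!(A.label t (played h) x)}
        ∂(A.dist t (played h) : Measure X) := by
    intro h
    have hq' : Measurable fun x => (L.predict t (h, x)).real {!(A.label t (played h) x)} :=
      hq.comp measurable_prodMk_left
    rw [integral_add (integrable_const _) (integrable_of_bound (C := 1) hq' (fun x => by
      rw [abs_of_nonneg measureReal_nonneg]; exact measureReal_le_one))]
    simp
  simp only [hx]
  refine integral_add (integrable_of_bound measurable_mistakes abs_mistakes_le) ?_
  refine integrable_of_bound (C := 1) (measurable_integral_dist A t hq) fun h => ?_
  refine (abs_integral_le_integral_abs).trans ?_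
  have : ∀ x, |(L.predict t (h, x)).real {!(A.label t (played h) x)}| ≤ 1 := fun x => by
    rw [abs_of_nonneg measureReal_nonneg]; exact measureReal_le_one
  refine (integral_mono_of_nonneg (Eventually.of_forall fun _ => abs_nonneg _)
    (integrable_const (1 : ℝ)) (Eventually.of_forall this)).trans ?_
  simp

theorem abs_integral_le_of_bound {α : Type*} [MeasurableSpace α] {μ : Measure α}
    [IsProbabilityMeasure μ] {g : α → ℝ} {C : ℝ} (hC : ∀ a, |g a| ≤ C) : |∫ a, g a ∂μ| ≤ C := by
  have h := norm_integral_le_of_norm_le_const (μ := μ) (f := g) (Eventually.of_forall hC)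
  simpa using h

theorem measurable_integral_predict (L : Learner X) (t : ℕ) {g : Hist X t × X → Bool → ℝ}
    (hg : Measurable (Function.uncurry g)) :
    Measurable fun p : Hist X t × X => ∫ b, g p b ∂(L.predict t p) :=
  (StronglyMeasurable.integral_kernel_prod_right (κ := L.predict t) (f := g)
    hg.stronglyMeasurable).measurable

/-- One step of an induction over the rounds. -/
theorem integral_play_succ_le (L : Learner X) (A : AdaptiveAdversary U) (t : ℕ)
    {g : Hist X (t + 1) → ℝ} (hg : Measurable g) {C : ℝ} (hC : ∀ h, |g h| ≤ C)
    {φ : Hist X t → ℝ} (hφ : Measurable φ) {C' : ℝ} (hC' : ∀ h, |φ h| ≤ C')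
    (H : ∀ᵐ h ∂(play L A t), ∫ x, ∫ b, g (A.extend t (h, (x, b))) ∂(L.predict t (h, x))
      ∂(A.dist t (played h) : Measure X) ≤ φ h) :
    ∫ h, g h ∂(play L A (t + 1)) ≤ ∫ h, φ h ∂(play L A t) := by
  rw [integral_play_succ L A t hg hC]
  refine integral_mono_ae (integrable_of_bound (C := C) ?_ fun h => ?_)
    (integrable_of_bound hφ hC') H
  · refine measurable_integral_dist A t
      (q := fun p => ∫ b, g (A.extend t (p.1, (p.2, b))) ∂(L.predict t p)) ?_
    refine measurable_integral_predict L t (g := fun p b => g (A.extend t (p.1, (p.2, b)))) ?_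
    refine hg.comp ((A.measurable_extend t).comp ?_)
    fun_prop
  · exact abs_integral_le_of_bound fun x => abs_integral_le_of_bound fun b => hC _

/-- One step of an induction over the rounds, when the inequality holds for all instances. -/
theorem integral_play_succ_le_of_forall (L : Learner X) (A : AdaptiveAdversary U) (t : ℕ)
    {g : Hist X (t + 1) → ℝ} (hg : Measurable g) {C : ℝ} (hC : ∀ h, |g h| ≤ C)
    {φ : Hist X t → ℝ} (hφ : Measurable φ) {C' : ℝ} (hC' : ∀ h, |φ h| ≤ C')
    (H : ∀ h x, ∫ b, g (A.extend t (h, (x, b))) ∂(L.predict t (h, x)) ≤ φ h) :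
    ∫ h, g h ∂(play L A (t + 1)) ≤ ∫ h, φ h ∂(play L A t) := by
  refine integral_play_succ_le L A t hg hC hφ hC' (Eventually.of_forall fun h => ?_)
  have hm : Measurable fun x => ∫ b, g (A.extend t (h, (x, b))) ∂(L.predict t (h, x)) := by
    refine (measurable_integral_predict L t
      (g := fun p b => g (A.extend t (p.1, (p.2, b)))) ?_).comp measurable_prodMk_left
    refine hg.comp ((A.measurable_extend t).comp ?_)
    fun_prop
  refine (integral_mono (integrable_of_bound (C := C) hm fun x =>
    abs_integral_le_of_bound fun b => hC _) (integrable_const (φ h)) (H h)).trans ?_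
  simp

end Play

/-! ### Hedge -/

section Experts

variable {X : Type*} (F : Set (X → Bool)) (r : X → Bool)

/-- An expert reads only the instances up to the current round, so its earlier mistakes are
unaffected by the new one. -/
theorem expertLoss_snoc (S : Finset ℕ) {t : ℕ} (D : Fin t → X × Bool) (x : X) (y : Bool) :
    expertLoss F r S (Fin.snoc (α := fun _ => X × Bool) D (x, y)) = expertLoss F r S D +
      if expertPredict F r S (Fin.snoc (α := fun _ => X) (fun s => (D s).1) x) ≠ y
        then 1 else 0 := by
  have hlast : (fun i : Fin (t + 1) =>
      (Fin.snoc (α := fun _ => X × Bool) D (x, y) (Fin.castLE (Fin.last t).isLt i)).1) =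
      Fin.snoc (α := fun _ => X) (fun s => (D s).1) x := by
    funext i
    refine Fin.lastCases ?_ (fun j => ?_) i
    · have : Fin.castLE (Fin.last t).isLt (Fin.last t) = Fin.last t := rfl
      rw [this]
      simp
    · have : Fin.castLE (Fin.last t).isLt (Fin.castSucc j) = Fin.castSucc j := rfl
      rw [this]
      simp
  unfold expertLoss
  rw [Fin.sum_univ_castSucc]
  congr 1
  · refine Finset.sum_congr rfl fun s _ => ?_
    have h : (fun i : Fin ((s : ℕ) + 1) =>
        (Fin.snoc (α := fun _ => X × Bool) D (x, y) (Fin.castLE (Fin.castSucc s).isLt i)).1) =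
        fun i => (D (Fin.castLE s.isLt i)).1 := by
      funext i
      have : Fin.castLE (Fin.castSucc s).isLt i = Fin.castSucc (Fin.castLE s.isLt i) := rfl
      rw [this]
      exact congrArg Prod.fst (Fin.snoc_castSucc (α := fun _ => X × Bool) (x, y) D _)
    simp only [Fin.snoc_castSucc, Fin.val_castSucc]
    exact if_congr (by rw [← h]) rfl rfl
  · simp only [Fin.snoc_last]
    rw [← hlast]
    rfl

theorem expertLoss_nonneg (S : Finset ℕ) {t : ℕ} (D : Fin t → X × Bool) :
    0 ≤ expertLoss F r S D :=
  Finset.sum_nonneg fun _ _ => by split_ifs <;> norm_num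

theorem expertLoss_le (S : Finset ℕ) {t : ℕ} (D : Fin t → X × Bool) :
    expertLoss F r S D ≤ t := by
  unfold expertLoss
  calc _ ≤ ∑ _s : Fin t, (1 : ℝ) := Finset.sum_le_sum fun _ _ => by split_ifs <;> norm_num
    _ = t := by simp

/-- The total weight of the experts under Hedge. -/
noncomputable def totalWeight (T : ℕ) {t : ℕ} (D : Fin t → X × Bool) : ℝ :=
  ∑ S ∈ experts T, Real.exp (-rate T * expertLoss F r S D)

theorem empty_mem_experts (T : ℕ) : ∅ ∈ experts T := by simp [experts]

theorem rate_nonneg (T : ℕ) : 0 ≤ rate T := Real.sqrt_nonneg _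

theorem totalWeight_pos (T : ℕ) {t : ℕ} (D : Fin t → X × Bool) : 0 < totalWeight F r T D :=
  Finset.sum_pos (fun _ _ => Real.exp_pos _) ⟨∅, empty_mem_experts T⟩

theorem exp_le_totalWeight {T : ℕ} {S : Finset ℕ} (hS : S ∈ experts T) {t : ℕ}
    (D : Fin t → X × Bool) : Real.exp (-rate T * expertLoss F r S D) ≤ totalWeight F r T D :=
  Finset.single_le_sum (f := fun S => Real.exp (-rate T * expertLoss F r S D))
    (fun _ _ => (Real.exp_pos _).le) hS

theorem neg_rate_mul_expertLoss_le_log_totalWeight {T : ℕ} {S : Finset ℕ} (hS : S ∈ experts T)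
    {t : ℕ} (D : Fin t → X × Bool) :
    -rate T * expertLoss F r S D ≤ Real.log (totalWeight F r T D) := by
  rw [Real.le_log_iff_exp_le (totalWeight_pos F r T D)]
  exact exp_le_totalWeight F r hS D

theorem totalWeight_le_card (T : ℕ) {t : ℕ} (D : Fin t → X × Bool) :
    totalWeight F r T D ≤ (experts T).card := by
  unfold totalWeight
  calc _ ≤ ∑ _S ∈ experts T, (1 : ℝ) := Finset.sum_le_sum fun S _ => by
        rw [Real.exp_le_one_iff]
        exact mul_nonpos_of_nonpos_of_nonneg (neg_nonpos.2 (rate_nonneg T))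
          (expertLoss_nonneg F r S D)
    _ = _ := by simp

theorem log_card_experts_nonneg (T : ℕ) : 0 ≤ Real.log (experts T).card := by
  refine Real.log_nonneg ?_
  exact_mod_cast Finset.card_pos.2 ⟨∅, empty_mem_experts T⟩

/-- A crude bound, needed only for integrability. -/
theorem abs_log_totalWeight_le (T : ℕ) {t : ℕ} (D : Fin t → X × Bool) :
    |Real.log (totalWeight F r T D)| ≤ Real.log (experts T).card + rate T * t := by
  rw [abs_le]
  constructor
  · have h1 := neg_rate_mul_expertLoss_le_log_totalWeight F r (empty_mem_experts T) D
    have h2 := mul_le_mul_of_nonneg_left (expertLoss_le F r ∅ D) (rate_nonneg T)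
    have h3 := log_card_experts_nonneg T
    linarith
  · have h1 := Real.log_le_log (totalWeight_pos F r T D) (totalWeight_le_card F r T D)
    have h2 := mul_nonneg (rate_nonneg T) (Nat.cast_nonneg (α := ℝ) t)
    linarith

/-- The total weight of the experts that err on the instance `x` with label `y`. -/
noncomputable def wrongWeight (T : ℕ) {t : ℕ} (D : Fin t → X × Bool) (x : X) (y : Bool) : ℝ :=
  ∑ S ∈ experts T, if expertPredict F r S (Fin.snoc (α := fun _ => X) (fun s => (D s).1) x) ≠ y
    then Real.exp (-rate T * expertLoss F r S D) else 0

theorem wrongWeight_nonneg (T : ℕ) {t : ℕ} (D : Fin t → X × Bool) (x : X) (y : Bool) :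
    0 ≤ wrongWeight F r T D x y :=
  Finset.sum_nonneg fun _ _ => by split_ifs <;> positivity

theorem wrongWeight_add (T : ℕ) {t : ℕ} (D : Fin t → X × Bool) (x : X) (y : Bool) :
    wrongWeight F r T D x y + wrongWeight F r T D x (!y) = totalWeight F r T D := by
  unfold wrongWeight totalWeight
  rw [← Finset.sum_add_distrib]
  refine Finset.sum_congr rfl fun S _ => ?_
  cases expertPredict F r S (Fin.snoc (α := fun _ => X) (fun s => (D s).1) x) <;> cases y <;> simp

theorem hedgeProb_eq (T : ℕ) {t : ℕ} (D : Fin t → X × Bool) (x : X) :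
    hedgeProb F r T D x = wrongWeight F r T D x false / totalWeight F r T D := by
  simp [hedgeProb, wrongWeight, totalWeight]

theorem hedgeProb_nonneg (T : ℕ) {t : ℕ} (D : Fin t → X × Bool) (x : X) :
    0 ≤ hedgeProb F r T D x := by
  rw [hedgeProb_eq]
  exact div_nonneg (wrongWeight_nonneg F r T D x _) (totalWeight_pos F r T D).le

theorem hedgeProb_le_one (T : ℕ) {t : ℕ} (D : Fin t → X × Bool) (x : X) :
    hedgeProb F r T D x ≤ 1 := by
  rw [hedgeProb_eq, div_le_one (totalWeight_pos F r T D), ← wrongWeight_add F r T D x false]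
  linarith [wrongWeight_nonneg F r T D x (!false)]

theorem totalWeight_snoc (T : ℕ) {t : ℕ} (D : Fin t → X × Bool) (x : X) (y : Bool) :
    totalWeight F r T (Fin.snoc (α := fun _ => X × Bool) D (x, y)) =
      totalWeight F r T D - (1 - Real.exp (-rate T)) * wrongWeight F r T D x y := by
  unfold totalWeight wrongWeight
  rw [Finset.mul_sum, ← Finset.sum_sub_distrib]
  refine Finset.sum_congr rfl fun S _ => ?_
  rw [expertLoss_snoc]
  split_ifs
  · rw [mul_add, Real.exp_add]
    ring_nf
  · simp

/-- This is `log u ≤ u - 1` for the ratio of the new weight to the old. The fraction of wrong weight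
is the mistake probability of Hedge, so the inequality is the one-round drop of the potential. -/
theorem log_totalWeight_snoc_le (T : ℕ) {t : ℕ} (D : Fin t → X × Bool) (x : X) (y : Bool) :
    (1 - Real.exp (-rate T)) * (wrongWeight F r T D x y / totalWeight F r T D) +
      Real.log (totalWeight F r T (Fin.snoc (α := fun _ => X × Bool) D (x, y))) ≤
      Real.log (totalWeight F r T D) := by
  have hW := totalWeight_pos F r T D
  have hW' := totalWeight_pos F r T (Fin.snoc (α := fun _ => X × Bool) D (x, y))
  have h1 : Real.log (totalWeight F r T (Fin.snoc (α := fun _ => X × Bool) D (x, y)) /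
      totalWeight F r T D) ≤ _ := Real.log_le_sub_one_of_pos (div_pos hW' hW)
  rw [Real.log_div hW'.ne' hW.ne', totalWeight_snoc] at h1
  rw [totalWeight_snoc]
  have h2 : (totalWeight F r T D - (1 - Real.exp (-rate T)) * wrongWeight F r T D x y) /
      totalWeight F r T D - 1 =
      -((1 - Real.exp (-rate T)) * (wrongWeight F r T D x y / totalWeight F r T D)) := by
    field_simp
    ring
  linarith

end Experts

/-! ### Hedge as a measurable learner, and its regret -/

section Measurability

variable {X : Type*} [MeasurableSpace X] {F : Set (X → Bool)} {r : X → Bool}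

open Classical in
theorem measurable_expertPredict (hr : Measurable r)
    (hle : MeasurableSet {p : X × X | TreeLE F r p.1 p.2}) (S : Finset ℕ) (t : ℕ) :
    Measurable fun z : Fin (t + 1) → X => expertPredict F r S z := by
  unfold expertPredict
  have h : MeasurableSet {z : Fin (t + 1) → X | ∃ s : Fin (t + 1), (s : ℕ) ∈ S ∧
      (∀ s' ∈ S, s' ≤ t → s' ≤ s) ∧ TreeLE F r (z (Fin.last t)) (z s)} := by
    simp only [Set.ofPred_exists]
    refine MeasurableSet.iUnion fun s => ?_
    refine (MeasurableSet.const _).inter ((MeasurableSet.const _).inter ?_)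
    have hz : Measurable fun z : Fin (t + 1) → X => (z (Fin.last t), z s) := by fun_prop
    exact hz hle
  have h1 : Measurable fun z : Fin (t + 1) → X => r (z (Fin.last t)) :=
    hr.comp (measurable_pi_apply _)
  have h2 : Measurable fun z : Fin (t + 1) → X => decide (∃ s : Fin (t + 1), (s : ℕ) ∈ S ∧
      (∀ s' ∈ S, s' ≤ t → s' ≤ s) ∧ TreeLE F r (z (Fin.last t)) (z s)) :=
    measurable_to_bool (by convert h using 1; ext z; simp)
  exact (measurable_of_countable fun p : Bool × Bool => xor p.1 p.2).comp (h1.prodMk h2)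

theorem measurable_fst_snoc {t : ℕ} :
    Measurable fun p : (Fin t → X × Bool) × X =>
      (Fin.snoc (α := fun _ => X) (fun s => (p.1 s).1) p.2 : Fin (t + 1) → X) := by
  have h : Measurable fun p : (Fin t → X × Bool) × X => ((fun s => (p.1 s).1, p.2) : (Fin t → X) × X) := by
    fun_prop
  exact measurable_snoc.comp h

theorem measurable_expertLoss (hr : Measurable r)
    (hle : MeasurableSet {p : X × X | TreeLE F r p.1 p.2}) (S : Finset ℕ) (t : ℕ) :
    Measurable fun D : Fin t → X × Bool => expertLoss F r S D := by
  unfold expertLoss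
  refine Finset.measurable_sum _ fun s _ => Measurable.ite ?_ measurable_const measurable_const
  have h1 : Measurable fun D : Fin t → X × Bool =>
      (fun i : Fin ((s : ℕ) + 1) => (D (Fin.castLE s.isLt i)).1) := by fun_prop
  have h2 := ((measurable_expertPredict hr hle S s).comp h1).prodMk
    (measurable_snd.comp (measurable_pi_apply (X := fun _ => X × Bool) s))
  exact h2 (MeasurableSet.of_discrete (s := {p : Bool × Bool | p.1 ≠ p.2}))

theorem measurable_totalWeight (hr : Measurable r)
    (hle : MeasurableSet {p : X × X | TreeLE F r p.1 p.2}) (T t : ℕ) :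
    Measurable fun D : Fin t → X × Bool => totalWeight F r T D :=
  Finset.measurable_sum _ fun S _ =>
    Real.measurable_exp.comp ((measurable_expertLoss hr hle S t).const_mul _)

theorem measurable_hedgeProb (hr : Measurable r)
    (hle : MeasurableSet {p : X × X | TreeLE F r p.1 p.2}) (T t : ℕ) :
    Measurable fun p : (Fin t → X × Bool) × X => hedgeProb F r T p.1 p.2 := by
  simp only [hedgeProb_eq]
  refine Measurable.div (Finset.measurable_sum _ fun S _ => Measurable.ite ?_ ?_ measurable_const)
    ((measurable_totalWeight hr hle T t).comp measurable_fst)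
  · exact ((measurable_expertPredict hr hle S t).comp measurable_fst_snoc)
      (MeasurableSet.of_discrete (s := {b : Bool | b ≠ false}))
  · exact Real.measurable_exp.comp
      (((measurable_expertLoss hr hle S t).const_mul _).comp measurable_fst)

/-- A Markov kernel to `Bool` with a prescribed probability of `true`. -/
theorem exists_bool_kernel {α : Type*} [MeasurableSpace α] {p : α → ℝ} (hp : Measurable p)
    (h0 : ∀ a, 0 ≤ p a) (h1 : ∀ a, p a ≤ 1) :
    ∃ κ : Kernel α Bool, IsMarkovKernel κ ∧ ∀ a, κ a {true} = ENNReal.ofReal (p a) := by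
  refine ⟨⟨fun a => ENNReal.ofReal (p a) • Measure.dirac true +
    ENNReal.ofReal (1 - p a) • Measure.dirac false, ?_⟩, ⟨fun a => ⟨?_⟩⟩, fun a => ?_⟩
  · refine Measure.measurable_of_measurable_coe _ fun s hs => ?_
    simp only [Measure.coe_add, Measure.coe_smul, Pi.add_apply, Pi.smul_apply, smul_eq_mul]
    exact (hp.ennreal_ofReal.mul_const _).add ((measurable_const.sub hp).ennreal_ofReal.mul_const _)
  · simp only [Kernel.coe_mk, Measure.coe_add, Measure.coe_smul, Pi.add_apply, Pi.smul_apply,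
      measure_univ, smul_eq_mul, mul_one]
    rw [← ENNReal.ofReal_add (h0 a) (by linarith [h1 a])]
    simp
  · simp

theorem exists_isTreeHedge (hr : Measurable r)
    (hle : MeasurableSet {p : X × X | TreeLE F r p.1 p.2}) :
    ∃ L : ℕ → Learner X, IsTreeHedge F r L := by
  have h : ∀ T t : ℕ, ∃ κ : Kernel (Hist X t × X) Bool, IsMarkovKernel κ ∧
      ∀ a, κ a {true} = ENNReal.ofReal (hedgeProb F r T (sample a.1) a.2) := by
    intro T t
    have hs : Measurable fun a : Hist X t × X => (sample a.1, a.2) :=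
      (measurable_sample.comp measurable_fst).prodMk measurable_snd
    have hp : Measurable fun a : Hist X t × X => hedgeProb F r T (sample a.1) a.2 := by
      have h := (measurable_hedgeProb hr hle T t).comp hs
      exact h
    have h0 : ∀ a : Hist X t × X, 0 ≤ hedgeProb F r T (sample a.1) a.2 := fun a =>
      hedgeProb_nonneg F r T _ _
    have h1 : ∀ a : Hist X t × X, hedgeProb F r T (sample a.1) a.2 ≤ 1 := fun a =>
      hedgeProb_le_one F r T _ _
    obtain ⟨κ, hκ, hκ'⟩ := exists_bool_kernel hp h0 h1
    exact ⟨κ, hκ, hκ'⟩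
  choose κ hκ hκ' using h
  refine ⟨fun T => ⟨κ T, hκ T⟩, ?_⟩
  intro T t _ h x
  change κ T t (h, x) {true} = _
  rw [hκ']

theorem predict_hedge {L : ℕ → Learner X} (hL : IsTreeHedge F r L) {T t : ℕ} (ht : t < T)
    (h : Hist X t) (x : X) (y : Bool) : ((L T).predict t (h, x)).real {!y} =
      wrongWeight F r T (sample h) x y / totalWeight F r T (sample h) := by
  have h1 : ((L T).predict t (h, x)).real {true} = hedgeProb F r T (sample h) x := by
    rw [measureReal_def, hL T t ht, ENNReal.toReal_ofReal (hedgeProb_nonneg F r T _ _)]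
  have h2 := real_false_eq ((L T).predict t (h, x))
  cases y
  · rw [Bool.not_false, h1, hedgeProb_eq]
  · rw [Bool.not_true, h2, h1, hedgeProb_eq, ← wrongWeight_add F r T (sample h) x true]
    have := wrongWeight_add F r T (sample h) x true ▸ totalWeight_pos F r T (sample h)
    field_simp
    simp

variable {U : Set (ProbabilityMeasure X)}

/-- Since `exp η ≥ 1 + η + η ^ 2 / 2`, it is enough that the product of this with `1 - η + η ^ 2 /
2` equals `1 + η ^ 4 / 4`. -/
theorem exp_neg_le {η : ℝ} (hη : 0 ≤ η) : Real.exp (-η) ≤ 1 - η + η ^ 2 / 2 := by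
  rw [Real.exp_neg, inv_le_iff_one_le_mul₀ (Real.exp_pos _)]
  have h1 := Real.quadratic_le_exp_of_nonneg hη
  have h2 : 0 ≤ 1 - η + η ^ 2 / 2 := by nlinarith [sq_nonneg (η - 1)]
  calc (1 : ℝ) ≤ (1 - η + η ^ 2 / 2) * (1 + η + η ^ 2 / 2) := by nlinarith [sq_nonneg (η ^ 2)]
    _ ≤ _ := by gcongr

/-- The potential is a supermartingale: in each round the logarithm of the weight falls by at least
`1 - exp (-rate T)` times the mistake probability. It starts at the logarithm of the number of
experts, since all initial weights are one. -/
theorem integral_potential_le {L : ℕ → Learner X} (hL : IsTreeHedge F r L) (hr : Measurable r)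
    (hle : MeasurableSet {p : X × X | TreeLE F r p.1 p.2}) (A : AdaptiveAdversary U) {T : ℕ}
    (t : ℕ) (ht : t ≤ T) :
    ∫ h, ((1 - Real.exp (-rate T)) * mistakes h + Real.log (totalWeight F r T (sample h)))
      ∂(play (L T) A t) ≤ Real.log (experts T).card := by
  have hc0 : 0 ≤ 1 - Real.exp (-rate T) := by
    rw [sub_nonneg, Real.exp_le_one_iff]
    linarith [rate_nonneg T]
  have hm : ∀ t, Measurable fun h : Hist X t => (1 - Real.exp (-rate T)) * mistakes h +
      Real.log (totalWeight F r T (sample h)) := fun t =>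
    (measurable_mistakes.const_mul _).add
      (Real.measurable_log.comp ((measurable_totalWeight hr hle T t).comp measurable_sample))
  have hb : ∀ t, ∀ h : Hist X t, |(1 - Real.exp (-rate T)) * mistakes h +
      Real.log (totalWeight F r T (sample h))| ≤ (1 - Real.exp (-rate T)) * t +
        (Real.log (experts T).card + rate T * t) := fun t h => by
    refine (abs_add_le _ _).trans (add_le_add ?_ (abs_log_totalWeight_le F r T _))
    rw [abs_mul, abs_of_nonneg hc0]
    exact mul_le_mul_of_nonneg_left (abs_mistakes_le h) hc0
  induction t with
  | zero =>
    have : ∀ h : Hist X 0, (1 - Real.exp (-rate T)) * mistakes h +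
        Real.log (totalWeight F r T (sample h)) = Real.log (experts T).card := fun h => by
      simp [mistakes, totalWeight, expertLoss]
    simp [this]
  | succ t ih =>
    refine le_trans (integral_play_succ_le_of_forall (L T) A t (hm (t + 1)) (hb (t + 1))
      (hm t) (hb t) fun h x => ?_) (ih (Nat.le_of_succ_le ht))
    simp only [mistakes_extend, sample_extend]
    have h1 := log_totalWeight_snoc_le F r T (sample h) x (A.label t (played h) x)
    rw [← predict_hedge hL ht] at h1
    have h2 := real_false_eq ((L T).predict t (h, x))
    rw [integral_bool]
    revert h1
    cases A.label t (played h) x <;> simp [h2] <;> intro h1 <;> linarith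

/-- The regret bound of Hedge against the best expert, for a pointwise upper bound `G` of the loss
of the best expert. -/
theorem integral_mistakes_hedge_le {L : ℕ → Learner X} (hL : IsTreeHedge F r L)
    (hr : Measurable r) (hle : MeasurableSet {p : X × X | TreeLE F r p.1 p.2})
    (A : AdaptiveAdversary U) {T : ℕ} (hrate : 0 < rate T) {G : Hist X T → ℝ}
    (hG : Integrable G (play (L T) A T))
    (hGS : ∀ᵐ h ∂(play (L T) A T), ∃ S ∈ experts T, expertLoss F r S (sample h) ≤ G h) :
    ∫ h, mistakes h ∂(play (L T) A T) ≤ ∫ h, G h ∂(play (L T) A T) +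
      Real.log (experts T).card / rate T + rate T * T / 2 := by
  have h1 := integral_potential_le hL hr hle A T le_rfl
  have hmi : Integrable (fun h : Hist X T => mistakes h) (play (L T) A T) :=
    integrable_of_bound measurable_mistakes abs_mistakes_le
  have hwi : Integrable (fun h : Hist X T => Real.log (totalWeight F r T (sample h)))
      (play (L T) A T) := integrable_of_bound (Real.measurable_log.comp
        ((measurable_totalWeight hr hle T T).comp measurable_sample))
        (fun h => abs_log_totalWeight_le F r T _)
  rw [integral_add (hmi.const_mul _) hwi, integral_const_mul] at h1
  have h2 : ∫ h, -rate T * G h ∂(play (L T) A T) ≤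
      ∫ h, Real.log (totalWeight F r T (sample h)) ∂(play (L T) A T) := by
    refine integral_mono_ae (hG.const_mul _) hwi ?_
    filter_upwards [hGS] with h ⟨S, hS, hSG⟩
    refine le_trans ?_ (neg_rate_mul_expertLoss_le_log_totalWeight F r hS (sample h))
    rw [neg_mul, neg_mul, neg_le_neg_iff]
    exact mul_le_mul_of_nonneg_left hSG hrate.le
  rw [integral_const_mul] at h2
  have h3 := exp_neg_le hrate.le
  have h4 : ∫ h, mistakes h ∂(play (L T) A T) ≤ T :=
    (le_abs_self _).trans (abs_integral_le_of_bound abs_mistakes_le)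
  have h5 : 0 ≤ ∫ h, mistakes h ∂(play (L T) A T) := integral_nonneg mistakes_nonneg
  set Q := ∫ h, mistakes h ∂(play (L T) A T)
  set I := ∫ h, G h ∂(play (L T) A T)
  -- The second-order term multiplies `Q` itself; the trivial bound `Q ≤ T` turns it into `rate T ^
  -- 2 / 2 * T`.
  have h6 : rate T * Q ≤ rate T * (I + Real.log (experts T).card / rate T + rate T * T / 2) := by
    have h7 : rate T * (Real.log (experts T).card / rate T) = Real.log (experts T).card := by
      field_simp
    have h8 : (rate T - rate T ^ 2 / 2) * Q ≤ (1 - Real.exp (-rate T)) * Q :=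
      mul_le_mul_of_nonneg_right (by linarith) h5
    have h9 : rate T ^ 2 / 2 * Q ≤ rate T ^ 2 / 2 * T := by gcongr
    rw [mul_add, mul_add, h7]
    nlinarith
  exact le_of_mul_le_mul_left h6 hrate

end Measurability

/-! ### Ladders -/

section Ladder

variable {X : Type*} [MeasurableSpace X]

/-- The instances strictly above `v` whose label an adversary is free to choose, if it knows how to
go on both from `w` and from the points of `B`. -/
def goodSet (F : Set (X → Bool)) (r : X → Bool) (B : Set X) (v w : X) : Set X :=
  {z | TreeLT F r v z ∧ (TreeLE F r z w ∨ (z ∈ B ∧ ¬ TreeLE F r w z))}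

/-- From the points of `B'` one can step up to points of `B`, measurably, with distributions in `U`
that charge the good sets. -/
def Extends (F : Set (X → Bool)) (r : X → Bool) (U : Set (ProbabilityMeasure X)) (ε : ℝ)
    (B B' : Set X) : Prop :=
  ∃ n : X → X, Measurable n ∧ ∃ ν : X → ProbabilityMeasure X, Measurable ν ∧ ∀ v ∈ B',
    ν v ∈ U ∧ n v ∈ B ∧ TreeLT F r v (n v) ∧ ε ≤ (ν v : Measure X).real (goodSet F r B v (n v))

/-- There is a sequence of `K` extensions that starts with `B₀` and does not end with the empty
set. -/
def HasLadder (F : Set (X → Bool)) (r : X → Bool) (U : Set (ProbabilityMeasure X)) (ε : ℝ)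
    (B₀ : Set X) (K : ℕ) : Prop :=
  ∃ B : ℕ → Set X, B 0 = B₀ ∧ (∀ j, MeasurableSet (B j)) ∧
    (∀ j < K, Extends F r U ε (B j) (B (j + 1))) ∧ (B K).Nonempty

variable {F : Set (X → Bool)} {r : X → Bool} {U : Set (ProbabilityMeasure X)} {ε : ℝ}

/-- Makes the family of extensions nonempty for the exhaustion below; the Dirac mass only serves as
a default value. -/
theorem extends_empty [Nonempty X] (B : Set X) : Extends F r U ε B ∅ :=
  ⟨id, measurable_id, fun _ => ⟨Measure.dirac (Classical.arbitrary X), inferInstance⟩,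
    measurable_const, by simp⟩

/-- Only the points of the extended set carry a requirement, so step functions on disjointed pieces
can be glued. -/
theorem Extends.iUnion {B : Set X} {B' : ℕ → Set X} (hB' : ∀ i, MeasurableSet (B' i))
    (h : ∀ i, Extends F r U ε B (B' i)) : Extends F r U ε B (⋃ i, B' i) := by
  choose n hn ν hν hstep using h
  obtain ⟨f, hf, hfeq⟩ := exists_measurable_piecewise (disjointed B')
    (fun i => MeasurableSet.disjointed hB' i) (fun i v => (n i v, ν i v))
    (fun i => (hn i).prodMk (hν i)) (fun i j hij x hx =>
      ((disjoint_disjointed B' hij).le_bot hx).elim)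
  refine ⟨fun v => (f v).1, measurable_fst.comp hf, fun v => (f v).2, measurable_snd.comp hf, ?_⟩
  intro v hv
  rw [← iUnion_disjointed] at hv
  obtain ⟨i, hi⟩ := Set.mem_iUnion.1 hv
  have hfv := hfeq i hi
  simp only [hfv]
  exact hstep i v (disjointed_subset B' i hi)

theorem Extends.union {B B₁ B₂ : Set X} (h₁ : MeasurableSet B₁) (h₂ : MeasurableSet B₂)
    (H₁ : Extends F r U ε B B₁) (H₂ : Extends F r U ε B B₂) : Extends F r U ε B (B₁ ∪ B₂) := by
  have : B₁ ∪ B₂ = ⋃ i : ℕ, if i = 0 then B₁ else B₂ := by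
    ext x
    simp only [Set.mem_union, Set.mem_iUnion]
    constructor
    · rintro (h | h)
      · exact ⟨0, by simpa using h⟩
      · exact ⟨1, by simpa using h⟩
    · rintro ⟨i, hi⟩
      split_ifs at hi
      · exact Or.inl hi
      · exact Or.inr hi
  rw [this]
  exact Extends.iUnion (fun i => by split_ifs <;> assumption) (fun i => by split_ifs <;> assumption)

/-- Up to null sets there is a largest extension. -/
theorem exists_maximal_extension [Nonempty X] (m : Measure X) [IsFiniteMeasure m] (B : Set X) :
    ∃ B', MeasurableSet B' ∧ Extends F r U ε B B' ∧
      ∀ B'', MeasurableSet B'' → Extends F r U ε B B'' → m (B'' \ B') = 0 := by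
  -- Exhaustion: the union of a maximizing sequence is again an extension and attains the supremum
  -- of the masses, so no extension can add mass to it.
  set V : Set ENNReal := {c | ∃ B', MeasurableSet B' ∧ Extends F r U ε B B' ∧ m B' = c} with hV
  have hne : V.Nonempty := ⟨m ∅, ∅, MeasurableSet.empty, extends_empty B, rfl⟩
  obtain ⟨c, -, hc, hcV⟩ := exists_seq_tendsto_sSup hne (OrderTop.bddAbove V)
  choose C hCm hCe hCc using hcV
  have hUm : MeasurableSet (⋃ i, C i) := MeasurableSet.iUnion hCm
  have hUe := Extends.iUnion hCm hCe
  have hUc : sSup V ≤ m (⋃ i, C i) :=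
    le_of_tendsto' hc fun i => (hCc i).symm.le.trans (measure_mono (Set.subset_iUnion C i))
  refine ⟨⋃ i, C i, hUm, hUe, fun B'' hm he => ?_⟩
  have h1 : m ((⋃ i, C i) ∪ B'') ≤ m (⋃ i, C i) :=
    (le_sSup ⟨_, hUm.union hm, hUe.union hUm hm he, rfl⟩ : _ ≤ sSup V).trans hUc
  have h2 : m ((⋃ i, C i) ∪ B'') = m (⋃ i, C i) + m (B'' \ ⋃ i, C i) := by
    rw [← Set.union_sdiff_self, measure_union Set.disjoint_sdiff_right (hm.diff hUm)]
  rw [h2] at h1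
  by_contra h3
  exact absurd h1 (not_le.2 (ENNReal.lt_add_right (measure_ne_top m _) h3))

/-- Iterating the greedy choice gives levels that are each maximal over the previous one. If no
ladder of height `K` exists, level `K` of this particular sequence must be empty. -/
theorem exists_maximal_extensions [Nonempty X] (F : Set (X → Bool)) (r : X → Bool)
    (U : Set (ProbabilityMeasure X)) (ε : ℝ) (m : Measure X) [IsFiniteMeasure m]
    {B₀ : Set X} (hB₀ : MeasurableSet B₀) :
    ∃ B : ℕ → Set X, B 0 = B₀ ∧ (∀ j, MeasurableSet (B j)) ∧ ∀ j, Extends F r U ε (B j) (B (j + 1)) ∧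
      ∀ B'', MeasurableSet B'' → Extends F r U ε (B j) B'' → m (B'' \ B (j + 1)) = 0 := by
  choose next hm he hmax using fun B : Set X =>
    exists_maximal_extension (F := F) (r := r) (U := U) (ε := ε) m B
  refine ⟨fun j => Nat.rec B₀ (fun _ B => next B) j, rfl, fun j => ?_, fun j => ⟨he _, hmax _⟩⟩
  cases j with
  | zero => exact hB₀
  | succ j => exact hm _

/-- Against a maximal extension `B'` of `B`, an adversary in `U` cannot make the next instance rise
from a point outside `B'` to a point of `B` with large probability. -/
theorem measureReal_rise_lt [StandardBorelSpace X]
    (hlt : MeasurableSet {p : X × X | TreeLT F r p.1 p.2}) (hε : 0 < ε) {B B' : Set X}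
    (hB : MeasurableSet B) (hB' : MeasurableSet B') (L : Learner X) (A : AdaptiveAdversary U)
    {t : ℕ} (s : Fin t) {m : Measure X} (hm : (play L A t).map (fun h => (h s).1) ≪ m)
    (hmax : ∀ B'', MeasurableSet B'' → Extends F r U ε B B'' → m (B'' \ B') = 0) :
    ∀ᵐ h ∂(play L A t), (h s).1 ∉ B' →
      (A.dist t (played h) : Measure X).real {z | z ∈ B ∧ TreeLT F r (h s).1 z} < 2 * ε := by
  set κ := A.instanceKernel t
  have hxs : Measurable fun h : Hist X t => (h s).1 := by fun_prop
  have hE : MeasurableSet {q : (Hist X t × X) × X | q.2 ∈ B ∧ TreeLT F r (q.1.1 s).1 q.2 ∧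
      ¬ TreeLT F r q.1.2 q.2} := by
    refine (measurable_snd hB).inter (MeasurableSet.inter ?_ (MeasurableSet.compl ?_))
    · have : Measurable fun q : (Hist X t × X) × X => ((q.1.1 s).1, q.2) := by fun_prop
      exact this hlt
    · have : Measurable fun q : (Hist X t × X) × X => (q.1.2, q.2) := by fun_prop
      exact this hlt
  have hEm : Measurable fun p : Hist X t × X => κ p.1
      {z | z ∈ B ∧ TreeLT F r (p.1 s).1 z ∧ ¬ TreeLT F r p.2 z} :=
    Kernel.measurable_kernel_prodMk_left (κ := κ.comap Prod.fst measurable_fst) hE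
  -- `W` collects histories together with a second sample `w`, drawn independently from the same
  -- conditional law, that could serve as the next point in an extension.
  set W : Set (Hist X t × X) := {p | (p.1 s).1 ∉ B' ∧ p.2 ∈ B ∧ TreeLT F r (p.1 s).1 p.2 ∧
    ε ≤ (κ p.1).real {z | z ∈ B ∧ TreeLT F r (p.1 s).1 z ∧ ¬ TreeLT F r p.2 z}} with hW
  have hWm : MeasurableSet W := by
    refine ((hxs.comp measurable_fst) hB').compl.inter ((measurable_snd hB).inter
      (MeasurableSet.inter ?_ ?_))
    · have : Measurable fun q : Hist X t × X => ((q.1 s).1, q.2) := by fun_prop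
      exact this hlt
    · exact measurableSet_le measurable_const hEm.ennreal_toReal
  have hW0 : (play L A t ⊗ₘ κ) W = 0 := by
    by_contra hne
    -- An extension must choose its step as a function of the point `v` alone; the section picks,
    -- for each `v`, one history with `v` at time `s` and one sample `w`.
    obtain ⟨B'', g, hB'', hg, hpos, hgW⟩ := exists_measurable_section (play L A t ⊗ₘ κ)
      (hxs.comp measurable_fst) hWm hne
    have hext : Extends F r U ε B B'' := by
      refine ⟨fun v => (g v).2, measurable_snd.comp hg, fun v => A.dist t (played (g v).1), ?_, ?_⟩
      · exact ((A.measurable_dist t).comp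
          (measurable_played.comp (measurable_fst.comp hg))).subtype_mk
      · intro v hv
        obtain ⟨⟨-, h1, h2, h3⟩, h4⟩ := hgW v hv
        simp only [Function.comp] at h4
        rw [h4] at h2 h3
        refine ⟨A.dist_mem _ _, h1, h2, h3.trans (measureReal_mono ?_)⟩
        rintro z ⟨hz1, hz2, hz3⟩
        refine ⟨hz2, ?_⟩
        -- For `z ∈ B`, failing both alternatives of `goodSet` means exactly that `w` is strictly
        -- below `z`.
        by_contra! h
        exact hz3 ⟨h.2 hz1, h.1⟩
    have h1 := hmax B'' hB'' hext
    have h2 : B'' \ B' = B'' := by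
      rw [sdiff_eq_left]
      refine Set.disjoint_left.2 fun v hv hv' => ?_
      obtain ⟨⟨h3, -⟩, h4⟩ := hgW v hv
      simp only [Function.comp] at h4
      rw [h4] at h3
      exact h3 hv'
    rw [h2] at h1
    refine hpos ?_
    have h3 : (play L A t ⊗ₘ κ).map ((fun h : Hist X t => (h s).1) ∘ Prod.fst) =
        (play L A t).map (fun h => (h s).1) := by
      rw [← Measure.map_map hxs measurable_fst]
      congr 1
      exact Measure.fst_compProd _ _
    rw [h3]
    exact hm h1
  have h1 : ∀ᵐ p ∂(play L A t ⊗ₘ κ), p ∉ W := measure_eq_zero_iff_ae_notMem.1 hW0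
  rw [Measure.ae_compProd_iff hWm.compl] at h1
  filter_upwards [h1] with h hh hB'h
  by_contra! hge
  have hC : MeasurableSet {z | z ∈ B ∧ TreeLT F r (h s).1 z} :=
    hB.inter (measurable_prodMk_left hlt)
  -- A large rise probability splits in half: many samples `w` leave mass `ε` not strictly above
  -- them. This is where `2 * ε` comes from.
  refine measure_pos_of_half (ν := κ h) hlt (fun x y hxy hyx => hxy.2 hyx.1) hC hε hge ?_
  refine measure_mono_null ?_ (ae_iff.1 hh)
  rintro w ⟨⟨hw1, hw2⟩, hw3⟩
  simp only [Set.mem_ofPred_eq, not_not]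
  refine ⟨hB'h, hw1, hw2, ?_⟩
  simpa only [Set.mem_ofPred_eq, and_assoc] using hw3

end Ladder

/-! ### Rises -/

section Rises

variable {X : Type*}

/-- The instances in `B j` that rise above the current instance of the expert `E(S)`, where `K - j`
is the number of times in `S` that have passed. -/
def rises (F : Set (X → Bool)) (r : X → Bool) (B : ℕ → Set X) (K : ℕ) (S : Finset ℕ) {t : ℕ}
    (x : Fin t → X) : Set X :=
  {z | ∃ s : Fin t, (s : ℕ) ∈ S ∧ (∀ s' ∈ S, s' < t → s' ≤ s) ∧
    ∃ j, j + (S.filter (· < t)).card = K ∧ x s ∉ B (j + 1) ∧ z ∈ B j ∧ TreeLT F r (x s) z}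

open Classical in
/-- The number of rises along a sequence. -/
noncomputable def riseCount (F : Set (X → Bool)) (r : X → Bool) (B : ℕ → Set X) (K : ℕ)
    (S : Finset ℕ) {t : ℕ} (x : Fin t → X) : ℝ :=
  ∑ s : Fin t, if x s ∈ rises F r B K S (fun i : Fin (s : ℕ) => x (Fin.castLE s.isLt.le i))
    then 1 else 0

variable (F : Set (X → Bool)) (r : X → Bool) (B : ℕ → Set X) (K : ℕ)

open Classical in
theorem riseCount_snoc (S : Finset ℕ) {t : ℕ} (x : Fin t → X) (z : X) :
    riseCount F r B K S (Fin.snoc (α := fun _ => X) x z) =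
      riseCount F r B K S x + if z ∈ rises F r B K S x then 1 else 0 := by
  unfold riseCount
  rw [Fin.sum_univ_castSucc]
  congr 1
  · refine Finset.sum_congr rfl fun s _ => ?_
    have h : (fun i : Fin (s : ℕ) =>
        (Fin.snoc (α := fun _ => X) x z (Fin.castLE (Fin.castSucc s).isLt.le i) : X)) =
        fun i => x (Fin.castLE s.isLt.le i) := by
      funext i
      have : Fin.castLE (Fin.castSucc s).isLt.le i = Fin.castSucc (Fin.castLE s.isLt.le i) := rfl
      rw [this]
      exact Fin.snoc_castSucc (α := fun _ => X) z x _
    simp only [Fin.snoc_castSucc, Fin.val_castSucc]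
    exact if_congr (by rw [← h]) rfl rfl
  · have h : (fun i : Fin t =>
        (Fin.snoc (α := fun _ => X) x z (Fin.castLE (Fin.last t).isLt.le i) : X)) = x := by
      funext i
      have : Fin.castLE (Fin.last t).isLt.le i = Fin.castSucc i := rfl
      rw [this]
      exact Fin.snoc_castSucc (α := fun _ => X) z x _
    simp only [Fin.snoc_last]
    exact if_congr (iff_of_eq (congrArg (fun y => z ∈ rises F r B K S y) h)) rfl rfl

open Classical in
theorem riseCount_le (S : Finset ℕ) {t : ℕ} (x : Fin t → X) : riseCount F r B K S x ≤ t := by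
  unfold riseCount
  calc _ ≤ ∑ _s : Fin t, (1 : ℝ) := Finset.sum_le_sum fun _ _ => by split_ifs <;> norm_num
    _ = t := by simp

-- The count up to `t` sees only the times of `S` before `t`, so an update made at time `t` does not
-- disturb it.
open Classical in
theorem riseCount_congr {S S' : Finset ℕ} {t : ℕ} (h : ∀ s < t, s ∈ S ↔ s ∈ S') (x : Fin t → X) :
    riseCount F r B K S x = riseCount F r B K S' x := by
  unfold riseCount
  refine Finset.sum_congr rfl fun s _ => if_congr (iff_of_eq ?_) rfl rfl
  congr 1
  unfold rises
  have h1 : S.filter (· < (s : ℕ)) = S'.filter (· < (s : ℕ)) := by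
    ext a
    simp only [Finset.mem_filter]
    exact ⟨fun ⟨ha, hs⟩ => ⟨(h a (hs.trans s.isLt)).1 ha, hs⟩,
      fun ⟨ha, hs⟩ => ⟨(h a (hs.trans s.isLt)).2 ha, hs⟩⟩
  ext z
  simp only [Set.mem_ofPred_eq, h1]
  refine exists_congr fun i => and_congr (h _ (i.isLt.trans s.isLt)) (and_congr ?_ Iff.rfl)
  exact ⟨fun H a ha hs => H a ((h a (hs.trans s.isLt)).2 ha) hs,
    fun H a ha hs => H a ((h a (hs.trans s.isLt)).1 ha) hs⟩

theorem expertPredict_congr {S S' : Finset ℕ} {t : ℕ} (h : ∀ s ≤ t, s ∈ S ↔ s ∈ S')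
    (z : Fin (t + 1) → X) : expertPredict F r S z = expertPredict F r S' z := by
  unfold expertPredict
  congr 1
  rw [decide_eq_decide]
  refine exists_congr fun i => and_congr (h _ (Nat.lt_succ_iff.1 i.isLt)) (and_congr ?_ Iff.rfl)
  exact ⟨fun H a ha hs => H a ((h a hs).2 ha) hs, fun H a ha hs => H a ((h a hs).1 ha) hs⟩

theorem expertLoss_congr {S S' : Finset ℕ} {t : ℕ} (h : ∀ s < t, s ∈ S ↔ s ∈ S')
    (D : Fin t → X × Bool) : expertLoss F r S D = expertLoss F r S' D := by
  unfold expertLoss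
  refine Finset.sum_congr rfl fun s _ => ?_
  rw [expertPredict_congr F r fun a ha => h a (ha.trans_lt s.isLt)]

variable {F r B K}

open Classical in
theorem expertPredict_eq_of_exists {S : Finset ℕ} {t : ℕ} {z : Fin (t + 1) → X}
    (h : ∃ s : Fin (t + 1), (s : ℕ) ∈ S ∧ (∀ s' ∈ S, s' ≤ t → s' ≤ s) ∧
      TreeLE F r (z (Fin.last t)) (z s)) : expertPredict F r S z = !(r (z (Fin.last t))) := by
  unfold expertPredict
  rw [decide_eq_true h, Bool.xor_true]

open Classical in
theorem expertPredict_eq_of_not_exists {S : Finset ℕ} {t : ℕ} {z : Fin (t + 1) → X}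
    (h : ¬ ∃ s : Fin (t + 1), (s : ℕ) ∈ S ∧ (∀ s' ∈ S, s' ≤ t → s' ≤ s) ∧
      TreeLE F r (z (Fin.last t)) (z s)) : expertPredict F r S z = r (z (Fin.last t)) := by
  unfold expertPredict
  rw [decide_eq_false h, Bool.xor_false]

/-- The expert `E(S)` makes at most `K` updates, all of them at instances on which `f` differs from
`r`, the last of them outside the set `B (j + 1)` with `j` the number of updates left,
and loses at most the number of rises more than `f`. -/
structure Follows (F : Set (X → Bool)) (r : X → Bool) (B : ℕ → Set X) (K : ℕ) (f : X → Bool)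
    {t : ℕ} (D : Fin t → X × Bool) (S : Finset ℕ) : Prop where
  subset : S ⊆ Finset.range t
  card_le : S.card ≤ K
  ne : ∀ s : Fin t, (s : ℕ) ∈ S → f (D s).1 ≠ r (D s).1
  notMem : ∀ s : Fin t, (s : ℕ) ∈ S → (∀ s' ∈ S, s' ≤ s) → ∀ j, j + S.card = K →
    (D s).1 ∉ B (j + 1)
  loss_le : expertLoss F r S D ≤ errors f D + riseCount F r B K S fun s => (D s).1

open Classical in
/-- Every member of the class is followed by some expert with at most `K` updates. -/
theorem exists_follows (hVC : vcDim F = 1) (hr : r ∈ F) {f : X → Bool} (hf : f ∈ F)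
    (hfB : ∀ x, f x ≠ r x → x ∈ B 0) (hK : 1 ≤ K) (hBK : B K = ∅) {t : ℕ}
    (D : Fin t → X × Bool) : ∃ S, Follows F r B K f D S := by
  induction t with
  | zero => exact ⟨∅, by simp, by simp, by simp, by simp, by simp [expertLoss, errors, riseCount]⟩
  | succ t ih =>
    obtain ⟨D, p, rfl⟩ : ∃ D' p, D = Fin.snoc (α := fun _ => X × Bool) D' p :=
      ⟨Fin.init D, D (Fin.last t), (Fin.snoc_init_self D).symm⟩
    obtain ⟨x, y⟩ := p
    obtain ⟨S, hSt, hSK, hSf, hSB, hSl⟩ := ih D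
    set D' : Fin (t + 1) → X × Bool := Fin.snoc (α := fun _ => X × Bool) D (x, y) with hD'
    have hfst : (fun s : Fin (t + 1) => (D' s).1) =
        Fin.snoc (α := fun _ => X) (fun s => (D s).1) x := by
      funext s
      refine Fin.lastCases ?_ (fun j => ?_) s <;> simp [hD']
    have htS : t ∉ S := fun h => by simpa using hSt h
    have hSlt : ∀ s ∈ S, s < t := fun s hs => Finset.mem_range.1 (hSt hs)
    -- It suffices that in the new round the expert agrees with `f` or a rise occurs, which pays for
    -- any mistake.
    have hgoal : ∀ S' : Finset ℕ, (∀ s < t, s ∈ S' ↔ s ∈ S) →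
        (expertPredict F r S' (Fin.snoc (α := fun _ => X) (fun s => (D s).1) x) = f x ∨
          x ∈ rises F r B K S' fun s => (D s).1) →
        expertLoss F r S' D' ≤ errors f D' + riseCount F r B K S' fun s => (D' s).1 := by
      intro S' hS' h
      rw [hfst, hD', expertLoss_snoc, errors_snoc, riseCount_snoc, expertLoss_congr F r hS',
        riseCount_congr F r B K hS']
      rcases h with h | h
      · rw [h]
        have : (0 : ℝ) ≤ if x ∈ rises F r B K S' fun s => (D s).1 then 1 else 0 := by
          split_ifs <;> norm_num
        linarith
      · rw [if_pos h]
        have h1 : (if expertPredict F r S' (Fin.snoc (α := fun _ => X) (fun s => (D s).1) x) ≠ y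
          then (1 : ℝ) else 0) ≤ 1 := by split_ifs <;> norm_num
        have h2 : (0 : ℝ) ≤ if f x ≠ y then 1 else 0 := by split_ifs <;> norm_num
        linarith
    have hkeep : (expertPredict F r S (Fin.snoc (α := fun _ => X) (fun s => (D s).1) x) = f x ∨
        x ∈ rises F r B K S fun s => (D s).1) → ∃ S, Follows F r B K f D' S := by
      intro h
      refine ⟨S, hSt.trans (Finset.range_subset_range.2 (Nat.le_succ t)), hSK, fun s => ?_,
        fun s => ?_, hgoal S (fun _ _ => Iff.rfl) h⟩
      · refine Fin.lastCases (fun h => (htS h).elim) (fun s => ?_) s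
        simpa [hD'] using hSf s
      · refine Fin.lastCases (fun h => (htS h).elim) (fun s => ?_) s
        simpa [hD'] using hSB s
    -- With `S.card` updates made, `K - S.card` are left. The update uses one, so its instance must
    -- avoid `B (K - S.card)`, the level one above the new remainder.
    have hupdate : f x ≠ r x → S.card + 1 ≤ K → x ∉ B (K - S.card) →
        ∃ S, Follows F r B K f D' S := by
      intro hfx hc hxB
      refine ⟨insert t S, ?_, ?_, fun s => ?_, fun s => ?_,
        hgoal (insert t S) (fun s hs => by simp [hs.ne]) (Or.inl ?_)⟩
      · exact Finset.insert_subset (by simp)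
          (hSt.trans (Finset.range_subset_range.2 (Nat.le_succ t)))
      · rwa [Finset.card_insert_of_notMem htS]
      · refine Fin.lastCases (fun _ => by simpa [hD'] using hfx) (fun s hs => ?_) s
        have hs' : (s : ℕ) ∈ S := (Finset.mem_insert.1 hs).resolve_left s.isLt.ne
        simpa [hD'] using hSf s hs'
      · refine Fin.lastCases (fun _ _ j hj => ?_) (fun s hs hmax => ?_) s
        · rw [Finset.card_insert_of_notMem htS] at hj
          have : j + 1 = K - S.card := by omega
          simpa [hD', this] using hxB
        · exact absurd s.isLt (not_lt.2 (hmax t (Finset.mem_insert_self t S)))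
      -- An update takes effect in its own round, by reflexivity of the order, so it costs no
      -- mistake beyond those of `f`.
      · rw [expertPredict_eq_of_exists]
        · simpa [Bool.eq_not] using (Ne.symm hfx)
        · exact ⟨Fin.last t, by simp, fun s' _ h => by simpa using h, TreeLE.refl F r _⟩
    by_cases hfx : f x = r x
    · refine hkeep (Or.inl ?_)
      rw [expertPredict_eq_of_not_exists]
      · simp [hfx]
      · rintro ⟨s, hs, -, hle⟩
        revert hs hle
        refine Fin.lastCases (fun h => (htS h).elim) (fun s hs hle => ?_) s
        simp only [Fin.snoc_last, Fin.snoc_castSucc] at hle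
        exact hle f hf (hSf s hs) hfx
    rcases S.eq_empty_or_nonempty with rfl | hne
    -- The first update is always allowed because `B K` is empty.
    · exact hupdate hfx (by simpa using hK) (by simp [hBK])
    have hmS := S.max'_mem hne
    set m : Fin t := ⟨S.max' hne, hSlt _ hmS⟩ with hm
    by_cases hle : TreeLE F r x (D m).1
    · refine hkeep (Or.inl ?_)
      rw [expertPredict_eq_of_exists]
      · simpa [Bool.eq_not] using (Ne.symm hfx)
      · refine ⟨Fin.castSucc m, hmS, fun s' hs' _ => S.le_max' s' hs', ?_⟩
        simpa using hle
    have hlt := treeLT_of_not_treeLE hVC hr hf (hSf m hmS) hfx hle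
    by_cases hxB : x ∈ B (K - S.card)
    · refine hkeep (Or.inr ⟨m, hmS, fun s' hs' _ => S.le_max' s' hs', K - S.card, ?_, ?_, hxB, hlt⟩)
      · rw [Finset.filter_true_of_mem hSlt]
        omega
      · exact hSB m hmS (fun s' hs' => S.le_max' s' hs') _ (by omega)
    -- The updates cannot run out: with none left the relevant level is `B 0`, which contains all of
    -- `{f ≠ r}`, so the instance would have been a rise.
    · refine hupdate hfx ?_ hxB
      by_contra hcon
      have : K - S.card = 0 := by omega
      rw [this] at hxB
      exact hxB (hfB x hfx)

end Rises

/-! ### The regret of Hedge in the absence of ladders -/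

section Upper

variable {X : Type*} [MeasurableSpace X] {F : Set (X → Bool)} {r : X → Bool}
  {U : Set (ProbabilityMeasure X)} {B : ℕ → Set X} {ε : ℝ} {K : ℕ}

theorem measurableSet_rises (hlt : MeasurableSet {p : X × X | TreeLT F r p.1 p.2})
    (hB : ∀ j, MeasurableSet (B j)) (K : ℕ) (S : Finset ℕ) (t : ℕ) :
    MeasurableSet {p : (Fin t → X) × X | p.2 ∈ rises F r B K S p.1} := by
  have : {p : (Fin t → X) × X | p.2 ∈ rises F r B K S p.1} =
      ⋃ s : Fin t, ⋃ j : ℕ, {p | ((s : ℕ) ∈ S ∧ (∀ s' ∈ S, s' < t → s' ≤ s) ∧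
        j + (S.filter (· < t)).card = K) ∧ p.1 s ∉ B (j + 1) ∧ p.2 ∈ B j ∧
          TreeLT F r (p.1 s) p.2} := by
    ext p
    simp only [rises, Set.mem_ofPred_eq, Set.mem_iUnion]
    constructor
    · rintro ⟨s, h1, h2, j, h3, h4⟩
      exact ⟨s, j, ⟨h1, h2, h3⟩, h4⟩
    · rintro ⟨s, j, ⟨h1, h2, h3⟩, h4⟩
      exact ⟨s, h1, h2, j, h3, h4⟩
  rw [this]
  refine MeasurableSet.iUnion fun s => MeasurableSet.iUnion fun j => (MeasurableSet.const _).inter ?_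
  have h1 : Measurable fun p : (Fin t → X) × X => p.1 s := by fun_prop
  have h2 : Measurable fun p : (Fin t → X) × X => (p.1 s, p.2) := by fun_prop
  exact (h1 (hB (j + 1))).compl.inter ((measurable_snd (hB j)).inter (h2 hlt))

open Classical in
theorem measurable_riseCount (hlt : MeasurableSet {p : X × X | TreeLT F r p.1 p.2})
    (hB : ∀ j, MeasurableSet (B j)) (K : ℕ) (S : Finset ℕ) (t : ℕ) :
    Measurable fun x : Fin t → X => riseCount F r B K S x := by
  unfold riseCount
  refine Finset.measurable_sum _ fun s _ => Measurable.ite ?_ measurable_const measurable_const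
  have h : Measurable fun x : Fin t → X =>
      ((fun i : Fin (s : ℕ) => x (Fin.castLE s.isLt.le i)), x s) := by fun_prop
  exact h (measurableSet_rises hlt hB K S s)

/-- The set `S` determines both the last update and the level, so the two existential quantifiers in
`rises` cause no union bound. -/
theorem measureReal_rises_le {μ : Measure X} [IsProbabilityMeasure μ] {S : Finset ℕ} {t : ℕ}
    {x : Fin t → X} {p : ℝ} (hp : 0 ≤ p)
    (h : ∀ s j, x s ∉ B (j + 1) → μ.real {z | z ∈ B j ∧ TreeLT F r (x s) z} ≤ p) :
    μ.real (rises F r B K S x) ≤ p := by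
  rcases (rises F r B K S x).eq_empty_or_nonempty with he | ⟨z, s, hs, hmax, j, hj, hxs, -⟩
  · simpa [he] using hp
  · refine (measureReal_mono ?_).trans (h s j hxs)
    rintro z' ⟨s', hs', hmax', j', hj', -, hz', hlt'⟩
    have h1 : s' = s := Fin.ext (le_antisymm (hmax s' hs' s'.isLt) (hmax' s hs s.isLt))
    have h2 : j' = j := by omega
    subst h1 h2
    exact ⟨hz', hlt'⟩

/-- The instances of a history. -/
def instances {t : ℕ} (h : Hist X t) : Fin t → X := fun s => (h s).1

theorem measurable_instances {t : ℕ} : Measurable (instances : Hist X t → Fin t → X) := by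
  unfold instances
  fun_prop

theorem instances_extend (A : AdaptiveAdversary U) (t : ℕ) (h : Hist X t) (x : X) (b : Bool) :
    instances (A.extend t (h, (x, b))) = Fin.snoc (α := fun _ => X) (instances h) x := by
  funext s
  refine Fin.lastCases ?_ (fun j => ?_) s <;> simp [instances, AdaptiveAdversary.extend]

-- Conditionally on the past a round multiplies the exponential by at most `1 + (e - 1) * p` on
-- average. A moment bound is used because the relevant expert depends on the whole history, so all
-- experts must be controlled at once.
open Classical in
theorem integral_exp_riseCount_le (hlt : MeasurableSet {p : X × X | TreeLT F r p.1 p.2})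
    (hB : ∀ j, MeasurableSet (B j)) (L : Learner X) (A : AdaptiveAdversary U) {p : ℝ} (hp : 0 ≤ p)
    {T : ℕ} (H : ∀ t < T, ∀ s : Fin t, ∀ j, ∀ᵐ h ∂(play L A t), (h s).1 ∉ B (j + 1) →
      (A.dist t (played h) : Measure X).real {z | z ∈ B j ∧ TreeLT F r (h s).1 z} ≤ p)
    (S : Finset ℕ) (t : ℕ) (ht : t ≤ T) :
    ∫ h, Real.exp (riseCount F r B K S (instances h)) ∂(play L A t) ≤ (1 + 2 * p) ^ t := by
  have hm : ∀ t, Measurable fun h : Hist X t =>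
      Real.exp (riseCount F r B K S (instances h)) := fun t =>
    Real.measurable_exp.comp ((measurable_riseCount hlt hB K S t).comp measurable_instances)
  have hb : ∀ t, ∀ h : Hist X t, |Real.exp (riseCount F r B K S (instances h))| ≤ Real.exp t :=
    fun t h => by
      rw [abs_of_pos (Real.exp_pos _)]
      exact Real.exp_le_exp.2 (riseCount_le F r B K S _)
  induction t with
  | zero => simp [riseCount]
  | succ t ih =>
    have hstep := integral_play_succ_le L A t (hm (t + 1)) (hb (t + 1))
      (φ := fun h => (1 + 2 * p) * Real.exp (riseCount F r B K S (instances h)))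
      ((hm t).const_mul _) (C' := (1 + 2 * p) * Real.exp t) (fun h => by
        rw [abs_mul, abs_of_nonneg (by positivity : 0 ≤ 1 + 2 * p)]
        exact mul_le_mul_of_nonneg_left (hb t h) (by positivity)) ?_
    · refine hstep.trans ?_
      rw [integral_const_mul, pow_succ, mul_comm]
      exact mul_le_mul_of_nonneg_right (ih (Nat.le_of_succ_le ht)) (by positivity)
    · have hall := ae_all_iff.2 fun s => ae_all_iff.2 (H t ht s)
      filter_upwards [hall] with h hh
      have hR := measureReal_rises_le (K := K) (S := S) (x := instances h)
        (μ := (A.dist t (played h) : Measure X)) hp hh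
      have hRm : MeasurableSet (rises F r B K S (instances h)) :=
        measurable_prodMk_left (measurableSet_rises hlt hB K S t)
      -- The value `2` of the indicator is a bound for `e - 1`.
      have h1 : ∀ x b, Real.exp (riseCount F r B K S (instances (A.extend t (h, (x, b))))) ≤
          Real.exp (riseCount F r B K S (instances h)) *
            (1 + (rises F r B K S (instances h)).indicator (fun _ => 2) x) := by
        intro x b
        rw [instances_extend, riseCount_snoc, Real.exp_add]
        refine mul_le_mul_of_nonneg_left ?_ (Real.exp_pos _).le
        by_cases hx : x ∈ rises F r B K S (instances h)
        · rw [if_pos hx, Set.indicator_of_mem hx]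
          linarith [Real.exp_one_lt_d9]
        · simp [hx]
      have hind : Integrable ((rises F r B K S (instances h)).indicator (fun _ => (2 : ℝ)))
          (A.dist t (played h) : Measure X) := (integrable_const (2 : ℝ)).indicator hRm
      have h2 : ∫ x, Real.exp (riseCount F r B K S (instances h)) *
            (1 + (rises F r B K S (instances h)).indicator (fun _ => 2) x)
          ∂(A.dist t (played h) : Measure X) ≤
          (1 + 2 * p) * Real.exp (riseCount F r B K S (instances h)) := by
        rw [integral_const_mul, integral_add (integrable_const _) hind,
          integral_indicator_const _ hRm, mul_comm]
        refine mul_le_mul_of_nonneg_right ?_ (Real.exp_pos _).le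
        simp only [integral_const, probReal_univ, smul_eq_mul, mul_one]
        linarith
      refine (integral_mono_of_nonneg (Eventually.of_forall fun x => ?_)
        (((integrable_const _).add hind).const_mul _) (Eventually.of_forall fun x => ?_)).trans h2
      · exact integral_nonneg fun b => (Real.exp_pos _).le
      · refine (integral_mono_of_nonneg (Eventually.of_forall fun b => (Real.exp_pos _).le)
          (integrable_const _) (Eventually.of_forall (h1 x))).trans ?_
        rw [integral_const, probReal_univ, one_smul]
        exact le_rfl

theorem mem_experts_of_card_le {T : ℕ} {S : Finset ℕ} (hS : S ⊆ Finset.range T)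
    (hK : S.card ≤ K) (hKT : K ≤ Nat.sqrt T) : S ∈ experts T := by
  simp only [experts, Finset.mem_filter, Finset.mem_powerset]
  exact ⟨hS, hK.trans hKT⟩

/-- The regret of Hedge, if there is no ladder. -/
theorem integral_mistakes_le_of_not_hasLadder [StandardBorelSpace X]
    (hlt : MeasurableSet {p : X × X | TreeLT F r p.1 p.2})
    (hle : MeasurableSet {p : X × X | TreeLE F r p.1 p.2}) (hVC : vcDim F = 1) (hr : r ∈ F)
    (hrm : Measurable r) {L : ℕ → Learner X} (hL : IsTreeHedge F r L) (hε : 0 < ε) (hK : 1 ≤ K)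
    {B₀ : Set X} (hB₀ : MeasurableSet B₀) (hlad : ¬ HasLadder F r U ε B₀ K) {T : ℕ}
    (hKT : K ≤ Nat.sqrt T) (hrate : 0 < rate T) (A : AdaptiveAdversary U) {c : Hist X T → ℝ}
    (hc : Integrable c (play (L T) A T))
    (hcf : ∀ h, ∃ f ∈ F, (∀ x, f x ≠ r x → x ∈ B₀) ∧ errors f (sample h) ≤ c h) :
    ∫ h, mistakes h ∂(play (L T) A T) ≤ ∫ h, c h ∂(play (L T) A T) +
      (Real.log (experts T).card + 4 * ε * T + 1) +
      Real.log (experts T).card / rate T + rate T * T / 2 := by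
  have hT : 0 < T := by
    by_contra h
    obtain rfl : T = 0 := by omega
    simp at hKT
    omega
  obtain ⟨h₀⟩ : Nonempty (Hist X T) := (play (L T) A T).nonempty_of_neZero
  have : Nonempty X := ⟨(h₀ ⟨0, hT⟩).1⟩
  -- One finite measure that dominates the laws of all past instances, so that a single sequence of
  -- extensions is maximal for every pair of rounds.
  set m : Measure X := ∑ t ∈ Finset.range T, ∑ s : Fin t, (play (L T) A t).map (fun h => (h s).1)
    with hm
  obtain ⟨B, hB0, hBm, hBe⟩ := exists_maximal_extensions F r U ε m hB₀
  have hBK : B K = ∅ := by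
    by_contra h
    exact hlad ⟨B, hB0, hBm, fun j _ => (hBe j).1, Set.nonempty_iff_ne_empty.2 h⟩
  have hac : ∀ t < T, ∀ s : Fin t, (play (L T) A t).map (fun h => (h s).1) ≪ m := by
    intro t ht s
    refine Measure.absolutelyContinuous_of_le ?_
    refine (Finset.single_le_sum (f := fun s : Fin t => (play (L T) A t).map (fun h => (h s).1))
      (fun _ _ => Measure.zero_le _) (Finset.mem_univ s)).trans ?_
    exact Finset.single_le_sum (f := fun t => ∑ s : Fin t, (play (L T) A t).map (fun h => (h s).1))
      (fun _ _ => Measure.zero_le _) (Finset.mem_range.2 ht)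
  have H : ∀ t < T, ∀ s : Fin t, ∀ j, ∀ᵐ h ∂(play (L T) A t), (h s).1 ∉ B (j + 1) →
      (A.dist t (played h) : Measure X).real {z | z ∈ B j ∧ TreeLT F r (h s).1 z} ≤ 2 * ε := by
    intro t ht s j
    filter_upwards [measureReal_rise_lt hlt hε (hBm j) (hBm (j + 1)) (L T) A s (hac t ht s)
      (hBe j).2] with h hh hx using (hh hx).le
  -- This shift makes the sum of `exp (-a)` times the exponential moments, over all experts, at most
  -- one.
  set a : ℝ := Real.log (experts T).card + 4 * ε * T with ha
  have hexp : ∀ S, ∫ h, Real.exp (riseCount F r B K S (instances h)) ∂(play (L T) A T) ≤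
      Real.exp (4 * ε * T) := by
    intro S
    refine (integral_exp_riseCount_le hlt hBm (L T) A (by positivity) H S T le_rfl).trans ?_
    rw [mul_comm (4 * ε), Real.exp_nat_mul]
    refine pow_le_pow_left₀ (by positivity) ?_ T
    linarith [Real.add_one_le_exp (4 * ε)]
  have hint : ∀ S, Integrable (fun h => Real.exp (riseCount F r B K S (instances h)))
      (play (L T) A T) := fun S => integrable_of_bound (Real.measurable_exp.comp
        ((measurable_riseCount hlt hBm K S T).comp measurable_instances)) (C := Real.exp T)
        fun h => by
          rw [abs_of_pos (Real.exp_pos _)]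
          exact Real.exp_le_exp.2 (riseCount_le F r B K S _)
  -- Since `u ≤ a + exp (u - a)`, summing the exponentials dominates the rises of whichever expert
  -- follows the comparator of the given history.
  set G : Hist X T → ℝ := fun h => c h + (a + ∑ S ∈ experts T,
    Real.exp (-a) * Real.exp (riseCount F r B K S (instances h))) with hG
  have hsum : Integrable (fun h => ∑ S ∈ experts T,
      Real.exp (-a) * Real.exp (riseCount F r B K S (instances h))) (play (L T) A T) :=
    integrable_finsetSum _ fun S _ => (hint S).const_mul _
  have hGi : Integrable G (play (L T) A T) := hc.add ((integrable_const a).add hsum)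
  have hGS : ∀ᵐ h ∂(play (L T) A T), ∃ S ∈ experts T, expertLoss F r S (sample h) ≤ G h := by
    refine Eventually.of_forall fun h => ?_
    obtain ⟨f, hf, hfB, hfc⟩ := hcf h
    obtain ⟨S, hS⟩ := exists_follows hVC hr hf (by rwa [hB0]) hK hBK (sample h)
    have hSe := mem_experts_of_card_le hS.subset hS.card_le hKT
    refine ⟨S, hSe, hS.loss_le.trans (add_le_add hfc ?_)⟩
    have h1 : riseCount F r B K S (fun s => (sample h s).1) - a ≤
        Real.exp (-a) * Real.exp (riseCount F r B K S (instances h)) := by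
      rw [← Real.exp_add]
      refine le_trans ?_ (Real.add_one_le_exp _)
      have : riseCount F r B K S (fun s => (sample h s).1) =
        riseCount F r B K S (instances h) := rfl
      linarith
    have h2 := Finset.single_le_sum (f := fun S =>
      Real.exp (-a) * Real.exp (riseCount F r B K S (instances h))) (fun _ _ => by positivity) hSe
    linarith
  have hmain := integral_mistakes_hedge_le hL hrm hle A hrate hGi hGS
  have hGle : ∫ h, G h ∂(play (L T) A T) ≤ ∫ h, c h ∂(play (L T) A T) + (a + 1) := by
    have h1 : Integrable (fun h => a + ∑ S ∈ experts T,
        Real.exp (-a) * Real.exp (riseCount F r B K S (instances h))) (play (L T) A T) :=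
      (integrable_const a).add hsum
    simp only [hG]
    rw [integral_add hc h1, integral_add (integrable_const a) hsum,
      integral_finsetSum _ fun S _ => (hint S).const_mul _]
    simp only [integral_const, probReal_univ, smul_eq_mul, one_mul, integral_const_mul]
    gcongr
    calc ∑ S ∈ experts T, Real.exp (-a) *
          ∫ h, Real.exp (riseCount F r B K S (instances h)) ∂(play (L T) A T)
        ≤ ∑ S ∈ experts T, Real.exp (-a) * Real.exp (4 * ε * T) :=
          Finset.sum_le_sum fun S _ => mul_le_mul_of_nonneg_left (hexp S) (Real.exp_pos _).le
      _ = (experts T).card * Real.exp (-Real.log (experts T).card) := by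
          rw [Finset.sum_const, nsmul_eq_mul, ← Real.exp_add, ha]
          congr 2
          ring
      _ = 1 := by
          have : (0 : ℝ) < (experts T).card := by
            exact_mod_cast Finset.card_pos.2 ⟨∅, empty_mem_experts T⟩
          rw [Real.exp_neg, Real.exp_log this, mul_inv_cancel₀ this.ne']
  linarith

end Upper

/-! ### Adaptive adversaries with a memory -/

section Machine

variable {X Q : Type*}

/-- The history and the state of an adversary with a memory, reconstructed from the instances and
the predictions. -/
def replay (q₀ : Q) (label : ∀ t : ℕ, Hist X t → Q → X → Bool) (next : ℕ → Q → X → Bool → Q) :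
    ∀ t : ℕ, (Fin t → X × Bool) → Hist X t × Q
  | 0, _ => (Fin.elim0, q₀)
  | t + 1, p =>
    let s := replay q₀ label next t (Fin.init p)
    let x := (p (Fin.last t)).1
    let y := label t s.1 s.2 x
    (Fin.snoc (α := fun _ => Round X) s.1 (x, y, (p (Fin.last t)).2), next t s.2 x y)

theorem replay_snoc (q₀ : Q) (label : ∀ t : ℕ, Hist X t → Q → X → Bool)
    (next : ℕ → Q → X → Bool → Q) (t : ℕ) (p : Fin t → X × Bool) (x : X) (b : Bool) :
    replay q₀ label next (t + 1) (Fin.snoc (α := fun _ => X × Bool) p (x, b)) =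
      (Fin.snoc (α := fun _ => Round X) (replay q₀ label next t p).1
        (x, label t (replay q₀ label next t p).1 (replay q₀ label next t p).2 x, b),
        next t (replay q₀ label next t p).2 x
          (label t (replay q₀ label next t p).1 (replay q₀ label next t p).2 x)) := by
  simp [replay]

variable [MeasurableSpace X] [MeasurableSpace Q]
  {q₀ : Q} {label : ∀ t : ℕ, Hist X t → Q → X → Bool} {next : ℕ → Q → X → Bool → Q}

theorem measurable_replay
    (hlabel : ∀ t, Measurable fun p : (Hist X t × Q) × X => label t p.1.1 p.1.2 p.2)
    (hnext : ∀ t, Measurable fun p : Q × X × Bool => next t p.1 p.2.1 p.2.2) (t : ℕ) :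
    Measurable (replay q₀ label next t) := by
  induction t with
  | zero => exact measurable_const
  | succ t ih =>
    have h1 : Measurable fun p : Fin (t + 1) → X × Bool =>
        replay q₀ label next t (Fin.init p) := by
      refine ih.comp ?_
      unfold Fin.init
      fun_prop
    have h2 : Measurable fun p : Fin (t + 1) → X × Bool => (p (Fin.last t)).1 := by fun_prop
    have h3 : Measurable fun p : Fin (t + 1) → X × Bool => (p (Fin.last t)).2 := by fun_prop
    have h4 := (hlabel t).comp (h1.prodMk h2)
    exact (measurable_snoc.comp ((measurable_fst.comp h1).prodMk (h2.prodMk (h4.prodMk h3)))).prodMk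
      ((hnext t).comp ((measurable_snd.comp h1).prodMk (h2.prodMk h4)))

/-- The adversary with a given memory. -/
noncomputable def machine {U : Set (ProbabilityMeasure X)} (q₀ : Q)
    (dist : ℕ → Q → ProbabilityMeasure X)
    (label : ∀ t : ℕ, Hist X t → Q → X → Bool) (next : ℕ → Q → X → Bool → Q)
    (hU : ∀ t p, dist t (replay q₀ label next t p).2 ∈ U) (hdist : ∀ t, Measurable (dist t))
    (hlabel : ∀ t, Measurable fun p : (Hist X t × Q) × X => label t p.1.1 p.1.2 p.2)
    (hnext : ∀ t, Measurable fun p : Q × X × Bool => next t p.1 p.2.1 p.2.2) :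
    AdaptiveAdversary U where
  dist t p := dist t (replay q₀ label next t p).2
  dist_mem := hU
  measurable_dist t := measurable_subtype_coe.comp
    ((hdist t).comp (measurable_snd.comp (measurable_replay hlabel hnext t)))
  label t p x := label t (replay q₀ label next t p).1 (replay q₀ label next t p).2 x
  measurable_label t := (hlabel t).comp
    (((measurable_replay hlabel hnext t).comp measurable_fst).prodMk measurable_snd)

/-- The adversary sees instances and predictions only, while the learner's kernel also reads the
labels. The labels are the adversary's own, so almost surely it knows the full history and can
evaluate the learner's probabilities. -/
theorem ae_replay_played [StandardBorelSpace X] {U : Set (ProbabilityMeasure X)}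
    {dist : ℕ → Q → ProbabilityMeasure X}
    (hU : ∀ t p, dist t (replay q₀ label next t p).2 ∈ U) (hdist : ∀ t, Measurable (dist t))
    (hlabel : ∀ t, Measurable fun p : (Hist X t × Q) × X => label t p.1.1 p.1.2 p.2)
    (hnext : ∀ t, Measurable fun p : Q × X × Bool => next t p.1 p.2.1 p.2.2) (L : Learner X)
    (t : ℕ) : ∀ᵐ h ∂(play L (machine q₀ dist label next hU hdist hlabel hnext) t),
      (replay q₀ label next t (played h)).1 = h := by
  induction t with
  | zero => exact Eventually.of_forall fun h => Subsingleton.elim _ _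
  | succ t ih =>
    refine ae_play_succ L _ t (measurableSet_eq_fun
      (measurable_fst.comp ((measurable_replay hlabel hnext (t + 1)).comp measurable_played))
      measurable_id) ?_
    filter_upwards [ih] with h hh
    refine Eventually.of_forall fun x b => ?_
    rw [played_extend, replay_snoc]
    simp only [AdaptiveAdversary.extend, machine, hh]

end Machine

/-! ### The lower bound for adaptive adversaries -/

section AdaptiveLower

variable {X : Type*}

/-- Climb `i` steps of a ladder from the point `v` of level `j`. -/
def climb (n : ℕ → X → X) : ℕ → ℕ → X → X
  | 0, _, v => v
  | i + 1, j, v => climb n i (j - 1) (n (j - 1) v)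

/-- The length of a path on which a binary search can run for `k` more rounds. -/
def searchLength : ℕ → ℕ
  | 0 => 1
  | k + 1 => 2 * searchLength k + 1

theorem one_le_searchLength (k : ℕ) : 1 ≤ searchLength k := by
  cases k <;> simp [searchLength]

theorem climb_add (n : ℕ → X → X) (i i' j : ℕ) (v : X) :
    climb n (i + i') j v = climb n i' (j - i) (climb n i j v) := by
  induction i generalizing j v with
  | zero => simp [climb]
  | succ i ih =>
    rw [Nat.add_right_comm, climb, ih, climb]
    congr 1
    omega

/-- The definition of `climb` peels off the first step; this is the form with the last step, taken
into level `j - i - 1`. -/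
theorem climb_succ (n : ℕ → X → X) (i j : ℕ) (v : X) :
    climb n (i + 1) j v = n (j - i - 1) (climb n i j v) := by
  rw [climb_add]
  rfl

variable {F : Set (X → Bool)} {r : X → Bool} {B : ℕ → Set X} {K : ℕ} {n : ℕ → X → X}

theorem climb_mem (hn : ∀ j < K, ∀ v ∈ B (j + 1), n j v ∈ B j ∧ TreeLT F r v (n j v)) {i j : ℕ}
    (hij : i ≤ j) (hj : j ≤ K) {v : X} (hv : v ∈ B j) : climb n i j v ∈ B (j - i) := by
  induction i generalizing j v with
  | zero => simpa [climb]
  | succ i ih =>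
    obtain ⟨j, rfl⟩ : ∃ j', j = j' + 1 := ⟨j - 1, by omega⟩
    rw [climb]
    have := ih (j := j) (v := n j v) (by omega) (by omega) (hn j (by omega) v hv).1
    simpa using this

theorem treeLE_climb (hn : ∀ j < K, ∀ v ∈ B (j + 1), n j v ∈ B j ∧ TreeLT F r v (n j v)) {i j : ℕ}
    (hij : i ≤ j) (hj : j ≤ K) {v : X} (hv : v ∈ B j) : TreeLE F r v (climb n i j v) := by
  induction i generalizing j v with
  | zero => exact TreeLE.refl F r v
  | succ i ih =>
    obtain ⟨j, rfl⟩ : ∃ j', j = j' + 1 := ⟨j - 1, by omega⟩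
    obtain ⟨h1, h2⟩ := hn j (by omega) v hv
    exact h2.1.trans (ih (j := j) (v := n j v) (by omega) (by omega) h1)

theorem not_climb_treeLE (hn : ∀ j < K, ∀ v ∈ B (j + 1), n j v ∈ B j ∧ TreeLT F r v (n j v))
    {i j : ℕ} (hi : 1 ≤ i) (hij : i ≤ j) (hj : j ≤ K) {v : X} (hv : v ∈ B j) :
    ¬ TreeLE F r (climb n i j v) v := by
  obtain ⟨i, rfl⟩ : ∃ i', i = i' + 1 := ⟨i - 1, by omega⟩
  obtain ⟨j, rfl⟩ : ∃ j', j = j' + 1 := ⟨j - 1, by omega⟩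
  obtain ⟨h1, h2⟩ := hn j (by omega) v hv
  intro h
  exact h2.2 ((treeLE_climb hn (i := i) (j := j) (by omega) (by omega) h1).trans h)

/-- The members of the class that a binary search with `k` rounds left, from the point `q.2` of level
`q.1`, can still select. -/
def window (F : Set (X → Bool)) (r : X → Bool) (n : ℕ → X → X) (k : ℕ) (q : ℕ × X) :
    Set (X → Bool) :=
  {f | f ∈ F ∧ f q.2 ≠ r q.2 ∧
    f (climb n (searchLength k) q.1 q.2) = r (climb n (searchLength k) q.1 q.2)}

/-- The state `q` allows a binary search with `k` rounds. -/
def IsValid (B : ℕ → Set X) (K k : ℕ) (q : ℕ × X) : Prop :=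
  q.1 ≤ K ∧ searchLength k ≤ q.1 ∧ q.2 ∈ B q.1

/-- The middle of the path. -/
def middle (n : ℕ → X → X) (k : ℕ) (q : ℕ × X) : X := climb n (searchLength k) q.1 q.2

/-- The level of the point above the middle of the path. -/
def midLevel (k : ℕ) (q : ℕ × X) : ℕ := q.1 - searchLength k - 1

/-- The point above the middle of the path. -/
def aboveMiddle (n : ℕ → X → X) (k : ℕ) (q : ℕ × X) : X := n (midLevel k q) (middle n k q)

/-- The instances whose label is free. -/
def freeSet (F : Set (X → Bool)) (r : X → Bool) (B : ℕ → Set X) (n : ℕ → X → X) (k : ℕ)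
    (q : ℕ × X) : Set X :=
  goodSet F r (B (midLevel k q)) (middle n k q) (aboveMiddle n k q)

open Classical in
/-- The state after an instance `x` with label `y`. -/
noncomputable def searchNext (F : Set (X → Bool)) (r : X → Bool) (B : ℕ → Set X) (n : ℕ → X → X)
    (k : ℕ) (q : ℕ × X) (x : X) (y : Bool) : ℕ × X :=
  if TreeLE F r (middle n k q) x ∧ y = r x then q
  else if x ∈ freeSet F r B n k q ∧ ¬ TreeLE F r x (aboveMiddle n k q) then (midLevel k q, x)
  else (midLevel k q, aboveMiddle n k q)

open Classical in
/-- The label of the instance `x`, which is the bit `b` if the label is free. -/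
noncomputable def searchLabel (F : Set (X → Bool)) (r : X → Bool) (B : ℕ → Set X) (n : ℕ → X → X)
    (k : ℕ) (q : ℕ × X) (b : Bool) (x : X) : Bool :=
  if x ∈ freeSet F r B n k q then b
  else if TreeLE F r (middle n k q) x then r x
  else if TreeLE F r x (middle n k q) then !(r x) else r x

theorem middle_mem (hn : ∀ j < K, ∀ v ∈ B (j + 1), n j v ∈ B j ∧ TreeLT F r v (n j v)) {k : ℕ}
    {q : ℕ × X} (hq : IsValid B K (k + 1) q) : middle n k q ∈ B (midLevel k q + 1) := by
  obtain ⟨h1, h2, h3⟩ := hq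
  simp only [searchLength] at h2
  have := climb_mem hn (i := searchLength k) (by omega) h1 h3
  rwa [show midLevel k q + 1 = q.1 - searchLength k by unfold midLevel; omega]

theorem midLevel_lt {k : ℕ} {q : ℕ × X} (hq : IsValid B K (k + 1) q) : midLevel k q < K := by
  obtain ⟨h1, h2, h3⟩ := hq
  simp only [searchLength] at h2
  unfold midLevel
  omega

/-- A path of length `2 * l + 1` consists of `l` steps below the middle, the step used by the
current round, and `l` steps above it; each outcome keeps `l` steps. A free instance not below the
point above the middle lies in the ladder by definition of `goodSet`, so the search may restart
there. -/
theorem IsValid.searchNext (hn : ∀ j < K, ∀ v ∈ B (j + 1), n j v ∈ B j ∧ TreeLT F r v (n j v))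
    {k : ℕ} {q : ℕ × X} (hq : IsValid B K (k + 1) q) (x : X) (y : Bool) :
    IsValid B K k (searchNext F r B n k q x y) := by
  have hmid := hn _ (midLevel_lt hq) _ (middle_mem hn hq)
  have hlt := midLevel_lt hq
  obtain ⟨h1, h2, h3⟩ := hq
  simp only [searchLength] at h2
  have hl : searchLength k ≤ midLevel k q := by unfold midLevel; omega
  unfold DistOnline.searchNext
  split_ifs with ha hb
  · exact ⟨h1, by omega, h3⟩
  · refine ⟨hlt.le, hl, ?_⟩
    exact (hb.1.2.resolve_left hb.2).1
  · exact ⟨hlt.le, hl, hmid.1⟩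

/-- The functions that can still be selected after a round are consistent with its label. -/
theorem of_mem_window_searchNext (hVC : vcDim F = 1) (hr : r ∈ F)
    (hn : ∀ j < K, ∀ v ∈ B (j + 1), n j v ∈ B j ∧ TreeLT F r v (n j v))
    {k : ℕ} {q : ℕ × X} (hq : IsValid B K (k + 1) q) (b : Bool) (x : X) {f : X → Bool}
    (hf : f ∈ window F r n k (searchNext F r B n k q x (searchLabel F r B n k q b x))) :
    f ∈ window F r n (k + 1) q ∧ f x = searchLabel F r B n k q b x := by
  obtain ⟨hwB, hmw⟩ := hn _ (midLevel_lt hq) _ (middle_mem hn hq)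
  have hlt := midLevel_lt hq
  obtain ⟨h1, h2, h3⟩ := hq
  simp only [searchLength] at h2
  have hl : searchLength k ≤ midLevel k q := by unfold midLevel; omega
  have hend : climb n (searchLength (k + 1)) q.1 q.2 =
      climb n (searchLength k) (midLevel k q) (aboveMiddle n k q) := by
    rw [show searchLength (k + 1) = (searchLength k + 1) + searchLength k by
      simp only [searchLength]; omega, climb_add, climb_succ]
    rfl
  have hwe : TreeLE F r (aboveMiddle n k q) (climb n (searchLength (k + 1)) q.1 q.2) := by
    rw [hend]
    exact treeLE_climb hn hl hlt.le hwB
  have hvm : TreeLE F r q.2 (middle n k q) := treeLE_climb hn (by omega) h1 h3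
  have hmw' : TreeLE F r (middle n k q) (aboveMiddle n k q) := hmw.1
  set y := searchLabel F r B n k q b x with hy
  unfold searchNext at hf
  split_ifs at hf with ha hb
  · obtain ⟨hfF, hfv, hfe⟩ := hf
    have hfm : f (middle n k q) = r (middle n k q) := hfe
    refine ⟨⟨hfF, hfv, ?_⟩, ?_⟩
    · by_contra h
      exact (hmw'.trans hwe) f hfF h hfm
    · rw [ha.2]
      by_contra h
      exact ha.1 f hfF h hfm
  · obtain ⟨hfF, hfx, -⟩ := hf
    simp only at hfx
    have hmx : TreeLE F r (middle n k q) x := hb.1.1.1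
    have hyx : y ≠ r x := fun h => ha ⟨hmx, h⟩
    refine ⟨⟨hfF, hvm f hfF (hmx f hfF hfx), ?_⟩, Bool.eq_of_ne_of_ne hfx hyx⟩
    by_contra h
    -- Otherwise `f` would differ from `r` both at `x` and above the middle, and these two points
    -- are incomparable.
    have hfw := hwe f hfF h
    rcases treeLE_total hVC hr hfF hfx hfw with h' | h'
    · exact hb.2 h'
    · exact (hb.1.2.resolve_left hb.2).2 h'
  · obtain ⟨hfF, hfw, hfe⟩ := hf
    simp only at hfw hfe
    have hfm := hmw' f hfF hfw
    refine ⟨⟨hfF, hvm f hfF hfm, by rw [hend]; exact hfe⟩, ?_⟩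
    -- Moving to the point above the middle covers free instances below that point with label `!r
    -- x`, and instances not above the middle, where all remaining functions already agree.
    by_cases hmx : TreeLE F r (middle n k q) x
    · have hyx : y ≠ r x := fun h => ha ⟨hmx, h⟩
      have hfree : x ∈ freeSet F r B n k q := by
        by_contra h
        exact hyx (by rw [hy, searchLabel, if_neg h, if_pos hmx])
      have hxw : TreeLE F r x (aboveMiddle n k q) := by
        by_contra h
        exact hb ⟨hfree, h⟩
      exact Bool.eq_of_ne_of_ne (hxw f hfF hfw) hyx
    · have hfree : x ∉ freeSet F r B n k q := fun h => hmx h.1.1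
      rw [hy, searchLabel, if_neg hfree, if_neg hmx]
      split_ifs with hxm
      · simpa [Bool.eq_not] using hxm f hfF hfm
      · by_contra h
        exact (treeLE_total hVC hr hfF h hfm).elim hxm hmx

/-- Even a search with no rounds left keeps one strict step, because `searchLength 0 = 1`; a
function separating its endpoints exists. This yields realizability. -/
theorem window_nonempty (hn : ∀ j < K, ∀ v ∈ B (j + 1), n j v ∈ B j ∧ TreeLT F r v (n j v)) {k : ℕ}
    {q : ℕ × X} (hq : IsValid B K k q) : (window F r n k q).Nonempty := by
  obtain ⟨h1, h2, h3⟩ := hq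
  obtain ⟨f, hf, hfv, hfe⟩ := exists_of_not_treeLE
    (not_climb_treeLE hn (one_le_searchLength k) h2 h1 h3)
  exact ⟨f, hf, hfv, hfe⟩

end AdaptiveLower

section AdaptiveLower

variable {X : Type*} [MeasurableSpace X] {F : Set (X → Bool)} {r : X → Bool} {B : ℕ → Set X} {K : ℕ}
  {n : ℕ → X → X} {U : Set (ProbabilityMeasure X)} {ε : ℝ}

theorem measurable_level {Y : Type*} [MeasurableSpace Y] {n : ℕ → X → Y}
    (hn : ∀ j, Measurable (n j)) : Measurable fun q : ℕ × X => n q.1 q.2 :=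
  measurable_from_prod_countable_right hn

theorem measurable_climb (hn : ∀ j, Measurable (n j)) (i : ℕ) :
    Measurable fun q : ℕ × X => climb n i q.1 q.2 := by
  induction i with
  | zero => exact measurable_snd
  | succ i ih =>
    have h1 : Measurable fun q : ℕ × X => (q.1 - 1, q.2) :=
      ((measurable_of_countable fun j : ℕ => j - 1).comp measurable_fst).prodMk measurable_snd
    exact ih.comp ((measurable_fst.comp h1).prodMk ((measurable_level hn).comp h1))

theorem measurable_middle (hn : ∀ j, Measurable (n j)) (k : ℕ) : Measurable (middle n k) :=
  measurable_climb hn _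

theorem measurable_midLevel (k : ℕ) : Measurable (midLevel k : ℕ × X → ℕ) :=
  (measurable_of_countable fun j : ℕ => j - searchLength k - 1).comp measurable_fst

theorem measurable_aboveMiddle (hn : ∀ j, Measurable (n j)) (k : ℕ) :
    Measurable (aboveMiddle n k) :=
  (measurable_level hn).comp ((measurable_midLevel k).prodMk (measurable_middle hn k))

theorem measurableSet_freeSet (hlt : MeasurableSet {p : X × X | TreeLT F r p.1 p.2})
    (hle : MeasurableSet {p : X × X | TreeLE F r p.1 p.2}) (hB : ∀ j, MeasurableSet (B j))
    (hn : ∀ j, Measurable (n j)) (k : ℕ) :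
    MeasurableSet {p : (ℕ × X) × X | p.2 ∈ freeSet F r B n k p.1} := by
  have hm : Measurable fun p : (ℕ × X) × X => middle n k p.1 :=
    (measurable_middle hn k).comp measurable_fst
  have ha : Measurable fun p : (ℕ × X) × X => aboveMiddle n k p.1 :=
    (measurable_aboveMiddle hn k).comp measurable_fst
  have hBB : MeasurableSet {p : ℕ × X | p.2 ∈ B p.1} := by
    have : {p : ℕ × X | p.2 ∈ B p.1} = ⋃ j, {j} ×ˢ B j := by
      ext ⟨j, x⟩
      simp
    rw [this]
    exact MeasurableSet.iUnion fun j => (measurableSet_singleton j).prod (hB j)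
  have hBm : MeasurableSet {p : (ℕ × X) × X | p.2 ∈ B (midLevel k p.1)} :=
    (((measurable_midLevel k).comp measurable_fst).prodMk measurable_snd) hBB
  exact ((hm.prodMk measurable_snd) hlt).inter (((measurable_snd.prodMk ha) hle).union
    (hBm.inter ((ha.prodMk measurable_snd) hle).compl))

theorem measurable_searchNext (hlt : MeasurableSet {p : X × X | TreeLT F r p.1 p.2})
    (hle : MeasurableSet {p : X × X | TreeLE F r p.1 p.2}) (hrm : Measurable r)
    (hB : ∀ j, MeasurableSet (B j)) (hn : ∀ j, Measurable (n j)) (k : ℕ) :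
    Measurable fun p : (ℕ × X) × X × Bool => searchNext F r B n k p.1 p.2.1 p.2.2 := by
  have hx : Measurable fun p : (ℕ × X) × X × Bool => p.2.1 := by fun_prop
  have hy : Measurable fun p : (ℕ × X) × X × Bool => p.2.2 := by fun_prop
  have hm : Measurable fun p : (ℕ × X) × X × Bool => middle n k p.1 :=
    (measurable_middle hn k).comp measurable_fst
  have ha : Measurable fun p : (ℕ × X) × X × Bool => aboveMiddle n k p.1 :=
    (measurable_aboveMiddle hn k).comp measurable_fst
  have hl : Measurable fun p : (ℕ × X) × X × Bool => (midLevel k p.1 : ℕ) :=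
    (measurable_midLevel k).comp measurable_fst
  unfold searchNext
  refine Measurable.ite ?_ measurable_fst (Measurable.ite ?_ (hl.prodMk hx) (hl.prodMk ha))
  · exact ((hm.prodMk hx) hle).inter (measurableSet_eq_fun hy (hrm.comp hx))
  · exact ((measurable_fst.prodMk hx) (measurableSet_freeSet hlt hle hB hn k)).inter
      ((hx.prodMk ha) hle).compl

theorem measurable_searchLabel {Y : Type*} [MeasurableSpace Y]
    (hlt : MeasurableSet {p : X × X | TreeLT F r p.1 p.2})
    (hle : MeasurableSet {p : X × X | TreeLE F r p.1 p.2}) (hrm : Measurable r)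
    (hB : ∀ j, MeasurableSet (B j)) (hn : ∀ j, Measurable (n j)) (k : ℕ) {b : Y → Bool}
    (hb : Measurable b) {q : Y → ℕ × X} (hq : Measurable q) {x : Y → X} (hx : Measurable x) :
    Measurable fun p => searchLabel F r B n k (q p) (b p) (x p) := by
  have hm := (measurable_middle hn k).comp hq
  have hr' := hrm.comp hx
  unfold searchLabel
  refine Measurable.ite ?_ hb (Measurable.ite ?_ hr' (Measurable.ite ?_
    ((measurable_of_countable not).comp hr') hr'))
  · exact (hq.prodMk hx) (measurableSet_freeSet hlt hle hB hn k)
  · exact (hm.prodMk hx) hle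
  · exact (hx.prodMk hm) hle

/-- The steps are chosen for all `j` at once; from `K` on they repeat the data of step `0` as a
default, hence the need for `0 < K`. -/
theorem Extends.of_lt {B : ℕ → Set X} (hK : 0 < K)
    (h : ∀ j < K, Extends F r U ε (B j) (B (j + 1))) :
    ∃ n : ℕ → X → X, (∀ j, Measurable (n j)) ∧ ∃ ν : ℕ → X → ProbabilityMeasure X,
      (∀ j, Measurable (ν j)) ∧ ∀ j < K, ∀ v ∈ B (j + 1), ν j v ∈ U ∧ n j v ∈ B j ∧
        TreeLT F r v (n j v) ∧
        ε ≤ (ν j v : Measure X).real (goodSet F r (B j) v (n j v)) := by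
  have h' : ∀ j, ∃ n : X → X, Measurable n ∧ ∃ ν : X → ProbabilityMeasure X, Measurable ν ∧
      (j < K → ∀ v ∈ B (j + 1), ν v ∈ U ∧ n v ∈ B j ∧ TreeLT F r v (n v) ∧
        ε ≤ (ν v : Measure X).real (goodSet F r (B j) v (n v))) := by
    intro j
    by_cases hj : j < K
    · obtain ⟨n, hn, ν, hν, H⟩ := h j hj
      exact ⟨n, hn, ν, hν, fun _ => H⟩
    · obtain ⟨n, hn, ν, hν, -⟩ := h 0 hK
      exact ⟨n, hn, ν, hν, fun h => absurd h hj⟩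
  choose n hn ν hν H using h'
  exact ⟨n, hn, ν, hν, H⟩

/-- A long ladder forces many mistakes, even in the realizable case. -/
theorem exists_adaptiveAdversary [StandardBorelSpace X] (hF : ∀ f ∈ F, Measurable f)
    (hbest : ∀ T : ℕ, Measurable fun D : Fin T → X × Bool => bestLoss F D) (hVC : vcDim F = 1)
    (hr : r ∈ F) {B₀ : Set X} {N : ℕ} (hlad : HasLadder F r U ε B₀ (searchLength N))
    (L : Learner X) : ∃ A : AdaptiveAdversary U,
      (∀ᵐ h ∂(play L A N), bestLoss F (sample h) = 0) ∧
      N * (ε / 2) ≤ ∫ h, mistakes h ∂(play L A N) := by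
  have hle := measurableSet_treeLE hF hr hbest
  have hlt := measurableSet_treeLT hF hr hbest
  have hrm := hF r hr
  obtain ⟨B, -, hB, hext, v₀, hv₀⟩ := hlad
  obtain ⟨n, hnm, ν, hνm, H⟩ := Extends.of_lt (one_le_searchLength N) hext
  set K := searchLength N with hK
  have hn : ∀ j < K, ∀ v ∈ B (j + 1), n j v ∈ B j ∧ TreeLT F r v (n j v) := fun j hj v hv =>
    ⟨(H j hj v hv).2.1, (H j hj v hv).2.2.1⟩
  obtain ⟨μ₀, hμ₀⟩ : ∃ μ, μ ∈ U := by
    have h1 := one_le_searchLength N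
    refine ⟨_, (H (K - 1) (by omega) v₀ ?_).1⟩
    rwa [Nat.sub_add_cancel h1]
  -- Before round `t` the state is valid for `N - t = (N - 1 - t) + 1` rounds, so its middle is
  -- computed with `N - 1 - t`. The value `μ₀` only fills the rounds after the horizon.
  set dist : ℕ → ℕ × X → ProbabilityMeasure X := fun t q =>
    if t < N then ν (midLevel (N - 1 - t) q) (middle n (N - 1 - t) q) else μ₀ with hdist
  -- The free bit is the value that the learner predicts with probability at most one half, so a
  -- free instance costs at least `1 / 2`.
  set label : ∀ t : ℕ, Hist X t → ℕ × X → X → Bool := fun t h q x =>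
    searchLabel F r B n (N - 1 - t) q (decide ((L.predict t (h, x)).real {true} ≤ 1 / 2)) x
    with hlabel
  set next : ℕ → ℕ × X → X → Bool → ℕ × X := fun t => searchNext F r B n (N - 1 - t) with hnext
  have hvalid : ∀ t ≤ N, ∀ p, IsValid B K (N - t) (replay (K, v₀) label next t p).2 := by
    intro t
    induction t with
    | zero => exact fun _ _ => ⟨le_rfl, le_rfl, hv₀⟩
    | succ t ih =>
      intro ht p
      obtain ⟨p, ⟨x, b⟩, rfl⟩ : ∃ p' q, p = Fin.snoc (α := fun _ => X × Bool) p' q :=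
        ⟨Fin.init p, p (Fin.last t), (Fin.snoc_init_self p).symm⟩
      rw [replay_snoc]
      have h1 := ih (by omega) p
      rw [show N - t = N - 1 - t + 1 by omega] at h1
      rw [show N - (t + 1) = N - 1 - t by omega]
      exact h1.searchNext hn x _
  -- Windows are nested, so a function that survives to the end fits every label given so far.
  have hwindow : ∀ t ≤ N, ∀ p, ∀ f ∈ window F r n (N - t) (replay (K, v₀) label next t p).2,
      f ∈ F ∧ ∀ s, f ((replay (K, v₀) label next t p).1 s).1 =
        ((replay (K, v₀) label next t p).1 s).2.1 := by
    intro t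
    induction t with
    | zero => exact fun _ _ f hf => ⟨hf.1, fun s => s.elim0⟩
    | succ t ih =>
      intro ht p f hf
      obtain ⟨p, ⟨x, b⟩, rfl⟩ : ∃ p' q, p = Fin.snoc (α := fun _ => X × Bool) p' q :=
        ⟨Fin.init p, p (Fin.last t), (Fin.snoc_init_self p).symm⟩
      have h1 := hvalid t (by omega) p
      rw [show N - t = N - 1 - t + 1 by omega] at h1
      rw [replay_snoc, show N - (t + 1) = N - 1 - t by omega] at hf
      obtain ⟨h2, h3⟩ := of_mem_window_searchNext hVC hr hn h1 _ x hf
      rw [show N - 1 - t + 1 = N - t by omega] at h2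
      obtain ⟨h4, h5⟩ := ih (by omega) p f h2
      refine ⟨h4, fun s => ?_⟩
      rw [replay_snoc]
      refine Fin.lastCases ?_ (fun s => ?_) s
      · simp only [Fin.snoc_last]
        exact h3
      · simpa using h5 s
  have hU : ∀ t p, dist t (replay (K, v₀) label next t p).2 ∈ U := by
    intro t p
    simp only [hdist]
    split_ifs with ht
    · have h1 := hvalid t ht.le p
      rw [show N - t = N - 1 - t + 1 by omega] at h1
      exact (H _ (midLevel_lt h1) _ (middle_mem hn h1)).1
    · exact hμ₀
  have hdm : ∀ t, Measurable (dist t) := by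
    intro t
    by_cases ht : t < N
    · simp only [hdist, if_pos ht]
      exact (measurable_level hνm).comp
        ((measurable_midLevel (N - 1 - t)).prodMk (measurable_middle hnm (N - 1 - t)))
    · simp only [hdist, if_neg ht]
      exact measurable_const
  have hlm : ∀ t, Measurable fun p : (Hist X t × (ℕ × X)) × X => label t p.1.1 p.1.2 p.2 := by
    intro t
    have h1 : Measurable fun p : (Hist X t × (ℕ × X)) × X => (p.1.1, p.2) := by fun_prop
    have h2 : Measurable fun p : Hist X t × X => (L.predict t p).real {true} :=
      ((L.predict t).measurable_coe (MeasurableSet.singleton true)).ennreal_toReal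
    have h3 : MeasurableSet {p : (Hist X t × (ℕ × X)) × X |
        (L.predict t (p.1.1, p.2)).real {true} ≤ 1 / 2} :=
      measurableSet_le (h2.comp h1) measurable_const
    refine measurable_searchLabel hlt hle hrm hB hnm _ ?_ (by fun_prop) (by fun_prop)
    refine measurable_to_bool ?_
    convert h3 using 1
    ext p
    simp
  have hnm' : ∀ t, Measurable fun p : (ℕ × X) × X × Bool => next t p.1 p.2.1 p.2.2 := fun t =>
    measurable_searchNext hlt hle hrm hB hnm _
  set A : AdaptiveAdversary U := machine (K, v₀) dist label next hU hdm hlm hnm' with hA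
  have hreplay : ∀ t, ∀ᵐ h ∂(play L A t), (replay (K, v₀) label next t (played h)).1 = h :=
    ae_replay_played hU hdm hlm hnm' L
  refine ⟨A, ?_, ?_⟩
  · filter_upwards [hreplay N] with h hh
    have h1 := hvalid N le_rfl (played h)
    obtain ⟨f, hf⟩ := window_nonempty hn h1
    obtain ⟨hfF, h2⟩ := hwindow N le_rfl (played h) f hf
    rw [hh] at h2
    exact (bestLoss_eq_zero_iff ⟨r, hr⟩).2 ⟨f, hfF, h2⟩
  · have hind : ∀ t ≤ N, t * (ε / 2) ≤ ∫ h, mistakes h ∂(play L A t) := by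
      intro t
      induction t with
      | zero => exact fun _ => by simp [mistakes]
      | succ t ih =>
        intro ht
        rw [integral_mistakes_succ]
        have hq := measurable_mistakeProb L A t
        have hq1 : ∀ (h : Hist X t) (x : X),
            |(L.predict t (h, x)).real {!(A.label t (played h) x)}| ≤ 1 := fun h x => by
          rw [abs_of_nonneg measureReal_nonneg]
          exact measureReal_le_one
        have hstep : ε / 2 ≤ ∫ h, ∫ x, (L.predict t (h, x)).real {!(A.label t (played h) x)}
            ∂(A.dist t (played h) : Measure X) ∂(play L A t) := by
          have hc : ∫ _h, ε / 2 ∂(play L A t) = ε / 2 := by simp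
          rw [← hc]
          refine integral_mono_ae (integrable_const _) (integrable_of_bound (C := 1)
            (measurable_integral_dist A t hq) fun h => abs_integral_le_of_bound (hq1 h)) ?_
          filter_upwards [hreplay t] with h hh
          have h1 := hvalid t (by omega) (played h)
          set q := (replay (K, v₀) label next t (played h)).2 with hqdef
          rw [show N - t = N - 1 - t + 1 by omega] at h1
          have h2 := (H _ (midLevel_lt h1) _ (middle_mem hn h1)).2.2.2
          have hd : A.dist t (played h) = ν (midLevel (N - 1 - t) q) (middle n (N - 1 - t) q) := by
            simp only [hA, machine, hdist]
            rw [if_pos (by omega)]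
          have h3 : ε ≤ (A.dist t (played h) : Measure X).real (freeSet F r B n (N - 1 - t) q) := by
            rw [hd]
            exact h2
          have hfm : MeasurableSet (freeSet F r B n (N - 1 - t) q) :=
            measurable_prodMk_left (measurableSet_freeSet hlt hle hB hnm (N - 1 - t))
          have hqm : Measurable fun x => (L.predict t (h, x)).real {!(A.label t (played h) x)} :=
            hq.comp measurable_prodMk_left
          calc ε / 2 ≤ ∫ x, (freeSet F r B n (N - 1 - t) q).indicator (fun _ => (1 / 2 : ℝ)) x
                ∂(A.dist t (played h) : Measure X) := by
                rw [integral_indicator_const _ hfm, smul_eq_mul]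
                linarith
            _ ≤ _ := by
                refine integral_mono ((integrable_const _).indicator hfm)
                  (integrable_of_bound hqm (hq1 h)) fun x => ?_
                by_cases hx : x ∈ freeSet F r B n (N - 1 - t) q
                · simp only [Set.indicator_of_mem hx]
                  have hl : A.label t (played h) x =
                      decide ((L.predict t (h, x)).real {true} ≤ 1 / 2) := by
                    have h4 : A.label t (played h) x =
                        label t (replay (K, v₀) label next t (played h)).1 q x := rfl
                    rw [h4, hh]
                    exact if_pos hx
                  rw [hl]
                  have hf := real_false_eq (L.predict t (h, x))
                  by_cases hp : (L.predict t (h, x)).real {true} ≤ 1 / 2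
                  · rw [decide_eq_true hp, Bool.not_true, hf]
                    linarith
                  · rw [decide_eq_false hp, Bool.not_false]
                    linarith
                · rw [Set.indicator_of_notMem hx]
                  exact measureReal_nonneg
        have := ih (by omega)
        push_cast
        linarith
    exact hind N le_rfl

end AdaptiveLower

/-! ### The lower bound for oblivious adversaries -/

section Coupling

variable {X : Type*} [MeasurableSpace X] {U : Set (ProbabilityMeasure X)}

/-- A small change of the labels changes the law of the game by little. -/
theorem integral_play_le_of_label (L : Learner X) {A A' : ObliviousAdversary U}
    (hd : A.dist = A'.dist) {δ : ℝ} {t : ℕ}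
    (hl : ∀ s < t, (A.dist s : Measure X).real {x | A.label s x ≠ A'.label s x} ≤ δ)
    {φ : Hist X t → ℝ} (hφ : Measurable φ) (h0 : ∀ h, 0 ≤ φ h) (h1 : ∀ h, φ h ≤ 1) :
    ∫ h, φ h ∂(play L A.toAdaptive t) ≤ ∫ h, φ h ∂(play L A'.toAdaptive t) + t * δ := by
  induction t with
  | zero => simp [play]
  | succ t ih =>
    have habs : ∀ h, |φ h| ≤ 1 := fun h => by rw [abs_of_nonneg (h0 h)]; exact h1 h
    rw [integral_play_succ L _ t hφ habs, integral_play_succ L _ t hφ habs]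
    have hm : ∀ A : ObliviousAdversary U, Measurable fun p : Hist X t × X =>
        ∫ b, φ (A.toAdaptive.extend t (p.1, (p.2, b))) ∂(L.predict t p) := fun A => by
      refine measurable_integral_predict L t
        (g := fun p b => φ (A.toAdaptive.extend t (p.1, (p.2, b)))) ?_
      refine hφ.comp ((A.toAdaptive.measurable_extend t).comp ?_)
      fun_prop
    have hΨm : ∀ A : ObliviousAdversary U, Measurable fun h : Hist X t =>
        ∫ x, ∫ b, φ (A.toAdaptive.extend t (h, (x, b))) ∂(L.predict t (h, x))
          ∂(A.toAdaptive.dist t (played h) : Measure X) := fun A =>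
      measurable_integral_dist A.toAdaptive t (hm A)
    have hi0 : ∀ (A : ObliviousAdversary U) h x,
        0 ≤ ∫ b, φ (A.toAdaptive.extend t (h, (x, b))) ∂(L.predict t (h, x)) := fun A h x =>
      integral_nonneg fun b => h0 _
    have hi1 : ∀ (A : ObliviousAdversary U) h x,
        |∫ b, φ (A.toAdaptive.extend t (h, (x, b))) ∂(L.predict t (h, x))| ≤ 1 := fun A h x =>
      abs_integral_le_of_bound fun b => habs _
    have hΨ1 : ∀ (A : ObliviousAdversary U) (h : Hist X t),
        |∫ x, ∫ b, φ (A.toAdaptive.extend t (h, (x, b))) ∂(L.predict t (h, x))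
          ∂(A.toAdaptive.dist t (played h) : Measure X)| ≤ 1 := fun A h =>
      abs_integral_le_of_bound (hi1 A h)
    -- The induction hypothesis is applied to the conditional expectation of `φ` under the last
    -- round of `A`; exchanging that round for the one of `A'` then costs another `δ`.
    refine (ih (fun s hs => hl s (by omega)) (hΨm A)
      (fun h => integral_nonneg fun x => hi0 A h x) (fun h => (le_abs_self _).trans (hΨ1 A h))).trans ?_
    have hstep : ∫ h, ∫ x, ∫ b, φ (A.toAdaptive.extend t (h, (x, b))) ∂(L.predict t (h, x))
          ∂(A.toAdaptive.dist t (played h) : Measure X) ∂(play L A'.toAdaptive t) ≤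
        ∫ h, (∫ x, ∫ b, φ (A'.toAdaptive.extend t (h, (x, b))) ∂(L.predict t (h, x))
          ∂(A'.toAdaptive.dist t (played h) : Measure X) + δ) ∂(play L A'.toAdaptive t) := by
      refine integral_mono (integrable_of_bound (hΨm A) (hΨ1 A))
        ((integrable_of_bound (hΨm A') (hΨ1 A')).add (integrable_const δ)) fun h => ?_
      have hD : MeasurableSet {x | A.label t x ≠ A'.label t x} :=
        (measurableSet_eq_fun (A.measurable_label t) (A'.measurable_label t)).compl
      have hdist : A.toAdaptive.dist t (played h) = A.dist t := rfl
      have hdist' : A'.toAdaptive.dist t (played h) = A.dist t := by rw [hd]; rfl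
      simp only [hdist, hdist']
      have hint : ∀ A : ObliviousAdversary U, ∀ μ : ProbabilityMeasure X, Integrable (fun x =>
          ∫ b, φ (A.toAdaptive.extend t (h, (x, b))) ∂(L.predict t (h, x))) (μ : Measure X) :=
        fun A μ => integrable_of_bound ((hm A).comp measurable_prodMk_left) (hi1 A h)
      -- Where the labels agree the extended histories coincide; elsewhere both values lie in `[0,
      -- 1]`.
      calc _ ≤ ∫ x, (∫ b, φ (A'.toAdaptive.extend t (h, (x, b))) ∂(L.predict t (h, x)) +
            {x | A.label t x ≠ A'.label t x}.indicator (fun _ => (1 : ℝ)) x)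
            ∂(A.dist t : Measure X) := by
            refine integral_mono (hint A _)
              ((hint A' _).add ((integrable_const 1).indicator hD)) fun x => ?_
            by_cases hx : A.label t x = A'.label t x
            · have he : ∀ b, A.toAdaptive.extend t (h, (x, b)) =
                  A'.toAdaptive.extend t (h, (x, b)) := fun b => by
                simp only [AdaptiveAdversary.extend, ObliviousAdversary.toAdaptive, hx]
              simp [he, hx]
            · have h2 := (le_abs_self _).trans (hi1 A h x)
              have h3 := hi0 A' h x
              simp only [Set.indicator_of_mem (show x ∈ {x | A.label t x ≠ A'.label t x} from hx)]
              linarith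
        _ = _ := integral_add (hint A' _) ((integrable_const 1).indicator hD)
        _ ≤ _ := by
            rw [integral_indicator_const _ hD, smul_eq_mul, mul_one]
            simpa using hl t (by omega)
    rw [integral_add (integrable_of_bound (hΨm A') (hΨ1 A')) (integrable_const δ)] at hstep
    simp only [integral_const, probReal_univ, one_smul] at hstep
    push_cast
    linarith

theorem ae_label_eq (L : Learner X) (A : ObliviousAdversary U) {g : X → Bool} (hg : Measurable g)
    (hA : ∀ t, A.label t = g) (t : ℕ) :
    ∀ᵐ h ∂(play L A.toAdaptive t), ∀ s : Fin t, g (h s).1 = (h s).2.1 := by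
  induction t with
  | zero => exact Eventually.of_forall fun h s => s.elim0
  | succ t ih =>
    refine ae_play_succ L _ t ?_ ?_
    · have : {h : Hist X (t + 1) | ∀ s, g (h s).1 = (h s).2.1} =
          ⋂ s, {h | g (h s).1 = (h s).2.1} := by
        ext h
        simp
      rw [this]
      exact MeasurableSet.iInter fun s => measurableSet_eq_fun (by fun_prop) (by fun_prop)
    · filter_upwards [ih] with h hh
      refine Eventually.of_forall fun x b s => ?_
      refine Fin.lastCases ?_ (fun s => ?_) s
      · simp [AdaptiveAdversary.extend, ObliviousAdversary.toAdaptive, hA]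
      · simpa [AdaptiveAdversary.extend] using hh s

end Coupling

/-! ### Paths below a function, and the oblivious binary search -/

section ObliviousLower

variable {X : Type*} [MeasurableSpace X] {F : Set (X → Bool)} {r : X → Bool}
  {U : Set (ProbabilityMeasure X)} {ε : ℝ}

/-- An increasing path, with distributions that charge its gaps and functions that separate its
consecutive points. -/
structure IsPath (F : Set (X → Bool)) (r : X → Bool) (U : Set (ProbabilityMeasure X)) (ε : ℝ)
    (K : ℕ) (v : ℕ → X) (μ : ℕ → ProbabilityMeasure X) (g : ℕ → X → Bool) : Prop where
  le : ∀ i < K, TreeLE F r (v i) (v (i + 1))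
  mem : ∀ i < K, μ i ∈ U
  gap : ∀ i < K, ε ≤ (μ i : Measure X).real
    {z | TreeLE F r (v i) z ∧ TreeLE F r z (v (i + 1))}
  fun_mem : ∀ i < K, g i ∈ F
  ne : ∀ i < K, g i (v i) ≠ r (v i)
  eq : ∀ i < K, g i (v (i + 1)) = r (v (i + 1))

/-- A ladder that starts at `{f ≠ r}` stays inside this chain. Points of the ladder are then
comparable, and the branching alternative of `goodSet` disappears: a good set lies in the order
interval between consecutive points. -/
theorem exists_isPath (hVC : vcDim F = 1) (hr : r ∈ F) {f : X → Bool} (hf : f ∈ F) {K : ℕ}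
    (hK : 0 < K) (h : HasLadder F r U ε {x | f x ≠ r x} K) :
    ∃ v μ g, IsPath F r U ε K v μ g := by
  obtain ⟨B, hB0, -, hext, v₀, hv₀⟩ := h
  obtain ⟨n, -, ν, -, H⟩ := Extends.of_lt hK hext
  have hn : ∀ j < K, ∀ v ∈ B (j + 1), n j v ∈ B j ∧ TreeLT F r v (n j v) := fun j hj v hv =>
    ⟨(H j hj v hv).2.1, (H j hj v hv).2.2.1⟩
  -- Climbing from `v` ends in level `0`, where `f` differs from `r`, and `{f ≠ r}` is an initial
  -- segment.
  have hBf : ∀ j ≤ K, ∀ v ∈ B j, f v ≠ r v := by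
    intro j hj v hv
    have h1 := climb_mem hn le_rfl hj hv
    rw [Nat.sub_self, hB0] at h1
    exact treeLE_climb hn le_rfl hj hv f hf h1
  set v : ℕ → X := fun i => climb n i K v₀ with hv
  have hvB : ∀ i ≤ K, v i ∈ B (K - i) := fun i hi => climb_mem hn hi le_rfl hv₀
  have hstep : ∀ i < K, ν (K - i - 1) (v i) ∈ U ∧ v (i + 1) ∈ B (K - i - 1) ∧
      TreeLT F r (v i) (v (i + 1)) ∧ ε ≤ (ν (K - i - 1) (v i) : Measure X).real
        (goodSet F r (B (K - i - 1)) (v i) (v (i + 1))) := by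
    intro i hi
    have h1 := H (K - i - 1) (by omega) (v i)
      (by rw [show K - i - 1 + 1 = K - i by omega]; exact hvB i hi.le)
    have h2 : v (i + 1) = n (K - i - 1) (v i) := climb_succ n i K v₀
    rw [h2]
    exact h1
  have hg : ∀ i, ∃ g : X → Bool, i < K → g ∈ F ∧ g (v i) ≠ r (v i) ∧
      g (v (i + 1)) = r (v (i + 1)) := by
    intro i
    by_cases hi : i < K
    · obtain ⟨g, h1, h2, h3⟩ := exists_of_not_treeLE (hstep i hi).2.2.1.2
      exact ⟨g, fun _ => ⟨h1, h2, h3⟩⟩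
    · exact ⟨f, fun h => absurd h hi⟩
  choose g hg using hg
  refine ⟨v, fun i => ν (K - i - 1) (v i), g, fun i hi => (hstep i hi).2.2.1.1,
    fun i hi => (hstep i hi).1, fun i hi => (hstep i hi).2.2.2.trans (measureReal_mono ?_),
    fun i hi => (hg i hi).1, fun i hi => (hg i hi).2.1, fun i hi => (hg i hi).2.2⟩
  rintro z ⟨hz, hz'⟩
  refine ⟨hz.1, hz'.elim id fun ⟨hzB, hwz⟩ => ?_⟩
  exact (treeLE_total hVC hr hf (hBf _ (by omega) z hzB)
    (hBf _ (by omega) _ (hstep i hi).2.1)).resolve_right hwz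

variable {K : ℕ} {v : ℕ → X} {μ : ℕ → ProbabilityMeasure X} {g : ℕ → X → Bool}

theorem IsPath.le_of_le (h : IsPath F r U ε K v μ g) {i j : ℕ} (hij : i ≤ j) (hj : j ≤ K) :
    TreeLE F r (v i) (v j) := by
  induction j, hij using Nat.le_induction with
  | base => exact TreeLE.refl F r _
  | succ j hij ih => exact (ih (by omega)).trans (h.le j (by omega))

theorem IsPath.ne_of_le (h : IsPath F r U ε K v μ g) {i : ℕ} (hi : i < K) {x : X}
    (hx : TreeLE F r x (v i)) : g i x ≠ r x :=
  hx _ (h.fun_mem i hi) (h.ne i hi)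

theorem IsPath.eq_of_le (h : IsPath F r U ε K v μ g) {i : ℕ} (hi : i < K) {x : X}
    (hx : TreeLE F r (v (i + 1)) x) : g i x = r x := by
  by_contra hne
  exact hx _ (h.fun_mem i hi) hne (h.eq i hi)

/-- The functions of a segment of the path agree outside of the segment. -/
theorem IsPath.agree (hVC : vcDim F = 1) (hr : r ∈ F) (h : IsPath F r U ε K v μ g) {c d j : ℕ}
    (hcj : c ≤ j) (hjd : j < d) (hd : d ≤ K) {x : X}
    (hx : ¬ (TreeLE F r (v c) x ∧ ¬ TreeLE F r (v d) x)) : g c x = g j x := by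
  -- Outside the segment, membership in `{g i ≠ r}` has a criterion that does not depend on `i`.
  have key : ∀ i, c ≤ i → i < d → (g i x ≠ r x ↔ TreeLE F r x (v c)) := by
    intro i hci hid
    constructor
    · intro hne
      refine (treeLE_total hVC hr (h.fun_mem i (by omega)) hne
        (h.ne_of_le (by omega) (h.le_of_le hci (by omega)))).resolve_right fun hcx => ?_
      have hdx : TreeLE F r (v d) x := by
        by_contra hdx
        exact hx ⟨hcx, hdx⟩
      exact hne (h.eq_of_le (by omega) ((h.le_of_le (by omega) hd).trans hdx))
    · intro hxc
      exact h.ne_of_le (by omega) (hxc.trans (h.le_of_le hci (by omega)))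
  by_cases hxc : TreeLE F r x (v c)
  · exact Bool.eq_of_ne_of_ne ((key c le_rfl (by omega)).2 hxc) ((key j hcj hjd).2 hxc)
  · have h1 := not_not.1 (mt (key c le_rfl (by omega)).1 hxc)
    have h2 := not_not.1 (mt (key j hcj hjd).1 hxc)
    rw [h1, h2]

/-- One of many segments has small mass. -/
theorem IsPath.exists_segment (hle : MeasurableSet {p : X × X | TreeLE F r p.1 p.2})
    (h : IsPath F r U ε K v μ g) (ρ : Measure X) [IsProbabilityMeasure ρ] (b l : ℕ) {M : ℕ}
    (hM : 0 < M) (hK : b + M * l ≤ K) : ∃ i < M, ρ.real {x | TreeLE F r (v (b + i * l)) x ∧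
      ¬ TreeLE F r (v (b + i * l + l)) x} ≤ 1 / M := by
  have hm : ∀ i, MeasurableSet {x | TreeLE F r (v i) x} := fun i => measurable_prodMk_left hle
  -- The segments are differences of decreasing up-sets, so their masses telescope to at most one.
  have hdiff : ∀ i ∈ Finset.range M, ρ.real {x | TreeLE F r (v (b + i * l)) x ∧
      ¬ TreeLE F r (v (b + i * l + l)) x} = ρ.real {x | TreeLE F r (v (b + i * l)) x} -
        ρ.real {x | TreeLE F r (v (b + (i + 1) * l)) x} := by
    intro i hi
    have hi' := Finset.mem_range.1 hi
    have h1 : b + i * l + l = b + (i + 1) * l := by ring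
    have h2 : (i + 1) * l ≤ M * l := Nat.mul_le_mul_right l hi'
    rw [h1, ← measureReal_sdiff _ (hm _)]
    · rfl
    · intro x hx
      exact (h.le_of_le (by omega) (by omega)).trans hx
  have hsum : ∑ i ∈ Finset.range M, ρ.real {x | TreeLE F r (v (b + i * l)) x ∧
      ¬ TreeLE F r (v (b + i * l + l)) x} ≤ ∑ _i ∈ Finset.range M, (1 / M : ℝ) := by
    rw [Finset.sum_congr rfl hdiff,
      Finset.sum_range_sub' (fun i => ρ.real {x | TreeLE F r (v (b + i * l)) x})]
    have h1 : ∑ _i ∈ Finset.range M, (1 / M : ℝ) = 1 := by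
      have : (M : ℝ) ≠ 0 := by positivity
      simp [this]
    rw [h1]
    have h2 : ρ.real {x | TreeLE F r (v (b + 0 * l)) x} ≤ 1 := measureReal_le_one
    have h3 : 0 ≤ ρ.real {x | TreeLE F r (v (b + M * l)) x} := measureReal_nonneg
    linarith
  obtain ⟨i, hi, h4⟩ := Finset.exists_le_of_sum_le ⟨0, Finset.mem_range.2 hM⟩ hsum
  exact ⟨i, Finset.mem_range.1 hi, h4⟩

/-- The length of a path on which a binary search, with subdivision of the halves into `M` pieces,
can run for `k` more rounds. -/
def sparseLength (M : ℕ) : ℕ → ℕ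
  | 0 => 1
  | k + 1 => 2 * (M * sparseLength M k) + 1

theorem one_le_sparseLength (M k : ℕ) : 1 ≤ sparseLength M k := by
  cases k <;> simp [sparseLength]

/-- Change the strategy of an oblivious adversary in one round. -/
noncomputable def ObliviousAdversary.update (A : ObliviousAdversary U) (t : ℕ)
    (ρ : ProbabilityMeasure X) (hρ : ρ ∈ U) (f : X → Bool) (hf : Measurable f) :
    ObliviousAdversary U where
  dist := Function.update A.dist t ρ
  dist_mem s := by
    by_cases h : s = t
    · subst h
      simpa using hρ
    · simpa [h] using A.dist_mem s
  label := Function.update A.label t f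
  measurable_label s := by
    by_cases h : s = t
    · subst h
      simpa using hf
    · simpa [h] using A.measurable_label s

/-- The invariant is a segment of candidate functions, each agreeing with every label function used
so far up to mass `1 / M`. The choice of the half compares expected errors, computable in advance
from the learner, so the adversary remains oblivious. -/
theorem exists_partial_obliviousAdversary (hF : ∀ f ∈ F, Measurable f)
    (hle : MeasurableSet {p : X × X | TreeLE F r p.1 p.2})
    (hVC : vcDim F = 1) (hr : r ∈ F) {M N : ℕ} (hM : 0 < M)
    (h : IsPath F r U ε (sparseLength M N) v μ g) (L : Learner X) (t : ℕ) (ht : t ≤ N) :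
    ∃ (A : ObliviousAdversary U) (a : ℕ), a + sparseLength M (N - t) ≤ sparseLength M N ∧
      t * (ε / 2) ≤ ∫ h, mistakes h ∂(play L A.toAdaptive t) ∧
      ∀ s < t, ∀ j, a ≤ j → j < a + sparseLength M (N - t) →
        (A.dist s : Measure X).real {x | A.label s x ≠ g j x} ≤ 1 / M := by
  induction t with
  | zero =>
    refine ⟨⟨fun _ => μ 0, fun _ => h.mem 0 (one_le_sparseLength M N), fun _ => r,
      fun _ => hF r hr⟩, 0, by simp, by simp [mistakes], by simp⟩
  | succ t ih =>
    obtain ⟨A, a, ha, hmist, hmass⟩ := ih (by omega)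
    set k := N - (t + 1) with hk
    have hkt : N - t = k + 1 := by omega
    rw [hkt] at ha hmass
    set l := sparseLength M k with hl
    have hl1 : 1 ≤ l := one_le_sparseLength M k
    have hlk : sparseLength M (k + 1) = 2 * (M * l) + 1 := rfl
    rw [hlk] at ha hmass
    -- The gap between `m` and `m + 1` is charged; on either side lie `M` blocks of length `l`, one
    -- of which has mass at most `1 / M` under `μ m`.
    set m := a + M * l with hm
    have hmK : m < sparseLength M N := by omega
    obtain ⟨i₀, hi₀, hs₀⟩ := h.exists_segment hle (μ m : Measure X) a l hM (by omega)
    obtain ⟨i₁, hi₁, hs₁⟩ := h.exists_segment hle (μ m : Measure X) (m + 1) l hM (by omega)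
    have hc₀ : i₀ * l + l ≤ M * l := by
      calc i₀ * l + l = (i₀ + 1) * l := by ring
        _ ≤ M * l := Nat.mul_le_mul_right l hi₀
    have hc₁ : i₁ * l + l ≤ M * l := by
      calc i₁ * l + l = (i₁ + 1) * l := by ring
        _ ≤ M * l := Nat.mul_le_mul_right l hi₁
    set c₀ := a + i₀ * l with hc₀'
    set c₁ := m + 1 + i₁ * l with hc₁'
    have hμm := h.mem m hmK
    have hgm : ∀ c, c < sparseLength M N → Measurable (g c) := fun c hc => hF _ (h.fun_mem c hc)
    have hcase : ∀ c (hc : c < sparseLength M N), a ≤ c → c + l ≤ a + (2 * (M * l) + 1) →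
        (μ m : Measure X).real {x | TreeLE F r (v c) x ∧ ¬ TreeLE F r (v (c + l)) x} ≤ 1 / M →
        ε / 2 ≤ ∫ h, ∫ x, (L.predict t (h, x)).real {!(g c x)} ∂(μ m : Measure X)
          ∂(play L A.toAdaptive t) →
        ∃ (A : ObliviousAdversary U) (a : ℕ), a + l ≤ sparseLength M N ∧
          (t + 1 : ℕ) * (ε / 2) ≤ ∫ h, mistakes h ∂(play L A.toAdaptive (t + 1)) ∧
          ∀ s < t + 1, ∀ j, a ≤ j → j < a + l →
            (A.dist s : Measure X).real {x | A.label s x ≠ g j x} ≤ 1 / M := by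
      intro c hc hac hca hseg herr
      refine ⟨A.update t (μ m) hμm (g c) (hgm c hc), c, by omega, ?_, ?_⟩
      · have hplay : play L (A.update t (μ m) hμm (g c) (hgm c hc)).toAdaptive t =
            play L A.toAdaptive t := by
          refine play_congr L t (fun s hs => ?_) (fun s hs => ?_)
          · funext p
            simp [ObliviousAdversary.toAdaptive, ObliviousAdversary.update, hs.ne]
          · funext p
            simp [ObliviousAdversary.toAdaptive, ObliviousAdversary.update, hs.ne]
        rw [integral_mistakes_succ, hplay]
        have h1 : ∀ h : Hist X t, (A.update t (μ m) hμm (g c) (hgm c hc)).toAdaptive.dist t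
            (played h) = μ m := fun h => by
          simp [ObliviousAdversary.toAdaptive, ObliviousAdversary.update]
        have h2 : ∀ h : Hist X t, (A.update t (μ m) hμm (g c) (hgm c hc)).toAdaptive.label t
            (played h) = g c := fun h => by
          simp [ObliviousAdversary.toAdaptive, ObliviousAdversary.update]
        simp only [h1, h2]
        push_cast
        linarith
      · intro s hs j hcj hjc
        rcases Nat.lt_succ_iff_lt_or_eq.1 hs with hs | rfl
        · have := hmass s hs j (by omega) (by omega)
          simpa [ObliviousAdversary.update, hs.ne] using this
        · simp only [ObliviousAdversary.update, Function.update_self]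
          refine (measureReal_mono ?_).trans hseg
          intro x hx
          by_contra hx'
          exact hx (h.agree hVC hr hcj hjc (by omega) hx')
    have hqm : ∀ c, c < sparseLength M N → Measurable fun p : Hist X t × X =>
        (L.predict t p).real {!(g c p.2)} := by
      intro c hc
      have := measurable_mistakeProb L (A.update t (μ m) hμm (g c) (hgm c hc)).toAdaptive t
      simpa [ObliviousAdversary.toAdaptive, ObliviousAdversary.update] using this
    have hq1 : ∀ c (h : Hist X t) (x : X), |(L.predict t (h, x)).real {!(g c x)}| ≤ 1 :=
      fun c h x => by
        rw [abs_of_nonneg measureReal_nonneg]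
        exact measureReal_le_one
    have hK₀ : c₀ < sparseLength M N := by omega
    have hK₁ : c₁ < sparseLength M N := by omega
    have hin : ∀ c, c < sparseLength M N → ∀ h : Hist X t,
        Integrable (fun x => (L.predict t (h, x)).real {!(g c x)}) (μ m : Measure X) :=
      fun c hc h => integrable_of_bound ((hqm c hc).comp measurable_prodMk_left) (hq1 c h)
    have hout : ∀ c, c < sparseLength M N → Integrable (fun h : Hist X t =>
        ∫ x, (L.predict t (h, x)).real {!(g c x)} ∂(μ m : Measure X))
        (play L A.toAdaptive t) := by
      intro c hc
      refine integrable_of_bound (C := 1) ?_ fun h => abs_integral_le_of_bound (hq1 c h)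
      have := measurable_integral_dist
        (A.update t (μ m) hμm (g c) (hgm c hc)).toAdaptive t (hqm c hc)
      simpa [ObliviousAdversary.toAdaptive, ObliviousAdversary.update] using this
    -- On the gap the functions of the lower block equal `r` and those of the upper block its
    -- negation, so the two mistake probabilities add up to one there.
    have hsum : ε ≤ ∫ h, ∫ x, (L.predict t (h, x)).real {!(g c₀ x)} ∂(μ m : Measure X)
          ∂(play L A.toAdaptive t) + ∫ h, ∫ x, (L.predict t (h, x)).real {!(g c₁ x)}
          ∂(μ m : Measure X) ∂(play L A.toAdaptive t) := by
      rw [← integral_add (hout c₀ hK₀) (hout c₁ hK₁)]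
      have hc : ∫ _h, ε ∂(play L A.toAdaptive t) = ε := by simp
      rw [← hc]
      refine integral_mono (integrable_const _) ((hout c₀ hK₀).add (hout c₁ hK₁)) fun p => ?_
      beta_reduce
      rw [← integral_add (hin c₀ hK₀ p) (hin c₁ hK₁ p)]
      set G : Set X := {z | TreeLE F r (v m) z ∧ TreeLE F r z (v (m + 1))} with hG
      have hGm : MeasurableSet G := (measurable_prodMk_left (x := v m) hle).inter
        (measurable_prodMk_right (y := v (m + 1)) hle)
      calc ε ≤ ∫ x, G.indicator (fun _ => (1 : ℝ)) x ∂(μ m : Measure X) := by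
            rw [integral_indicator_const _ hGm, smul_eq_mul, mul_one]
            exact h.gap m hmK
        _ ≤ _ := by
            refine integral_mono ((integrable_const _).indicator hGm)
              ((hin c₀ hK₀ p).add (hin c₁ hK₁ p)) fun x => ?_
            by_cases hx : x ∈ G
            · simp only [Set.indicator_of_mem hx]
              have h0 : g c₀ x = r x :=
                h.eq_of_le hK₀ ((h.le_of_le (by omega) hmK.le).trans hx.1)
              have h1 : g c₁ x ≠ r x :=
                h.ne_of_le hK₁ (hx.2.trans (h.le_of_le (by omega) hK₁.le))
              have h2 : g c₁ x = !(r x) := by simpa [Bool.eq_not] using h1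
              have hf := real_false_eq (L.predict t (p, x))
              rw [h0, h2, Bool.not_not]
              cases r x <;> simp [hf]
            · rw [Set.indicator_of_notMem hx]
              exact add_nonneg measureReal_nonneg measureReal_nonneg
    rcases le_or_gt (ε / 2) (∫ h, ∫ x, (L.predict t (h, x)).real {!(g c₀ x)} ∂(μ m : Measure X)
          ∂(play L A.toAdaptive t)) with h0 | h0
    · exact hcase c₀ hK₀ (by omega) (by omega) hs₀ h0
    · exact hcase c₁ hK₁ (by omega) (by omega) hs₁ (by linarith)

/-- A long ladder below a member of the class forces many mistakes, even for oblivious adversaries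
in the realizable case. -/
theorem exists_obliviousAdversary (hF : ∀ f ∈ F, Measurable f)
    (hle : MeasurableSet {p : X × X | TreeLE F r p.1 p.2})
    (hVC : vcDim F = 1) (hr : r ∈ F) {f : X → Bool} (hf : f ∈ F) {M N : ℕ} (hM : 0 < M)
    (hMN : (N : ℝ) * (1 / M) ≤ ε / 4)
    (hlad : HasLadder F r U ε {x | f x ≠ r x} (sparseLength M N)) (L : Learner X) :
    ∃ A : ObliviousAdversary U, ∃ g ∈ F,
      (∀ᵐ h ∂(play L A.toAdaptive N), ∀ s : Fin N, g (h s).1 = (h s).2.1) ∧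
      N * (ε / 4) ≤ ∫ h, mistakes h ∂(play L A.toAdaptive N) := by
  obtain ⟨v, μ, g, h⟩ := exists_isPath hVC hr hf (one_le_sparseLength M N) hlad
  obtain ⟨A, a, ha, hmist, hmass⟩ :=
    exists_partial_obliviousAdversary hF hle hVC hr hM h L N le_rfl
  have hl := one_le_sparseLength M (N - N)
  have hgF := h.fun_mem a (by omega)
  set A' : ObliviousAdversary U := ⟨A.dist, A.dist_mem, fun _ => g a, fun _ => hF _ hgF⟩ with hA'
  refine ⟨A', g a, hgF, ae_label_eq L A' (hF _ hgF) (fun _ => rfl) N, ?_⟩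
  rcases Nat.eq_zero_or_pos N with rfl | hN
  · simpa using integral_nonneg mistakes_nonneg
  have hN' : (0 : ℝ) < N := by exact_mod_cast hN
  -- Normalizing the mistakes to `[0, 1]` costs a factor `N`, so the change of labels loses `N * N /
  -- M ≤ N * (ε / 4)`, half of the forced mistakes.
  have h1 := integral_play_le_of_label L (A := A) (A' := A') rfl
    (fun s hs => hmass s hs a le_rfl (by omega)) (φ := fun h => mistakes h / N)
    (measurable_mistakes.div_const _) (fun h => div_nonneg (mistakes_nonneg h) hN'.le)
    (fun h => (div_le_one hN').2 (mistakes_le h))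
  rw [integral_div, integral_div, div_le_iff₀ hN', add_mul, div_mul_cancel₀ _ hN'.ne'] at h1
  have h2 : (N : ℝ) * (1 / M) * N ≤ ε / 4 * N := mul_le_mul_of_nonneg_right hMN hN'.le
  linarith

end ObliviousLower

/-! ### Regrets -/

section Regret

variable {X : Type*} [MeasurableSpace X] {F : Set (X → Bool)} {r : X → Bool}
  {U : Set (ProbabilityMeasure X)} {ε : ℝ}

theorem integrable_mistakes (L : Learner X) (A : AdaptiveAdversary U) (T : ℕ) :
    Integrable mistakes (play L A T) :=
  integrable_of_bound measurable_mistakes abs_mistakes_le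

theorem integrable_errors (L : Learner X) (A : AdaptiveAdversary U) (T : ℕ) {f : X → Bool}
    (hf : Measurable f) : Integrable (fun h => errors f (sample h)) (play L A T) :=
  integrable_of_bound ((measurable_errors hf).comp measurable_sample) (C := T) fun h => by
    rw [abs_of_nonneg (errors_nonneg _ _)]
    exact errors_le _ _

theorem integrable_bestLoss (hF : F.Nonempty)
    (hbest : ∀ T : ℕ, Measurable fun D : Fin T → X × Bool => bestLoss F D)
    (L : Learner X) (A : AdaptiveAdversary U) (T : ℕ) :
    Integrable (fun h => bestLoss F (sample h)) (play L A T) :=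
  integrable_of_bound ((hbest T).comp measurable_sample) (C := T) fun h => by
    rw [abs_of_nonneg (bestLoss_nonneg _)]
    exact bestLoss_le_card hF _

theorem integral_mistakes_nonneg (L : Learner X) (A : AdaptiveAdversary U) (T : ℕ) :
    0 ≤ ∫ h, mistakes h ∂(play L A T) :=
  integral_nonneg mistakes_nonneg

theorem integral_mistakes_le (L : Learner X) (A : AdaptiveAdversary U) (T : ℕ) :
    ∫ h, mistakes h ∂(play L A T) ≤ T :=
  (le_abs_self _).trans (abs_integral_le_of_bound abs_mistakes_le)

theorem integral_errors_nonneg (L : Learner X) (A : AdaptiveAdversary U) (T : ℕ) (f : X → Bool) :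
    0 ≤ ∫ h, errors f (sample h) ∂(play L A T) :=
  integral_nonneg fun _ => errors_nonneg _ _

theorem adaptiveRegret_le (L : Learner X) (A : AdaptiveAdversary U) (T : ℕ) :
    adaptiveRegret F T L A ≤ T := by
  by_cases h : Integrable (fun h => mistakes h - bestLoss F (sample h)) (play L A T)
  · refine (integral_mono h (integrable_mistakes L A T) fun h => ?_).trans
      (integral_mistakes_le L A T)
    exact sub_le_self _ (bestLoss_nonneg _)
  · rw [adaptiveRegret, integral_undef h]
    positivity

theorem obliviousRegret_le (L : Learner X) (A : ObliviousAdversary U) (T : ℕ) :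
    obliviousRegret F T L A ≤ T := by
  have h1 : 0 ≤ ⨅ f : F, ∫ h, errors f.1 (sample h) ∂(play L A.toAdaptive T) :=
    Real.iInf_nonneg fun f => integral_errors_nonneg L _ T f.1
  have h2 := integral_mistakes_le L A.toAdaptive T
  unfold obliviousRegret
  linarith

theorem bddAbove_regrets (T : ℕ) (L : Learner X) (σ : Setting) :
    BddAbove (regrets F U T L σ) := by
  refine ⟨T, ?_⟩
  cases σ
  · rintro ρ ⟨A, rfl⟩
    exact obliviousRegret_le L A T
  · rintro ρ ⟨A, -, rfl⟩
    exact obliviousRegret_le L A T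
  · rintro ρ ⟨A, rfl⟩
    exact adaptiveRegret_le L A T
  · rintro ρ ⟨A, -, rfl⟩
    exact adaptiveRegret_le L A T

theorem adaptiveRegret_eq_of_realizable {L : Learner X} {A : AdaptiveAdversary U} {T : ℕ}
    (h : ∀ᵐ h ∂(play L A T), bestLoss F (sample h) = 0) :
    adaptiveRegret F T L A = ∫ h, mistakes h ∂(play L A T) :=
  integral_congr_ae (by filter_upwards [h] with h hh; rw [hh, sub_zero])

theorem le_obliviousRegret_of_realizable {L : Learner X} {A : ObliviousAdversary U} {T : ℕ}
    {f : X → Bool} (hf : f ∈ F)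
    (h : ∀ᵐ h ∂(play L A.toAdaptive T), ∀ s : Fin T, f (h s).1 = (h s).2.1) :
    ∫ h, mistakes h ∂(play L A.toAdaptive T) ≤ obliviousRegret F T L A := by
  have h0 : ∫ h, errors f (sample h) ∂(play L A.toAdaptive T) = 0 := by
    refine integral_eq_zero_of_ae ?_
    filter_upwards [h] with h hh
    exact errors_eq_zero_iff.2 hh
  have h1 : ⨅ f : F, ∫ h, errors f.1 (sample h) ∂(play L A.toAdaptive T) ≤
      ∫ h, errors f (sample h) ∂(play L A.toAdaptive T) :=
    ciInf_le ⟨0, by rintro _ ⟨f, rfl⟩; exact integral_errors_nonneg L _ T f.1⟩ (⟨f, hf⟩ : F)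
  rw [obliviousRegret]
  linarith

theorem exists_realizable_obliviousAdversary (hU : U.Nonempty) (hr : Measurable r)
    (L : Learner X) (T : ℕ) : ∃ A : ObliviousAdversary U,
      ∀ᵐ h ∂(play L A.toAdaptive T), ∀ s : Fin T, r (h s).1 = (h s).2.1 :=
  ⟨⟨fun _ => hU.some, fun _ => hU.some_mem, fun _ => r, fun _ => hr⟩,
    ae_label_eq L _ hr (fun _ => rfl) T⟩

/-- Labelling by `r` gives an adversary admissible in all four settings, with nonnegative regret. If
`U` is empty there are no adversaries and the supremum is zero by convention. -/
theorem worstRegret_nonneg (hF : ∀ f ∈ F, Measurable f) (hr : r ∈ F) (T : ℕ) (L : Learner X)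
    (σ : Setting) : 0 ≤ worstRegret F U T L σ := by
  have h1 : ∀ A : ObliviousAdversary U,
      (∃ f ∈ F, ∀ᵐ h ∂(play L A.toAdaptive T), ∀ s : Fin T, f (h s).1 = (h s).2.1) →
      0 ≤ obliviousRegret F T L A := fun A ⟨f, hf, h⟩ =>
    (integral_mistakes_nonneg L _ T).trans (le_obliviousRegret_of_realizable hf h)
  have h2 : ∀ A : AdaptiveAdversary U, (∀ᵐ h ∂(play L A T), bestLoss F (sample h) = 0) →
      0 ≤ adaptiveRegret F T L A := fun A h => by
    rw [adaptiveRegret_eq_of_realizable h]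
    exact integral_mistakes_nonneg L _ T
  rcases U.eq_empty_or_nonempty with rfl | hU
  · refine Real.sSup_nonneg ?_
    cases σ
    · rintro ρ ⟨A, rfl⟩
      exact absurd (A.dist_mem 0) (Set.notMem_empty _)
    · rintro ρ ⟨A, h, rfl⟩
      exact h1 A h
    · rintro ρ ⟨A, rfl⟩
      exact absurd (A.dist_mem 0 Fin.elim0) (Set.notMem_empty _)
    · rintro ρ ⟨A, h, rfl⟩
      exact h2 A h
  · obtain ⟨A, hA⟩ := exists_realizable_obliviousAdversary hU (hF r hr) L T
    have hA' : ∀ᵐ h ∂(play L A.toAdaptive T), bestLoss F (sample h) = 0 := by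
      filter_upwards [hA] with h hh
      exact (bestLoss_eq_zero_iff ⟨r, hr⟩).2 ⟨r, hr, hh⟩
    cases σ
    · exact (h1 A ⟨r, hr, hA⟩).trans (le_csSup (bddAbove_regrets T L _) ⟨A, rfl⟩)
    · exact (h1 A ⟨r, hr, hA⟩).trans (le_csSup (bddAbove_regrets T L _) ⟨A, ⟨r, hr, hA⟩, rfl⟩)
    · exact (h2 _ hA').trans (le_csSup (bddAbove_regrets T L _) ⟨A.toAdaptive, rfl⟩)
    · exact (h2 _ hA').trans (le_csSup (bddAbove_regrets T L _) ⟨A.toAdaptive, hA', rfl⟩)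

/-- The sets at which the ladders that matter in a setting start. -/
def bases (F : Set (X → Bool)) (r : X → Bool) : Setting → Set (Set X)
  | .obliviousAgnostic => {B | ∃ f ∈ F, B = {x | f x ≠ r x}}
  | .obliviousRealizable => {B | ∃ f ∈ F, B = {x | f x ≠ r x}}
  | .adaptiveAgnostic => {Set.univ}
  | .adaptiveRealizable => {Set.univ}

/-- High ladders force a large regret. -/
theorem exists_le_worstRegret_of_hasLadder [StandardBorelSpace X] (hF : ∀ f ∈ F, Measurable f)
    (hbest : ∀ T : ℕ, Measurable fun D : Fin T → X × Bool => bestLoss F D)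
    (hVC : vcDim F = 1) (hr : r ∈ F) (hε : 0 < ε) (U : Set (ProbabilityMeasure X)) (N : ℕ)
    (σ : Setting) : ∃ K, 1 ≤ K ∧ ∀ B₀ ∈ bases F r σ, HasLadder F r U ε B₀ K →
      ∀ L : Learner X, N * (ε / 4) ≤ worstRegret F U N L σ := by
  have hle := measurableSet_treeLE hF hr hbest
  have hN : (N : ℝ) * (ε / 4) ≤ N * (ε / 2) := by gcongr; norm_num
  -- Chosen so that `N / M ≤ ε / 4`; the successor keeps `M` positive even when `N = 0`.
  set M := ⌈4 * N / ε⌉₊ + 1 with hM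
  have hMN : (N : ℝ) * (1 / M) ≤ ε / 4 := by
    have h1 : 4 * N / ε ≤ M := (Nat.le_ceil _).trans (by rw [hM]; push_cast; linarith)
    have h2 : (0 : ℝ) < M := by rw [hM]; positivity
    rw [div_le_iff₀ hε] at h1
    rw [mul_one_div, div_le_iff₀ h2]
    linarith
  cases σ
  · refine ⟨sparseLength M N, one_le_sparseLength M N, ?_⟩
    rintro _ ⟨f, hf, rfl⟩ hlad L
    obtain ⟨A, g, hg, hA, h⟩ := exists_obliviousAdversary hF hle hVC hr hf
      (Nat.succ_pos _) hMN hlad L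
    exact (h.trans (le_obliviousRegret_of_realizable hg hA)).trans
      (le_csSup (bddAbove_regrets N L _) ⟨A, rfl⟩)
  · refine ⟨sparseLength M N, one_le_sparseLength M N, ?_⟩
    rintro _ ⟨f, hf, rfl⟩ hlad L
    obtain ⟨A, g, hg, hA, h⟩ := exists_obliviousAdversary hF hle hVC hr hf
      (Nat.succ_pos _) hMN hlad L
    exact (h.trans (le_obliviousRegret_of_realizable hg hA)).trans
      (le_csSup (bddAbove_regrets N L _) ⟨A, ⟨g, hg, hA⟩, rfl⟩)
  · refine ⟨searchLength N, one_le_searchLength N, fun B₀ _ hlad L => ?_⟩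
    obtain ⟨A, hA, h⟩ := exists_adaptiveAdversary hF hbest hVC hr hlad L
    rw [← adaptiveRegret_eq_of_realizable hA] at h
    exact (hN.trans h).trans (le_csSup (bddAbove_regrets N L _) ⟨A, rfl⟩)
  · refine ⟨searchLength N, one_le_searchLength N, fun B₀ _ hlad L => ?_⟩
    obtain ⟨A, hA, h⟩ := exists_adaptiveAdversary hF hbest hVC hr hlad L
    rw [← adaptiveRegret_eq_of_realizable hA] at h
    exact (hN.trans h).trans (le_csSup (bddAbove_regrets N L _) ⟨A, hA, rfl⟩)

/-- Learnability bounds the heights of the ladders. -/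
theorem exists_not_hasLadder_of_learnable [StandardBorelSpace X] (hF : ∀ f ∈ F, Measurable f)
    (hbest : ∀ T : ℕ, Measurable fun D : Fin T → X × Bool => bestLoss F D)
    (hVC : vcDim F = 1) (hr : r ∈ F) (hε : 0 < ε) {σ : Setting} (h : Learnable σ F U) :
    ∃ K, 1 ≤ K ∧ ∀ B₀ ∈ bases F r σ, ¬ HasLadder F r U ε B₀ K := by
  -- Some learner must exist for `le_ciInf` to bound the minimax regret from below.
  obtain ⟨L, -⟩ := exists_isTreeHedge (hF r hr) (measurableSet_treeLE hF hr hbest)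
  have : Nonempty (Learner X) := ⟨L 0⟩
  have h1 : ∀ᶠ N : ℕ in atTop,
      (1 / (N : ℝ)) * ⨅ L : Learner X, worstRegret F U N L σ < ε / 4 :=
    h.eventually (gt_mem_nhds (by positivity))
  obtain ⟨N, hN, hN1⟩ := (h1.and (eventually_ge_atTop 1)).exists
  have hN0 : (0 : ℝ) < N := by exact_mod_cast hN1
  -- A single horizon `N` with small minimax regret suffices; the resulting height is the same for
  -- all bases.
  obtain ⟨K, hK, H⟩ := exists_le_worstRegret_of_hasLadder hF hbest hVC hr hε U N σ
  refine ⟨K, hK, fun B₀ hB₀ hlad => hN.not_ge ?_⟩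
  have h2 : N * (ε / 4) ≤ ⨅ L : Learner X, worstRegret F U N L σ := le_ciInf (H B₀ hB₀ hlad)
  rw [one_div, inv_mul_eq_div, le_div_iff₀ hN0]
  linarith

/-- A bound on the regret of Hedge in the absence of ladders. -/
noncomputable def regretBound (ε : ℝ) (T : ℕ) : ℝ :=
  (Real.log (experts T).card + 4 * ε * T + 1) + Real.log (experts T).card / rate T +
    rate T * T / 2

theorem regretBound_nonneg (hε : 0 < ε) (T : ℕ) : 0 ≤ regretBound ε T := by
  have h1 := log_card_experts_nonneg T
  have h2 := rate_nonneg T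
  unfold regretBound
  positivity

/-- In the oblivious settings the bound holds for each fixed comparator, with its own base, before
taking the infimum. In the adaptive settings the minimizer varies with the history, so ladders from
the whole space must be excluded. -/
theorem worstRegret_le_of_not_hasLadder [StandardBorelSpace X] (hF : ∀ f ∈ F, Measurable f)
    (hbest : ∀ T : ℕ, Measurable fun D : Fin T → X × Bool => bestLoss F D)
    (hVC : vcDim F = 1) (hr : r ∈ F) (hε : 0 < ε) {L : ℕ → Learner X} (hL : IsTreeHedge F r L)
    {σ : Setting} {K : ℕ} (hK : 1 ≤ K) (H : ∀ B₀ ∈ bases F r σ, ¬ HasLadder F r U ε B₀ K)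
    {T : ℕ} (hKT : K ≤ Nat.sqrt T) (hrate : 0 < rate T) :
    worstRegret F U T (L T) σ ≤ regretBound ε T := by
  have hle := measurableSet_treeLE hF hr hbest
  have hlt := measurableSet_treeLT hF hr hbest
  have hne : F.Nonempty := ⟨r, hr⟩
  have hob : (∀ B₀ ∈ {B | ∃ f ∈ F, B = {x | f x ≠ r x}}, ¬ HasLadder F r U ε B₀ K) →
      ∀ A : ObliviousAdversary U, obliviousRegret F T (L T) A ≤ regretBound ε T := by
    intro H A
    have : Nonempty F := ⟨⟨r, hr⟩⟩
    have h1 : ∫ h, mistakes h ∂(play (L T) A.toAdaptive T) - regretBound ε T ≤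
        ⨅ f : F, ∫ h, errors f.1 (sample h) ∂(play (L T) A.toAdaptive T) := by
      refine le_ciInf fun ⟨f, hf⟩ => ?_
      have := integral_mistakes_le_of_not_hasLadder hlt hle hVC hr (hF r hr) hL hε hK
        (measurableSet_eq_fun (hF f hf) (hF r hr)).compl (H _ ⟨f, hf, rfl⟩) hKT hrate
        A.toAdaptive (integrable_errors (L T) A.toAdaptive T (hF f hf))
        fun h => ⟨f, hf, fun x hx => hx, le_rfl⟩
      unfold regretBound
      linarith
    unfold obliviousRegret
    linarith
  have had : (∀ B₀ ∈ ({Set.univ} : Set (Set X)), ¬ HasLadder F r U ε B₀ K) →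
      ∀ A : AdaptiveAdversary U, adaptiveRegret F T (L T) A ≤ regretBound ε T := by
    intro H A
    have hint := integrable_bestLoss hne hbest (L T) A T
    have := integral_mistakes_le_of_not_hasLadder hlt hle hVC hr (hF r hr) hL hε hK
      MeasurableSet.univ (H _ rfl) hKT hrate A hint fun h => by
        obtain ⟨f, hf, he⟩ := exists_errors_eq_bestLoss hne (sample h)
        exact ⟨f, hf, fun _ _ => trivial, he.le⟩
    unfold adaptiveRegret regretBound
    rw [integral_sub (integrable_mistakes _ _ _) hint]
    linarith
  refine Real.sSup_le ?_ (regretBound_nonneg hε T)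
  cases σ
  · rintro ρ ⟨A, rfl⟩
    exact hob H A
  · rintro ρ ⟨A, -, rfl⟩
    exact hob H A
  · rintro ρ ⟨A, rfl⟩
    exact had H A
  · rintro ρ ⟨A, -, rfl⟩
    exact had H A

end Regret

/-! ### Asymptotics -/

theorem rate_pos {T : ℕ} (hT : 1 ≤ T) : 0 < rate T := by
  have h1 : 1 < (experts T).card := by
    refine Finset.one_lt_card.2 ⟨∅, empty_mem_experts T, {0}, ?_, by simp⟩
    simp only [experts, Finset.mem_filter, Finset.mem_powerset, Finset.singleton_subset_iff,
      Finset.mem_range, Finset.card_singleton]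
    exact ⟨hT, Nat.le_sqrt.2 (by omega)⟩
  have h2 : 0 < Real.log (experts T).card := Real.log_pos (by exact_mod_cast h1)
  have h3 : (0 : ℝ) < T := by exact_mod_cast hT
  exact Real.sqrt_pos.2 (by positivity)

/-- Bounding `T.choose i` by `T ^ i * (Nat.sqrt T).choose i` makes the sum a binomial expansion. -/
theorem card_experts_le (T : ℕ) : (experts T).card ≤ (T + 1) ^ Nat.sqrt T := by
  have h1 : experts T ⊆ (Finset.range (Nat.sqrt T + 1)).biUnion
      fun i => (Finset.range T).powersetCard i := by
    intro S hS
    simp only [experts, Finset.mem_filter, Finset.mem_powerset] at hS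
    simp only [Finset.mem_biUnion, Finset.mem_range, Finset.mem_powersetCard]
    exact ⟨S.card, by omega, hS.1, rfl⟩
  calc (experts T).card ≤ _ := Finset.card_le_card h1
    _ ≤ ∑ i ∈ Finset.range (Nat.sqrt T + 1), ((Finset.range T).powersetCard i).card :=
        Finset.card_biUnion_le
    _ ≤ ∑ i ∈ Finset.range (Nat.sqrt T + 1), T ^ i * 1 ^ (Nat.sqrt T - i) *
          (Nat.sqrt T).choose i := Finset.sum_le_sum fun i hi => by
        rw [Finset.card_powersetCard, Finset.card_range, one_pow, mul_one]
        refine (Nat.choose_le_pow T i).trans (Nat.le_mul_of_pos_right _ (Nat.choose_pos ?_))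
        have := Finset.mem_range.1 hi
        omega
    _ = (T + 1) ^ Nat.sqrt T := (add_pow _ _ _).symm

theorem tendsto_log_card_experts_div :
    Tendsto (fun T : ℕ => Real.log (experts T).card / T) atTop (𝓝 0) := by
  have h0 : Tendsto (fun x : ℝ => Real.log x / x ^ (1 / 2 : ℝ)) atTop (𝓝 0) :=
    (isLittleO_log_rpow_atTop (by norm_num : (0 : ℝ) < 1 / 2)).tendsto_div_nhds_zero
  have h1 : Tendsto (fun T : ℕ => 2 * (Real.log ((T + 1 : ℕ) : ℝ) /
      ((T + 1 : ℕ) : ℝ) ^ (1 / 2 : ℝ))) atTop (𝓝 0) := by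
    have := (h0.comp (tendsto_natCast_atTop_atTop.comp (tendsto_add_atTop_nat 1))).const_mul 2
    simpa using this
  refine squeeze_zero' (Eventually.of_forall fun T =>
    div_nonneg (log_card_experts_nonneg T) (Nat.cast_nonneg _)) ?_ h1
  filter_upwards [eventually_ge_atTop 1] with T hT
  have hT0 : (1 : ℝ) ≤ T := by exact_mod_cast hT
  have hs := Real.sqrt_pos.2 (by linarith : (0 : ℝ) < T + 1)
  have hl : 0 ≤ Real.log ((T : ℝ) + 1) := Real.log_nonneg (by linarith)
  have hlog : Real.log (experts T).card ≤ Real.sqrt ((T : ℝ) + 1) * Real.log ((T : ℝ) + 1) := by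
    have hpos : (0 : ℝ) < (experts T).card := by
      exact_mod_cast Finset.card_pos.2 ⟨∅, empty_mem_experts T⟩
    have : ((experts T).card : ℝ) ≤ ((T : ℝ) + 1) ^ Nat.sqrt T := by
      exact_mod_cast card_experts_le T
    refine (Real.log_le_log hpos this).trans ?_
    rw [Real.log_pow]
    refine mul_le_mul_of_nonneg_right ?_ hl
    exact Real.nat_sqrt_le_real_sqrt.trans (Real.sqrt_le_sqrt (by linarith))
  rw [← Real.sqrt_eq_rpow]
  push_cast
  rw [div_le_iff₀ (by linarith), ← mul_div_assoc, div_mul_eq_mul_div, le_div_iff₀ hs]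
  have h2 := mul_le_mul_of_nonneg_right hlog hs.le
  have h3 := Real.mul_self_sqrt (by linarith : (0 : ℝ) ≤ T + 1)
  have h4 : √((T : ℝ) + 1) * Real.log (T + 1) * √(T + 1) = (T + 1) * Real.log (T + 1) := by
    rw [mul_right_comm, h3]
  nlinarith

theorem tendsto_rate : Tendsto rate atTop (𝓝 0) := by
  have h := (tendsto_log_card_experts_div.const_mul 8).sqrt
  simp only [mul_zero, Real.sqrt_zero] at h
  refine h.congr fun T => ?_
  rw [rate, mul_div_assoc]

/-- The identity `rate T ^ 2 = 8 * log N / T`, with `N` experts, turns `log N / rate T` into `rate T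
* T / 8`; together with `rate T * T / 2` this is the coefficient `5 / 8`. -/
theorem regretBound_div {T : ℕ} (hT : 1 ≤ T) (ε : ℝ) :
    (1 / (T : ℝ)) * regretBound ε T =
      4 * ε + (Real.log (experts T).card / T + 1 / T + 5 / 8 * rate T) := by
  have hT0 : (0 : ℝ) < T := by exact_mod_cast hT
  have hr := rate_pos hT
  have h1 : rate T * rate T = 8 * Real.log (experts T).card / T :=
    Real.mul_self_sqrt (div_nonneg (mul_nonneg (by norm_num) (log_card_experts_nonneg T)) hT0.le)
  have h2 : Real.log (experts T).card / rate T = rate T * T / 8 := by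
    rw [div_eq_iff hr.ne', div_mul_eq_mul_div, mul_right_comm, h1]
    field_simp
  rw [regretBound, h2]
  field_simp
  ring

theorem isOptimistic_of_isTreeHedge {X : Type*} [MeasurableSpace X] [StandardBorelSpace X]
    {F : Set (X → Bool)} {r : X → Bool} (hF : ∀ f ∈ F, Measurable f)
    (hbest : ∀ T : ℕ, Measurable fun D : Fin T → X × Bool => bestLoss F D)
    (hVC : vcDim F = 1) (hr : r ∈ F) {L : ℕ → Learner X} (hL : IsTreeHedge F r L)
    (σ : Setting) : IsOptimistic σ F L := by
  intro U hU
  have hlim : Tendsto (fun T : ℕ => Real.log (experts T).card / T + 1 / (T : ℝ) +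
      5 / 8 * rate T) atTop (𝓝 0) := by
    simpa using (tendsto_log_card_experts_div.add tendsto_one_div_atTop_nhds_zero_nat).add
      (tendsto_rate.const_mul (5 / 8))
  rw [Metric.tendsto_atTop]
  intro δ hδ
  -- With `ε = δ / 8` the linear term `4 * ε` is `δ / 2`. The horizon must also exceed `K * K`, so
  -- that experts with `K` updates belong to the pool.
  obtain ⟨K, hK, H⟩ := exists_not_hasLadder_of_learnable hF hbest hVC hr
    (show 0 < δ / 8 by positivity) hU
  obtain ⟨T₀, hT₀⟩ := eventually_atTop.1 (hlim.eventually (gt_mem_nhds (half_pos hδ)))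
  refine ⟨max T₀ (K * K), fun T hT => ?_⟩
  have hKT : K * K ≤ T := (le_max_right _ _).trans hT
  have hT1 : 1 ≤ T := (Nat.mul_pos hK hK).trans_le hKT
  have h0 := worstRegret_nonneg (U := U) hF hr T (L T) σ
  have h1 := worstRegret_le_of_not_hasLadder hF hbest hVC hr (by positivity) hL hK H
    (Nat.le_sqrt.2 hKT) (rate_pos hT1)
  have h2 := mul_le_mul_of_nonneg_left h1 (show (0 : ℝ) ≤ 1 / T by positivity)
  rw [regretBound_div hT1] at h2
  have h3 := hT₀ T ((le_max_left _ _).trans hT)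
  rw [Real.dist_0_eq_abs, abs_of_nonneg (by positivity)]
  linarith

end DistOnline

theorem mainTheorem10 {X : Type*} [MeasurableSpace X] [StandardBorelSpace X]
    (F : Set (X → Bool)) (hF : ∀ f ∈ F, Measurable f)
    (hbest : ∀ T : ℕ, Measurable fun D : Fin T → X × Bool => DistOnline.bestLoss F D)
    (hVC : DistOnline.vcDim F = 1) :
    ∃ r ∈ F, ∃ L : ℕ → DistOnline.Learner X,
      DistOnline.IsTreeHedge F r L ∧
        ∀ σ : DistOnline.Setting, DistOnline.IsOptimistic σ F L := by
  obtain ⟨r, hr⟩ := DistOnline.nonempty_of_vcDim hVC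
  obtain ⟨L, hL⟩ := DistOnline.exists_isTreeHedge (hF r hr)
    (DistOnline.measurableSet_treeLE hF hr hbest)
  exact ⟨r, hr, L, hL, DistOnline.isOptimistic_of_isTreeHedge hF hbest hVC hr hL⟩
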